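/- **Theorem (high-probability bound on the conditional expected regret of IRGP-UCB, finite domain).** Let $\mathcal X$ be a finite nonempty set, let $k:\mathcal X\times\mathcal X\to\mathbb R$ be a positive semidefinite kernel with $k(x,x)\le 1$ for all $x$, let $\sigma>0$ and $\delta\in(0,1)$. Let $f$ be a Gaussian process on $\mathcal X$ with mean zero and covariance kernel $k$, let $\epsilon_1,\epsilon_2,\dots$ be i.i.d. $\mathcal N(0,\sigma^2)$, and let $\zeta_1,\zeta_2,\dots$ be i.i.d. with the shifted exponential density $\tfrac12 e^{-(\zeta-s)/2}\mathbf 1\{\zeta\ge s\}$, where $s = s_t = 2\log(|\mathcal X|/2)$ for all $t$; assume that $f$, $(\epsilon_t)_{t\ge1}$ and $(\zeta_t)_{t\ge1}$ are independent. Run IRGP-UCB: for $t=1,2,\dots$, given the queries $x_1,\dots,x_{t-1}$ and observations $y_i=f(x_i)+\epsilon_i$, $i<t$, put $\mathbf y=(y_i)_{i<t}$, $\mathbf K=(k(x_i,x_j))_{i,j<t}$, $\mathbf k(x)=(k(x,x_i))_{i<t}$, $$\mu_{t-1}(x)=\mathbf k(x)^\top(\mathbf K+\sigma^2\mathbf I)^{-1}\mathbf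 y,\qquad \sigma_{t-1}^2(x)=k(x,x)-\mathbf k(x)^\top(\mathbf K+\sigma^2\mathbf I)^{-1}\mathbf k(x),$$ and choose $x_t\in\operatorname{argmax}_{x\in\mathcal X}\bigl\{\mu_{t-1}(x)+\zeta_t^{1/2}\sigma_{t-1}(x)\bigr\}$, where ties are broken in any way that depends measurably only on $y_1,\dots,y_{t-1}$ and $\zeta_1,\dots,\zeta_t$. Let $R_T=\sum_{t=1}^T\bigl(\max_{x\in\mathcal X}f(x)-f(x_t)\bigr)$ be the cumulative regret and $$\gamma_T=\max_{a_1,\dots,a_T\in\mathcal X} I\bigl((f(a_i)+\epsilon_i)_{i\le T};(f(a_i))_{i\le T}\bigr)$$ the maximum information gain, where $I$ is the Shannon mutual information and repetitions among the $a_i$ are allowed. Then $R_T$ is integrable for every $T$, and $$\Pr\Bigl(\forall\, T\ge1:\ \mathbb E\bigl[R_T\mid(\zeta_t)_{t\ge1}\bigr]\le U(T,\delta)\Bigr)\ge 1-\delta,$$ where, with $C_1=2/\log(1+\sigma^{-2})$ and $L_T=\log\bigl(\pi^2T^2/(3\delta)\bigr)$, $$U(T,\delta)=6\sqrt{T L_T}+\sqrt{C_1\gamma_T\bigl(Ts+T+2\sqrt{T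 L_T}+2L_T\bigr)}.$$ (Square roots of negative numbers are read as $0$; this matters only when $|\mathcal X|=1$.) -/

import Mathlib

open MeasureTheory ProbabilityTheory Matrix
open scoped ENNReal NNReal

noncomputable section

namespace IRGPUCB

variable {X Ω : Type*}

/-! ### Gaussian process posterior

`q 0, …, q (n - 1)` are the inputs observed so far, `y 0, …, y (n - 1)` the noisy outputs and
`σ` is the standard deviation of the noise. -/

/-- The kernel matrix `K = (k (q i) (q j))`. -/
def kernelMatrix (k : X → X → ℝ) {n : ℕ} (q : Fin n → X) : Matrix (Fin n) (Fin n) ℝ :=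
  Matrix.of fun i j => k (q i) (q j)

/-- The vector `(k z (q i))`. -/
def kernelVec (k : X → X → ℝ) {n : ℕ} (q : Fin n → X) (z : X) : Fin n → ℝ :=
  fun i => k z (q i)

/-- Posterior mean `k(z)ᵀ (K + σ² I)⁻¹ y`. -/
def postMean (k : X → X → ℝ) (σ : ℝ) {n : ℕ} (q : Fin n → X) (y : Fin n → ℝ) (z : X) : ℝ :=
  kernelVec k q z ⬝ᵥ ((kernelMatrix k q + σ ^ 2 • (1 : Matrix (Fin n) (Fin n) ℝ))⁻¹ *ᵥ y)

/-- Posterior variance `k(z, z) - k(z)ᵀ (K + σ² I)⁻¹ k(z)`. -/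
def postVar (k : X → X → ℝ) (σ : ℝ) {n : ℕ} (q : Fin n → X) (z : X) : ℝ :=
  k z z - kernelVec k q z ⬝ᵥ
    ((kernelMatrix k q + σ ^ 2 • (1 : Matrix (Fin n) (Fin n) ℝ))⁻¹ *ᵥ kernelVec k q z)

/-- The randomized upper confidence bound `μ(z) + √ζ · σ(z)` with the confidence parameter `c`
in place of `ζ`. -/
def ucb (k : X → X → ℝ) (σ : ℝ) {n : ℕ} (q : Fin n → X) (y : Fin n → ℝ) (c : ℝ) (z : X) : ℝ :=
  postMean k σ q y z + √c * √(postVar k σ q z)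

/-! ### Probabilistic model -/

/-- The shifted exponential distribution with density `r * exp (-r (z - s))` on `z ≥ s`. -/
def shiftedExp (s r : ℝ) : Measure ℝ :=
  volume.withDensity fun z => ENNReal.ofReal (if s ≤ z then r * Real.exp (-(r * (z - s))) else 0)

/-- `f` is a sample path of the Gaussian process with mean zero and covariance kernel `k`, and
`ε 0, ε 1, …` are i.i.d. centred Gaussian noises with variance `σ²`, independent of `f`. -/
structure IsGPModel [MeasurableSpace Ω] (P : Measure Ω) (k : X → X → ℝ) (σ : ℝ)
    (f : X → Ω → ℝ) (ε : ℕ → Ω → ℝ) : Prop where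
  measurable_f : ∀ z, Measurable (f z)
  gaussian_f : IsGaussianProcess f P
  mean_f : ∀ z, ∫ ω, f z ω ∂P = 0
  cov_f : ∀ z w, cov[f z, f w; P] = k z w
  measurable_noise : ∀ t, Measurable (ε t)
  law_noise : ∀ t, HasLaw (ε t) (gaussianReal 0 (σ ^ 2).toNNReal) P
  iIndep_noise : iIndepFun ε P
  indep_f_noise : IndepFun (fun ω z => f z ω) (fun ω t => ε t ω) P

/-- The noisy observation at step `t`, when the inputs `x 0, x 1, …` are queried. -/
def obs (f : X → Ω → ℝ) (ε : ℕ → Ω → ℝ) (x : ℕ → Ω → X) (t : ℕ) (ω : Ω) : ℝ :=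
  f (x t ω) ω + ε t ω

/-- The information available when the query of step `t` is chosen: the observations of the
steps before `t`, and the confidence parameters up to and including step `t`. -/
abbrev history (f : X → Ω → ℝ) (ε : ℕ → Ω → ℝ) (ζ : ℕ → Ω → ℝ) (x : ℕ → Ω → X) (t : ℕ) :
    MeasurableSpace Ω :=
  MeasurableSpace.comap
    (fun ω => ((fun i : Fin t => obs f ε x i ω), (fun i : Fin (t + 1) => ζ i ω))) inferInstance

/-- The queries `x 0, x 1, …` are produced by running IRGP-UCB with confidence parameters
`ζ 0, ζ 1, …` drawn independently from the shifted exponential distribution with shift `s` and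
rate `1 / 2`. Steps are counted from `0`, so that `t` previous observations are available at
step `t`. Ties in the maximization may be broken in any way that uses only the available
information. -/
structure IsIRGPUCBRun [MeasurableSpace Ω] (P : Measure Ω) (k : X → X → ℝ) (σ s : ℝ)
    (f : X → Ω → ℝ) (ε : ℕ → Ω → ℝ) (ζ : ℕ → Ω → ℝ) (x : ℕ → Ω → X) : Prop where
  measurable_param : ∀ t, Measurable (ζ t)
  law_param : ∀ t, HasLaw (ζ t) (shiftedExp s (1 / 2)) P
  iIndep_param : iIndepFun ζ P
  indep_model_param :
    IndepFun (fun ω => ((fun z => f z ω), (fun t => ε t ω))) (fun ω t => ζ t ω) P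
  query_measurable : ∀ t, Measurable[history f ε ζ x t, ⊤] (x t)
  query_isMax : ∀ t ω z,
    ucb k σ (fun i : Fin t => x i ω) (fun i : Fin t => obs f ε x i ω) (ζ t ω) z ≤
      ucb k σ (fun i : Fin t => x i ω) (fun i : Fin t => obs f ε x i ω) (ζ t ω) (x t ω)

/-- The σ-algebra generated by all confidence parameters. -/
abbrev paramSigma (ζ : ℕ → Ω → ℝ) : MeasurableSpace Ω :=
  MeasurableSpace.comap (fun ω t => ζ t ω) inferInstance

/-- The cumulative regret of the first `T` steps, `∑ (max f - f (x t))`. -/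
def cumRegret (f : X → Ω → ℝ) (x : ℕ → Ω → X) (T : ℕ) (ω : Ω) : ℝ :=
  ∑ t ∈ Finset.range T, ((⨆ z, f z ω) - f (x t ω) ω)

/-! ### Maximum information gain -/

/-- Shannon mutual information of two random variables: the Kullback-Leibler divergence of
their joint law from the product of their laws. -/
def mutualInfo {A B : Type*} [MeasurableSpace A] [MeasurableSpace B] [MeasurableSpace Ω]
    (P : Measure Ω) (Y : Ω → A) (Z : Ω → B) : ℝ≥0∞ :=
  InformationTheory.klDiv (P.map fun ω => (Y ω, Z ω)) ((P.map Y).prod (P.map Z))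

/-- The maximum information gain `γ_T`: the maximum, over all choices of `T` inputs (with
repetitions), of the mutual information of the noisy and the noise-free outputs. -/
def maxInfoGain [MeasurableSpace Ω] (P : Measure Ω) (f : X → Ω → ℝ) (ε : ℕ → Ω → ℝ)
    (T : ℕ) : ℝ :=
  (⨆ a : Fin T → X, mutualInfo P (fun ω (i : Fin T) => f (a i) ω + ε i ω)
    (fun ω (i : Fin T) => f (a i) ω)).toReal

/-! ### The regret bound -/

/-- The shift `2 log (n / 2)` of the confidence parameters for a domain with `n` points. -/
def shift (n : ℕ) : ℝ := 2 * Real.log (n / 2)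

/-- The bound `U(T, δ)` for noise level `σ`, maximum information gain `γ` and shift `s`. -/
def regretBound (σ γ s : ℝ) (T : ℕ) (δ : ℝ) : ℝ :=
  6 * √(T * Real.log (Real.pi ^ 2 * T ^ 2 / (3 * δ))) +
    √(2 / Real.log (1 + (σ ^ 2)⁻¹) * γ *
      (T * s + T + 2 * √(T * Real.log (Real.pi ^ 2 * T ^ 2 / (3 * δ))) +
        2 * Real.log (Real.pi ^ 2 * T ^ 2 / (3 * δ))))

end IRGPUCB

end

open IRGPUCB

/-! Condition on the data before a step. The posterior is Gaussian with means m y and standard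
deviations s y ≤ 1, and the query maximizes m y + b s y, where b = √ζ. Let x be the square root of
the shift, so that |X| = 2 exp(x²/2), and let env(b) be the maximum of these lines. With n standard
normal, a union bound gives E max f ≤ env(x) + Σ_y E(m y + n s y - env(x))₊, which is `optBound`.
Each summand is at most E(env(max n x) - env(x)), so |X| times the Gaussian tail enters. The law of
b has the larger Rayleigh tail exp(-(b² - x²)/2). The difference of the two tails, divided by the
Rayleigh density, is `millsGap`. Since env has slope s at the selected point, integration by parts
yields `optBound` ≤ E[env(b) - s · millsGap(b)]. Without the gap, Cauchy-Schwarz would use E b² = x²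
+ 2; with it, b is replaced by b - millsGap(b), whose second moment is at most x² + 1
(`integral_sub_millsGap_sq_le`). This is where the constant s + 1 of the bound comes from.

Cauchy-Schwarz is used in linearized form: `stepGap` is the regret bound of a step minus C s² + (x²
+ 1)/(4C), for a fixed C > 0. Given the past, its exponential moments are at most exp(9 l²)
(`lintegral_exp_optBound_le`). With three or more points it is dominated by Y - E Y for a function Y
of b that is Lipschitz up to a bounded error, and a symmetrization argument applies. With two points
the shift is 0 and the Mills ratio estimates, which need b ≥ 0.9, are not available; there the gap
is either nonpositive or takes two values, and is estimated by hand.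

Each ζ_t is independent of the past, so the moments multiply to exp(9 l² T)
(`lintegral_exp_sum_stepGap_le`). Conditional Jensen and Chernoff pass this to the conditional
expectation given all ζ: a deviation 6√(T L_T) has probability at most exp(-L_T) = 3δ/(π²T²), with
sum δ/2 over T. The terms C s² add up along every path to at most C · C₁ γ_T, because the
information gain of a design is ½ Σ log(1 + postVar/σ²) (`klDiv_fixedObs`, `sum_postVar_le`). The
best C then gives √(C₁ γ_T T(s + 1)); the remaining terms under the root are slack.

Adaptivity is handled by fibers. Where the queries follow a fixed design, the observations are those
of that design, and this event is determined by them and ζ. The posterior error of the design is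
independent of both (`indepFun_postError_fixedData`). -/

namespace IRGPUCB

/-! ### The posterior of a Gaussian process for a fixed design -/

section Posterior

variable {X Ω : Type*} {k : X → X → ℝ} {σ : ℝ} {n : ℕ}

/-- The covariance matrix `K + σ² I` of the noisy observations. -/
def obsCov (k : X → X → ℝ) (σ : ℝ) {n : ℕ} (q : Fin n → X) : Matrix (Fin n) (Fin n) ℝ :=
  kernelMatrix k q + σ ^ 2 • (1 : Matrix (Fin n) (Fin n) ℝ)

/-- The weights of the observations in the posterior mean. -/
noncomputable def postWeight (k : X → X → ℝ) (σ : ℝ) {n : ℕ} (q : Fin n → X) (z : X) :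
    Fin n → ℝ :=
  kernelVec k q z ᵥ* (obsCov k σ q)⁻¹

lemma postMean_eq_sum (q : Fin n → X) (y : Fin n → ℝ) (z : X) :
    postMean k σ q y z = ∑ i, postWeight k σ q z i * y i := by
  rw [postMean, dotProduct_mulVec]; rfl

lemma postVar_eq_sub_sum (q : Fin n → X) (z : X) :
    postVar k σ q z = k z z - ∑ i, postWeight k σ q z i * k z (q i) := by
  rw [postVar, dotProduct_mulVec]; rfl

lemma measurable_postMean (q : Fin n → X) (z : X) :
    Measurable fun y : Fin n → ℝ => postMean k σ q y z := by
  simp_rw [postMean_eq_sum]; fun_prop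

lemma posDef_obsCov [Fintype X] (hk : (Matrix.of k).PosSemidef) (hσ : 0 < σ) (q : Fin n → X) :
    (obsCov k σ q).PosDef := by
  have h1 : (kernelMatrix k q).PosSemidef := hk.submatrix q
  exact Matrix.PosDef.posSemidef_add h1 (Matrix.PosDef.one.smul (by positivity))

/-- These are the normal equations of linear prediction. They make the posterior error uncorrelated
with the observations. -/
lemma postWeight_vecMul_obsCov [Fintype X] (hk : (Matrix.of k).PosSemidef) (hσ : 0 < σ)
    (q : Fin n → X) (z : X) : postWeight k σ q z ᵥ* obsCov k σ q = kernelVec k q z := by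
  have h : IsUnit (obsCov k σ q).det :=
    (Matrix.isUnit_iff_isUnit_det _).1 (posDef_obsCov hk hσ q).isUnit
  rw [postWeight, vecMul_vecMul, nonsing_inv_mul _ h, vecMul_one]

lemma postVar_le [Fintype X] (hk : (Matrix.of k).PosSemidef) (hσ : 0 < σ)
    (q : Fin n → X) (z : X) : postVar k σ q z ≤ k z z := by
  have h := (posDef_obsCov hk hσ q).inv.posSemidef.dotProduct_mulVec_nonneg (kernelVec k q z)
  simp only [star_trivial] at h
  unfold obsCov at h
  rw [postVar]; linarith

/-- The noisy observations for a fixed design. -/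
def fixedObs (f : X → Ω → ℝ) (ε : ℕ → Ω → ℝ) {n : ℕ} (q : Fin n → X) (ω : Ω) (i : Fin n) : ℝ :=
  f (q i) ω + ε i ω

/-- The error of the posterior mean for a fixed design. -/
noncomputable def postError (k : X → X → ℝ) (σ : ℝ) (f : X → Ω → ℝ) (ε : ℕ → Ω → ℝ) {n : ℕ}
    (q : Fin n → X) (z : X) (ω : Ω) : ℝ :=
  f z ω - postMean k σ q (fixedObs f ε q ω) z

/-- The posterior error is a linear function of the sample path and the noise. -/
lemma exists_linear_postError {f : X → Ω → ℝ} {ε : ℕ → Ω → ℝ} (q : Fin n → X) (z : X) :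
    ∃ L : ((X → ℝ) × (Fin n → ℝ)) →ₗ[ℝ] ℝ × (Fin n → ℝ), ∀ ω,
      L ((fun z => f z ω), fun i : Fin n => ε i ω) =
        (postError k σ f ε q z ω, fixedObs f ε q ω) := by
  let L : ((X → ℝ) × (Fin n → ℝ)) →ₗ[ℝ] ℝ × (Fin n → ℝ) :=
    { toFun := fun v => (v.1 z - ∑ i, postWeight k σ q z i * (v.1 (q i) + v.2 i),
        fun i => v.1 (q i) + v.2 i)
      map_add' := fun v w => by
        ext
        · simp only [Prod.fst_add, Pi.add_apply, Prod.snd_add, Prod.mk_add_mk]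
          rw [sub_add_sub_comm, ← Finset.sum_add_distrib]
          congr 1
          exact Finset.sum_congr rfl fun i _ => by ring
        · simp; ring
      map_smul' := fun c v => by
        ext
        · simp only [Prod.smul_fst, Pi.smul_apply, smul_eq_mul, Prod.smul_snd, RingHom.id_apply,
            mul_sub, Finset.mul_sum]
          congr 1
          exact Finset.sum_congr rfl fun i _ => by ring
        · simp; ring }
  refine ⟨L, fun ω => ?_⟩
  simp only [postError, postMean_eq_sum]; rfl

variable [MeasurableSpace Ω] {P : Measure Ω} {f : X → Ω → ℝ} {ε : ℕ → Ω → ℝ}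

namespace IsGPModel

variable (hm : IsGPModel P k σ f ε)
include hm

lemma hasGaussianLaw_noise [IsProbabilityMeasure P] (t : ℕ) : HasGaussianLaw (ε t) P :=
  (hm.law_noise t).hasGaussianLaw

lemma hasGaussianLaw_model [IsProbabilityMeasure P] [Fintype X] (n : ℕ) :
    HasGaussianLaw (fun ω => ((fun z => f z ω), fun i : Fin n => ε i ω)) P := by
  refine IndepFun.hasGaussianLaw ?_ ?_ ?_
  · have h := (hm.gaussian_f.hasGaussianLaw Finset.univ).map
      (ContinuousLinearMap.pi fun z : X => ContinuousLinearMap.proj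
        (⟨z, Finset.mem_univ z⟩ : (Finset.univ : Finset X)))
    exact h
  · have h : iIndepFun (fun i : Fin n => ε i) P :=
      hm.iIndep_noise.precomp (g := fun i : Fin n => (i : ℕ)) Fin.val_injective
    exact h.hasGaussianLaw fun _ => hm.hasGaussianLaw_noise _
  · exact hm.indep_f_noise.comp (φ := id) (ψ := fun e (i : Fin n) => e i) measurable_id
      (by fun_prop)

lemma hasGaussianLaw_linear [IsProbabilityMeasure P] [Fintype X] {E : Type*}
    [NormedAddCommGroup E] [MeasurableSpace E] [BorelSpace E] [NormedSpace ℝ E] (n : ℕ)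
    (L : ((X → ℝ) × (Fin n → ℝ)) →ₗ[ℝ] E) :
    HasGaussianLaw (fun ω => L ((fun z => f z ω), fun i : Fin n => ε i ω)) P :=
  (hm.hasGaussianLaw_model n).map_fun (LinearMap.toContinuousLinearMap L)

lemma memLp_f [IsProbabilityMeasure P] (z : X) : MemLp (f z) 2 P :=
  (hm.gaussian_f.hasGaussianLaw_eval z).memLp_two

lemma memLp_noise [IsProbabilityMeasure P] (t : ℕ) : MemLp (ε t) 2 P :=
  (hm.hasGaussianLaw_noise t).memLp_two

lemma memLp_fixedObs [IsProbabilityMeasure P] (q : Fin n → X) (i : Fin n) :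
    MemLp (fun ω => fixedObs f ε q ω i) 2 P :=
  (hm.memLp_f _).add (hm.memLp_noise _)

lemma measurable_fixedObs (q : Fin n → X) : Measurable (fixedObs f ε q) :=
  measurable_pi_lambda _ fun _ => (hm.measurable_f _).add (hm.measurable_noise _)

lemma measurable_postError (q : Fin n → X) (z : X) : Measurable (postError k σ f ε q z) :=
  (hm.measurable_f z).sub ((measurable_postMean q z).comp (hm.measurable_fixedObs q))

lemma integral_noise [IsProbabilityMeasure P] (t : ℕ) : ∫ ω, ε t ω ∂P = 0 := by
  rw [(hm.law_noise t).integral_eq]; simp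

lemma cov_f_noise [IsProbabilityMeasure P] (z : X) (t : ℕ) : cov[f z, ε t; P] = 0 := by
  have h1 : Measurable fun g : X → ℝ => g z := measurable_pi_apply z
  have h2 : Measurable fun e : ℕ → ℝ => e t := measurable_pi_apply t
  have h := hm.indep_f_noise.comp h1 h2
  exact h.covariance_eq_zero (hm.memLp_f z) (hm.memLp_noise t)

lemma cov_noise [IsProbabilityMeasure P] (s t : ℕ) :
    cov[ε s, ε t; P] = if s = t then σ ^ 2 else 0 := by
  split_ifs with h
  · subst h
    rw [covariance_self (hm.measurable_noise s).aemeasurable, (hm.law_noise s).variance_eq]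
    simp [variance_id_gaussianReal, sq_nonneg]
  · exact (hm.iIndep_noise.indepFun h).covariance_eq_zero (hm.memLp_noise s) (hm.memLp_noise t)

lemma cov_f_fixedObs [IsProbabilityMeasure P] (q : Fin n → X) (z : X) (j : Fin n) :
    cov[f z, fun ω => fixedObs f ε q ω j; P] = k z (q j) := by
  have := covariance_add_right (hm.memLp_f z) (hm.memLp_f (q j)) (hm.memLp_noise (j : ℕ))
  rw [hm.cov_f, hm.cov_f_noise, add_zero] at this
  exact this

lemma cov_fixedObs_fixedObs [IsProbabilityMeasure P] (q : Fin n → X) (i j : Fin n) :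
    cov[fun ω => fixedObs f ε q ω i, fun ω => fixedObs f ε q ω j; P] = obsCov k σ q i j := by
  have h1 : cov[fun ω => fixedObs f ε q ω i, fun ω => fixedObs f ε q ω j; P] = _ :=
    covariance_add_left (hm.memLp_f (q i)) (hm.memLp_noise (i : ℕ)) (hm.memLp_fixedObs q j)
  have h2 : cov[ε i, fun ω => fixedObs f ε q ω j; P] = _ :=
    covariance_add_right (hm.memLp_noise (i : ℕ)) (hm.memLp_f (q j)) (hm.memLp_noise (j : ℕ))
  rw [h1, h2, hm.cov_f_fixedObs, covariance_comm (ε i), hm.cov_f_noise, hm.cov_noise, zero_add]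
  simp [obsCov, kernelMatrix, Matrix.one_apply, Fin.ext_iff]

lemma cov_postError_left [IsProbabilityMeasure P] (q : Fin n → X) (z : X) {Y : Ω → ℝ}
    (hY : MemLp Y 2 P) :
    cov[postError k σ f ε q z, Y; P] = cov[f z, Y; P] -
      ∑ i, postWeight k σ q z i * cov[fun ω => fixedObs f ε q ω i, Y; P] := by
  have h0 : postError k σ f ε q z =
      fun ω => f z ω - ∑ i, postWeight k σ q z i * fixedObs f ε q ω i := by
    ext ω; rw [postError, postMean_eq_sum]
  have h1 : ∀ i, MemLp (fun ω => postWeight k σ q z i * fixedObs f ε q ω i) 2 P :=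
    fun i => (hm.memLp_fixedObs q i).const_mul _
  rw [h0, covariance_fun_sub_left (hm.memLp_f z) (memLp_finsetSum _ fun i _ => h1 i) hY,
    covariance_fun_sum_left h1 hY]
  simp_rw [covariance_const_mul_left]

lemma memLp_postError [IsProbabilityMeasure P] (q : Fin n → X) (z : X) :
    MemLp (postError k σ f ε q z) 2 P := by
  have h0 : postError k σ f ε q z =
      fun ω => f z ω - ∑ i, postWeight k σ q z i * fixedObs f ε q ω i := by
    ext ω; rw [postError, postMean_eq_sum]
  rw [h0]
  exact (hm.memLp_f z).sub (memLp_finsetSum _ fun i _ => (hm.memLp_fixedObs q i).const_mul _)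

lemma cov_postError_fixedObs [IsProbabilityMeasure P] [Fintype X] (hk : (Matrix.of k).PosSemidef)
    (hσ : 0 < σ) (q : Fin n → X) (z : X) (j : Fin n) :
    cov[postError k σ f ε q z, fun ω => fixedObs f ε q ω j; P] = 0 := by
  rw [hm.cov_postError_left q z (hm.memLp_fixedObs q j), hm.cov_f_fixedObs]
  simp_rw [hm.cov_fixedObs_fixedObs]
  have := congrFun (postWeight_vecMul_obsCov hk hσ q z) j
  simp only [vecMul, dotProduct, kernelVec] at this
  linarith

/-- The error is orthogonal to the observations, so its variance is its covariance with `f z` alone.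
-/
lemma variance_postError [IsProbabilityMeasure P] [Fintype X] (hk : (Matrix.of k).PosSemidef)
    (hσ : 0 < σ) (q : Fin n → X) (z : X) :
    Var[postError k σ f ε q z; P] = postVar k σ q z := by
  have h1 := hm.cov_postError_left q z (hm.memLp_postError q z)
  rw [covariance_self (hm.measurable_postError q z).aemeasurable] at h1
  rw [h1, Finset.sum_eq_zero, sub_zero, covariance_comm,
    hm.cov_postError_left q z (hm.memLp_f z), hm.cov_f, postVar_eq_sub_sum]
  · congr 1
    refine Finset.sum_congr rfl fun i _ => ?_
    rw [covariance_comm, hm.cov_f_fixedObs]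
  · intro i _
    rw [covariance_comm, hm.cov_postError_fixedObs hk hσ, mul_zero]

lemma postVar_nonneg [IsProbabilityMeasure P] [Fintype X] (hk : (Matrix.of k).PosSemidef)
    (hσ : 0 < σ) (q : Fin n → X) (z : X) : 0 ≤ postVar k σ q z := by
  rw [← hm.variance_postError hk hσ]; exact variance_nonneg _ _

/-- Error and observations are jointly Gaussian, being a linear image of sample path and noise, and
they are uncorrelated. -/
lemma indepFun_postError_fixedObs [IsProbabilityMeasure P] [Fintype X]
    (hk : (Matrix.of k).PosSemidef) (hσ : 0 < σ) (q : Fin n → X) (z : X) :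
    IndepFun (postError k σ f ε q z) (fixedObs f ε q) P := by
  obtain ⟨L, hL⟩ := exists_linear_postError (k := k) (σ := σ) (f := f) (ε := ε) q z
  -- The scalar error becomes a vector indexed by `Unit`, the form in which uncorrelated Gaussian
  -- families are independent.
  let L' : ℝ × (Fin n → ℝ) →ₗ[ℝ] (Unit → ℝ) × (Fin n → ℝ) :=
    LinearMap.prodMap (LinearMap.pi fun _ => LinearMap.id) LinearMap.id
  have h1 := hm.hasGaussianLaw_linear n (L' ∘ₗ L)
  have h2 : HasGaussianLaw (fun ω => ((fun _ : Unit => postError k σ f ε q z ω),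
      fun j => fixedObs f ε q ω j)) P := by
    have e : (fun ω => ((fun _ : Unit => postError k σ f ε q z ω), fun j => fixedObs f ε q ω j)) =
        fun ω => (L' ∘ₗ L) ((fun z => f z ω), fun i : Fin n => ε i ω) := by
      funext ω
      change _ = L' (L _)
      rw [hL]; rfl
    rw [e]; exact h1
  have h3 := HasGaussianLaw.indepFun_of_covariance_eval
    (X := fun _ : Unit => postError k σ f ε q z) (Y := fun j ω => fixedObs f ε q ω j) h2
    fun _ j => hm.cov_postError_fixedObs hk hσ q z j
  exact h3.comp (φ := fun g : Unit → ℝ => g ()) (ψ := id) (by fun_prop) measurable_id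

lemma hasGaussianLaw_postError [IsProbabilityMeasure P] [Fintype X] (q : Fin n → X) (z : X) :
    HasGaussianLaw (postError k σ f ε q z) P := by
  obtain ⟨L, hL⟩ := exists_linear_postError (k := k) (σ := σ) (f := f) (ε := ε) q z
  have h1 := hm.hasGaussianLaw_linear n (LinearMap.fst ℝ _ _ ∘ₗ L)
  have h2 : (fun ω => (LinearMap.fst ℝ ℝ (Fin n → ℝ) ∘ₗ L)
      ((fun z => f z ω), fun i : Fin n => ε i ω)) = postError k σ f ε q z := by
    ext ω; rw [LinearMap.comp_apply, hL]; rfl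
  rwa [h2] at h1

lemma integral_postError [IsProbabilityMeasure P] (q : Fin n → X) (z : X) :
    ∫ ω, postError k σ f ε q z ω ∂P = 0 := by
  have h0 : postError k σ f ε q z =
      fun ω => f z ω - ∑ i, postWeight k σ q z i * fixedObs f ε q ω i := by
    ext ω; rw [postError, postMean_eq_sum]
  have h1 : ∀ i, Integrable (fun ω => fixedObs f ε q ω i) P :=
    fun i => (hm.memLp_fixedObs q i).integrable (by norm_num)
  rw [h0, integral_sub ((hm.memLp_f z).integrable (by norm_num))
    (integrable_finsetSum _ fun i _ => (h1 i).const_mul _), hm.mean_f,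
    integral_finsetSum _ fun i _ => (h1 i).const_mul _, Finset.sum_eq_zero, sub_zero]
  intro i _
  rw [integral_const_mul]
  have : ∫ ω, fixedObs f ε q ω i ∂P = _ :=
    integral_add ((hm.memLp_f (q i)).integrable (by norm_num))
      ((hm.memLp_noise (i : ℕ)).integrable (by norm_num))
  rw [this, hm.mean_f, hm.integral_noise]; simp

lemma map_postError [IsProbabilityMeasure P] [Fintype X] (hk : (Matrix.of k).PosSemidef)
    (hσ : 0 < σ) (q : Fin n → X) (z : X) :
    P.map (postError k σ f ε q z) = gaussianReal 0 (postVar k σ q z).toNNReal := by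
  rw [(hm.hasGaussianLaw_postError q z).map_eq_gaussianReal, hm.integral_postError,
    hm.variance_postError hk hσ]

end IsGPModel

end Posterior

open Set Filter Topology Real

/-! ### Gaussian tails -/

section GaussTail

/-- The unnormalized Gaussian tail `∫ n in (b, ∞), exp (-n² / 2)`. -/
noncomputable def gaussTail (b : ℝ) : ℝ := ∫ n in Ioi b, rexp (-n ^ 2 / 2)

lemma integrable_exp_neg_sq_half : Integrable fun n : ℝ => rexp (-n ^ 2 / 2) := by
  have := integrable_exp_neg_mul_sq (b := 1 / 2) (by norm_num)
  refine this.congr (.of_forall fun n => ?_)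
  simp only; congr 1; ring

lemma integrable_mul_exp_neg_sq_half : Integrable fun n : ℝ => n * rexp (-n ^ 2 / 2) := by
  have := integrable_mul_exp_neg_mul_sq (b := 1 / 2) (by norm_num)
  refine this.congr (.of_forall fun n => ?_)
  simp only; congr 2; ring

lemma gaussTail_nonneg (b : ℝ) : 0 ≤ gaussTail b :=
  setIntegral_nonneg measurableSet_Ioi fun _ _ => (exp_pos _).le

lemma gaussTail_eq_sub (b : ℝ) :
    gaussTail b = gaussTail 0 - ∫ n in (0 : ℝ)..b, rexp (-n ^ 2 / 2) := by
  have := intervalIntegral.integral_Ioi_sub_Ioi' (a := 0) (b := b) (μ := volume)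
    integrable_exp_neg_sq_half.integrableOn integrable_exp_neg_sq_half.integrableOn
  rw [gaussTail, gaussTail, ← this]; ring

lemma hasDerivAt_gaussTail (b : ℝ) : HasDerivAt gaussTail (-rexp (-b ^ 2 / 2)) b := by
  have hc : Continuous fun n : ℝ => rexp (-n ^ 2 / 2) := by fun_prop
  have h := (intervalIntegral.integral_hasDerivAt_right (hc.intervalIntegrable 0 b)
    hc.stronglyMeasurable.stronglyMeasurableAtFilter hc.continuousAt).const_sub (gaussTail 0)
  exact h.congr_of_eventuallyEq (.of_forall gaussTail_eq_sub)

lemma continuous_gaussTail : Continuous gaussTail :=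
  continuous_iff_continuousAt.2 fun b => (hasDerivAt_gaussTail b).continuousAt

lemma hasDerivAt_exp_neg_sq_half (b : ℝ) :
    HasDerivAt (fun n : ℝ => rexp (-n ^ 2 / 2)) (-b * rexp (-b ^ 2 / 2)) b := by
  have h : HasDerivAt (fun n : ℝ => -n ^ 2 / 2) (-(2 * b) / 2) b := by
    simpa using ((hasDerivAt_pow 2 b).neg.div_const 2)
  convert h.exp using 1; ring

lemma tendsto_pow_mul_exp_neg_sq_half (m : ℕ) :
    Tendsto (fun b : ℝ => b ^ m * rexp (-b ^ 2 / 2)) atTop (𝓝 0) := by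
  have h1 := tendsto_pow_mul_exp_neg_atTop_nhds_zero m
  refine squeeze_zero' (g := fun b => b ^ m * rexp (-b)) ?_ ?_ h1
  · filter_upwards [eventually_ge_atTop 0] with b hb; positivity
  · filter_upwards [eventually_ge_atTop 2] with b hb
    gcongr; nlinarith

lemma tendsto_exp_neg_sq_half : Tendsto (fun b : ℝ => rexp (-b ^ 2 / 2)) atTop (𝓝 0) := by
  simpa using tendsto_pow_mul_exp_neg_sq_half 0

/-- On n > b the integrand b e^{-n²/2} is below n e^{-n²/2}, which has an explicit antiderivative.
-/
lemma gaussTail_mul_le {b : ℝ} : b * gaussTail b ≤ rexp (-b ^ 2 / 2) := by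
  have hd : ∀ n ∈ Ici b, HasDerivAt (fun n => -rexp (-n ^ 2 / 2)) (n * rexp (-n ^ 2 / 2)) n := by
    intro n _
    simpa using (hasDerivAt_exp_neg_sq_half n).fun_neg
  have ht : Tendsto (fun n : ℝ => -rexp (-n ^ 2 / 2)) atTop (𝓝 0) := by
    simpa using tendsto_exp_neg_sq_half.neg
  have := integral_Ioi_of_hasDerivAt_of_tendsto' hd
    integrable_mul_exp_neg_sq_half.integrableOn ht
  rw [zero_sub, neg_neg] at this
  rw [← this, gaussTail, ← integral_const_mul]
  refine setIntegral_mono_on (integrable_exp_neg_sq_half.integrableOn.const_mul _)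
    integrable_mul_exp_neg_sq_half.integrableOn measurableSet_Ioi fun n hn => ?_
  exact mul_le_mul_of_nonneg_right (le_of_lt hn) (exp_pos _).le

lemma tendsto_gaussTail : Tendsto gaussTail atTop (𝓝 0) := by
  refine squeeze_zero' (.of_forall gaussTail_nonneg) ?_ tendsto_exp_neg_sq_half
  filter_upwards [eventually_ge_atTop 1] with b hb
  nlinarith [gaussTail_mul_le (b := b), gaussTail_nonneg b]

/-- Comparison principle: a bounded subsolution of `g' = b g - 1` lies below the Mills ratio. -/
lemma mul_exp_le_gaussTail {g g' : ℝ → ℝ} {b₀ C : ℝ}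
    (hg : ∀ b ∈ Ici b₀, HasDerivAt g (g' b) b) (hle : ∀ b ∈ Ici b₀, b * g b - g' b ≤ 1)
    (hC : ∀ b ∈ Ici b₀, g b ≤ C) {b : ℝ} (hb : b₀ ≤ b) :
    g b * rexp (-b ^ 2 / 2) ≤ gaussTail b := by
  have hd : ∀ t ∈ Ici b₀, HasDerivAt (fun t => gaussTail t - g t * rexp (-t ^ 2 / 2))
      (-rexp (-t ^ 2 / 2) - (g' t * rexp (-t ^ 2 / 2) + g t * (-t * rexp (-t ^ 2 / 2)))) t :=
    fun t ht => (hasDerivAt_gaussTail t).sub ((hg t ht).mul (hasDerivAt_exp_neg_sq_half t))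
  -- The derivative is (t g - g' - 1) e^{-t²/2} ≤ 0. The bound g ≤ C keeps the limit at infinity
  -- nonnegative, hence the function is nonnegative throughout.
  have hanti : AntitoneOn (fun t => gaussTail t - g t * rexp (-t ^ 2 / 2)) (Ici b₀) := by
    refine antitoneOn_of_deriv_nonpos (convex_Ici _)
      (fun t ht => (hd t ht).continuousAt.continuousWithinAt)
      (fun t ht => (hd t (interior_subset ht)).differentiableAt.differentiableWithinAt)
      fun t ht => ?_
    rw [(hd t (interior_subset ht)).deriv]
    nlinarith [hle t (interior_subset ht), exp_pos (-t ^ 2 / 2)]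
  have hlim : Tendsto (fun t => gaussTail t - C * rexp (-t ^ 2 / 2)) atTop (𝓝 0) := by
    simpa using tendsto_gaussTail.sub (tendsto_exp_neg_sq_half.const_mul C)
  have : 0 ≤ gaussTail b - g b * rexp (-b ^ 2 / 2) := by
    refine le_of_tendsto hlim ?_
    filter_upwards [eventually_ge_atTop b] with t ht
    refine le_trans ?_ (hanti hb (hb.trans ht) ht)
    have := hC t (hb.trans ht)
    nlinarith [exp_pos (-t ^ 2 / 2)]
  linarith

/-- Comparison principle: a nonnegative supersolution of `g' = b g - 1` lies above the Mills
ratio. -/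
lemma gaussTail_le_mul_exp {g g' : ℝ → ℝ} {b₀ : ℝ}
    (hg : ∀ b ∈ Ici b₀, HasDerivAt g (g' b) b) (hle : ∀ b ∈ Ici b₀, 1 ≤ b * g b - g' b)
    (hC : ∀ b ∈ Ici b₀, 0 ≤ g b) {b : ℝ} (hb : b₀ ≤ b) :
    gaussTail b ≤ g b * rexp (-b ^ 2 / 2) := by
  have hd : ∀ t ∈ Ici b₀, HasDerivAt (fun t => g t * rexp (-t ^ 2 / 2) - gaussTail t)
      ((g' t * rexp (-t ^ 2 / 2) + g t * (-t * rexp (-t ^ 2 / 2))) - -rexp (-t ^ 2 / 2)) t :=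
    fun t ht => ((hg t ht).mul (hasDerivAt_exp_neg_sq_half t)).sub (hasDerivAt_gaussTail t)
  have hanti : AntitoneOn (fun t => g t * rexp (-t ^ 2 / 2) - gaussTail t) (Ici b₀) := by
    refine antitoneOn_of_deriv_nonpos (convex_Ici _)
      (fun t ht => (hd t ht).continuousAt.continuousWithinAt)
      (fun t ht => (hd t (interior_subset ht)).differentiableAt.differentiableWithinAt)
      fun t ht => ?_
    rw [(hd t (interior_subset ht)).deriv]
    nlinarith [hle t (interior_subset ht), exp_pos (-t ^ 2 / 2)]
  have hlim : Tendsto (fun t => -gaussTail t) atTop (𝓝 0) := by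
    simpa using tendsto_gaussTail.neg
  have : 0 ≤ g b * rexp (-b ^ 2 / 2) - gaussTail b := by
    refine le_of_tendsto hlim ?_
    filter_upwards [eventually_ge_atTop b] with t ht
    refine le_trans ?_ (hanti hb (hb.trans ht) ht)
    have := hC t (hb.trans ht)
    nlinarith [exp_pos (-t ^ 2 / 2), mul_nonneg this (exp_pos (-t ^ 2 / 2)).le]
  linarith

/-- The constant `√(2 / π)`. -/
noncomputable def kappa : ℝ := √(2 / π)

lemma kappa_pos : 0 < kappa := Real.sqrt_pos.2 (by positivity)

lemma kappa_lt : kappa < 0.79789 := by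
  rw [kappa, Real.sqrt_lt' (by norm_num), div_lt_iff₀ pi_pos]
  nlinarith [pi_gt_d6]

lemma lt_kappa : 0.7978 < kappa := by
  rw [kappa]; apply Real.lt_sqrt_of_sq_lt
  rw [lt_div_iff₀ pi_pos]; nlinarith [pi_lt_d6]

/-- For c > 0, (b + c)/(b² + cb + 1) is a supersolution as soon as cb ≥ 2 - c². With c = 1.04 this
holds from 0.9 on, and 0.9 lies just below √(2 log(3/2)), the value of x for three points. -/
lemma gaussTail_le_rational {b : ℝ} (hb : 0.9 ≤ b) :
    gaussTail b ≤ (b + 1.04) / (b ^ 2 + 1.04 * b + 1) * rexp (-b ^ 2 / 2) := by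
  refine gaussTail_le_mul_exp (b₀ := 0.9) (g := fun b => (b + 1.04) / (b ^ 2 + 1.04 * b + 1))
    (g' := fun b => (1 * (b ^ 2 + 1.04 * b + 1) - (b + 1.04) * (2 * b + 1.04)) /
      (b ^ 2 + 1.04 * b + 1) ^ 2) ?_ ?_ ?_ hb
  · intro t ht
    have ht' : (0.9 : ℝ) ≤ t := ht
    have h1 : HasDerivAt (fun b : ℝ => b + 1.04) 1 t := (hasDerivAt_id t).add_const _
    have h2 : HasDerivAt (fun b : ℝ => b ^ 2 + 1.04 * b + 1) (2 * t + 1.04) t := by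
      simpa using ((hasDerivAt_pow 2 t).add ((hasDerivAt_id t).const_mul 1.04)).add_const 1
    exact h1.div h2 (by positivity)
  · intro t ht
    have ht' : (0.9 : ℝ) ≤ t := ht
    have hD : 0 < t ^ 2 + 1.04 * t + 1 := by positivity
    rw [mul_div_assoc', div_sub_div _ _ hD.ne' (by positivity), le_div_iff₀ (by positivity)]
    have : 0 ≤ (t ^ 2 + 1.04 * t + 1) * (1.04 * t - (2 - 1.04 ^ 2)) :=
      mul_nonneg hD.le (by norm_num; linarith)
    nlinarith
  · intro t ht
    have ht' : (0.9 : ℝ) ≤ t := ht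
    positivity

lemma le_gaussTail_rational {b : ℝ} (hb : 0 ≤ b) :
    b / (1 + b ^ 2) * rexp (-b ^ 2 / 2) ≤ gaussTail b := by
  refine mul_exp_le_gaussTail (b₀ := 0) (C := 1) (g := fun b => b / (1 + b ^ 2))
    (g' := fun b => (1 * (1 + b ^ 2) - b * (2 * b)) / (1 + b ^ 2) ^ 2) ?_ ?_ ?_ hb
  · intro t _
    have h2 : HasDerivAt (fun b : ℝ => 1 + b ^ 2) (2 * t) t := by
      simpa using (hasDerivAt_pow 2 t).const_add 1
    exact (hasDerivAt_id t).div h2 (by positivity)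
  · intro t ht
    rw [mul_div_assoc', div_sub_div _ _ (by positivity) (by positivity),
      div_le_one (by positivity)]
    nlinarith [sq_nonneg t]
  · intro t ht
    rw [div_le_one (by positivity)]; nlinarith [sq_nonneg (t - 1)]

/-- The subsolution inequality needed in `one_sub_le_gaussTail`, with r = √b. The constant 0.494
leaves little room: the quartic in r that remains nearly has a double root close to 1.264. -/
lemma sqrt_mul_one_sub_le {r : ℝ} (hr : 0.9 ≤ r) :
    0.494 / (2 * r) + r ^ 2 * (1 - 0.494 * r) ≤ 0.7978 := by
  have hr0 : 0 < r := by linarith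
  rw [← sub_nonneg]
  have : 0.7978 - (0.494 / (2 * r) + r ^ 2 * (1 - 0.494 * r)) =
      (0.494 * r ^ 4 - r ^ 3 + 0.7978 * r - 0.247) / r := by field_simp; ring
  rw [this]
  refine div_nonneg ?_ hr0.le
  have h1 : 0 ≤ 0.494 * r ^ 2 + 0.2488 * r - 0.161 := by nlinarith
  nlinarith [mul_nonneg h1 (sq_nonneg (r - 1.264))]

/-- A lower bound for the Mills ratio: `1 - κ M(b) ≤ 0.494 √b`. -/
lemma one_sub_le_gaussTail {b : ℝ} (hb : 0.9 ≤ b) :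
    (1 - 0.494 * √b) * rexp (-b ^ 2 / 2) ≤ kappa * gaussTail b := by
  have hk := kappa_pos
  have h := mul_exp_le_gaussTail (b₀ := 0.9) (C := kappa⁻¹)
    (g := fun b => kappa⁻¹ * (1 - 0.494 * √b))
    (g' := fun b => kappa⁻¹ * (-(0.494 * (1 / (2 * √b))))) ?_ ?_ ?_ hb
  · rw [mul_assoc, inv_mul_le_iff₀ hk] at h
    exact h
  · intro t ht
    have ht' : (0.9 : ℝ) ≤ t := ht
    exact (((Real.hasDerivAt_sqrt (by linarith)).const_mul 0.494).const_sub 1).const_mul _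
  · intro t ht
    have ht' : (0.9 : ℝ) ≤ t := ht
    have hr : 0.9 ≤ √t := Real.le_sqrt_of_sq_le (by norm_num; linarith)
    have h2 := sqrt_mul_one_sub_le hr
    rw [Real.sq_sqrt (by linarith)] at h2
    have h3 := lt_kappa
    have : t * (kappa⁻¹ * (1 - 0.494 * √t)) - kappa⁻¹ * -(0.494 * (1 / (2 * √t))) =
        kappa⁻¹ * (0.494 / (2 * √t) + t * (1 - 0.494 * √t)) := by ring
    rw [this, inv_mul_le_iff₀ hk]; linarith
  · intro t _
    have : 0 ≤ √t := Real.sqrt_nonneg t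
    have h2 : 0 < kappa⁻¹ := by positivity
    nlinarith

end GaussTail

/-! ### The law of the square root of a shifted exponential variable -/

section Rayleigh

/-- The density of the square root of a shifted exponential variable with shift `x²`. -/
noncomputable def rayleighPDF (x b : ℝ) : ℝ := b * rexp (-(b ^ 2 - x ^ 2) / 2)

/-- The law of the square root of a shifted exponential variable with shift `x²`
and rate `1 / 2`. -/
noncomputable def rayleigh (x : ℝ) : Measure ℝ :=
  (volume.restrict (Ioi x)).withDensity fun b => ENNReal.ofReal (rayleighPDF x b)

lemma measurable_rayleighPDF (x : ℝ) : Measurable (rayleighPDF x) := by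
  unfold rayleighPDF; fun_prop

lemma rayleighPDF_nonneg {x b : ℝ} (hx : 0 ≤ x) (hb : x < b) : 0 ≤ rayleighPDF x b :=
  mul_nonneg (hx.trans hb.le) (exp_pos _).le

lemma rayleighPDF_eq (x b : ℝ) :
    rayleighPDF x b = rexp (x ^ 2 / 2) * (b * rexp (-b ^ 2 / 2)) := by
  rw [rayleighPDF, show -(b ^ 2 - x ^ 2) / 2 = x ^ 2 / 2 + -b ^ 2 / 2 by ring, exp_add]; ring

variable {x : ℝ}

lemma ae_rayleigh_lt (x : ℝ) : ∀ᵐ b ∂rayleigh x, x < b :=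
  (withDensity_absolutelyContinuous _ _).ae_le (ae_restrict_mem measurableSet_Ioi)

lemma rayleigh_absolutelyContinuous (x : ℝ) : rayleigh x ≪ volume :=
  (withDensity_absolutelyContinuous _ _).trans Measure.restrict_le_self.absolutelyContinuous

lemma lintegral_rayleigh {F : ℝ → ℝ≥0∞} (hF : Measurable F) :
    ∫⁻ b, F b ∂rayleigh x = ∫⁻ b in Ioi x, ENNReal.ofReal (rayleighPDF x b) * F b :=
  lintegral_withDensity_eq_lintegral_mul _ (measurable_rayleighPDF x).ennreal_ofReal hF

lemma integral_rayleigh (hx : 0 ≤ x) (g : ℝ → ℝ) :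
    ∫ b, g b ∂rayleigh x = ∫ b in Ioi x, rayleighPDF x b * g b := by
  rw [rayleigh, integral_withDensity_eq_integral_toReal_smul
    (measurable_rayleighPDF x).ennreal_ofReal (.of_forall fun _ => ENNReal.ofReal_lt_top)]
  refine setIntegral_congr_fun measurableSet_Ioi fun b hb => ?_
  simp only [smul_eq_mul]
  rw [ENNReal.toReal_ofReal (rayleighPDF_nonneg hx hb)]

lemma integrable_rayleigh_iff (hx : 0 ≤ x) (g : ℝ → ℝ) :
    Integrable g (rayleigh x) ↔ IntegrableOn (fun b => rayleighPDF x b * g b) (Ioi x) := by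
  rw [rayleigh, integrable_withDensity_iff_integrable_smul'
    (measurable_rayleighPDF x).ennreal_ofReal (.of_forall fun _ => ENNReal.ofReal_lt_top)]
  refine integrableOn_congr_fun (fun b hb => ?_) measurableSet_Ioi
  simp only [smul_eq_mul]
  rw [ENNReal.toReal_ofReal (rayleighPDF_nonneg hx hb)]

/-- The selection rule sees ζ only through √ζ, so the substitution z = b² moves all later estimates
to the law of b. -/
lemma shiftedExp_eq_map_rayleigh (hx : 0 ≤ x) :
    shiftedExp (x ^ 2) (1 / 2) = (rayleigh x).map fun b => b ^ 2 := by
  refine Measure.ext_of_lintegral _ fun F hF => ?_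
  rw [lintegral_map hF (by fun_prop), lintegral_rayleigh (F := fun b => F (b ^ 2))
    (hF.comp (by fun_prop)), shiftedExp,
    lintegral_withDensity_eq_lintegral_mul _ _ hF]
  · have himg : (fun b : ℝ => b ^ 2) '' Ioi x = Ioi (x ^ 2) := by
      ext z
      simp only [mem_image, mem_Ioi]
      constructor
      · rintro ⟨b, hb, rfl⟩; gcongr
      · intro hz
        exact ⟨√z, Real.lt_sqrt_of_sq_lt hz, Real.sq_sqrt ((sq_nonneg x).trans hz.le)⟩
    have hcv := lintegral_image_eq_lintegral_abs_deriv_mul (s := Ioi x) (f := fun b => b ^ 2)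
      (f' := fun b => 2 * b) measurableSet_Ioi
      (fun b _ => by simpa using (hasDerivAt_pow 2 b).hasDerivWithinAt)
      (fun a ha b hb h => by
        have ha' : 0 ≤ a := hx.trans (le_of_lt ha)
        have hb' : 0 ≤ b := hx.trans (le_of_lt hb)
        exact (pow_left_inj₀ ha' hb' two_ne_zero).1 h)
      (fun z => ENNReal.ofReal (1 / 2 * rexp (-(1 / 2 * (z - x ^ 2)))) * F z)
    rw [himg] at hcv
    have h1 : ∫⁻ z, ENNReal.ofReal (if x ^ 2 ≤ z then
        1 / 2 * rexp (-(1 / 2 * (z - x ^ 2))) else 0) * F z =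
        ∫⁻ z in Ici (x ^ 2), ENNReal.ofReal (1 / 2 * rexp (-(1 / 2 * (z - x ^ 2)))) * F z := by
      rw [← lintegral_indicator measurableSet_Ici]
      refine lintegral_congr fun z => ?_
      by_cases hz : x ^ 2 ≤ z
      · rw [indicator_of_mem (mem_Ici.2 hz), if_pos hz]
      · rw [indicator_of_notMem (by simpa using hz), if_neg hz]; simp
    simp only [Pi.mul_apply]
    rw [h1, setLIntegral_congr Ioi_ae_eq_Ici.symm, hcv]
    refine setLIntegral_congr_fun measurableSet_Ioi fun b hb => ?_
    have hb' : 0 < b := lt_of_le_of_lt hx hb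
    rw [← mul_assoc, ← ENNReal.ofReal_mul (abs_nonneg _), abs_of_pos (by positivity), rayleighPDF]
    congr 2
    rw [show -(1 / 2 * (b ^ 2 - x ^ 2)) = -(b ^ 2 - x ^ 2) / 2 by ring]; ring
  · exact (Measurable.ite measurableSet_Ici (by fun_prop) measurable_const).ennreal_ofReal

/-- The exponential moments of the square of a Rayleigh variable. -/
lemma lintegral_exp_sq_rayleigh (hx : 0 ≤ x) {θ : ℝ} (hθ : θ < 1 / 2) :
    ∫⁻ b, ENNReal.ofReal (rexp (θ * (b ^ 2 - x ^ 2))) ∂rayleigh x =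
      ENNReal.ofReal (1 / (1 - 2 * θ)) := by
  rw [lintegral_rayleigh (by fun_prop)]
  have hd : ∀ b ∈ Ici x, HasDerivAt
      (fun b : ℝ => -(1 / (1 - 2 * θ)) * rexp (-((1 - 2 * θ) * (b ^ 2 - x ^ 2) / 2)))
      (b * rexp (-((1 - 2 * θ) * (b ^ 2 - x ^ 2) / 2))) b := by
    intro b _
    have h : HasDerivAt (fun b : ℝ => -((1 - 2 * θ) * (b ^ 2 - x ^ 2) / 2))
        (-((1 - 2 * θ) * (2 * b) / 2)) b := by
      simpa using ((((hasDerivAt_pow 2 b).sub_const (x ^ 2)).const_mul (1 - 2 * θ)).div_const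
        2).fun_neg
    refine (h.exp.const_mul (-(1 / (1 - 2 * θ)))).congr_deriv ?_
    have : 1 - 2 * θ ≠ 0 := by linarith
    field_simp
  have ht : Tendsto (fun b : ℝ => -(1 / (1 - 2 * θ)) *
      rexp (-((1 - 2 * θ) * (b ^ 2 - x ^ 2) / 2))) atTop (𝓝 0) := by
    rw [← mul_zero (-(1 / (1 - 2 * θ)))]
    refine (tendsto_exp_atBot.comp ?_).const_mul _
    refine tendsto_neg_atTop_atBot.comp ?_
    refine Tendsto.atTop_div_const (by norm_num) ?_
    refine Tendsto.const_mul_atTop (by linarith) ?_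
    exact tendsto_atTop_add_const_right _ _ (tendsto_pow_atTop two_ne_zero)
  have hpos : ∀ b ∈ Ioi x, 0 ≤ b * rexp (-((1 - 2 * θ) * (b ^ 2 - x ^ 2) / 2)) :=
    fun b hb => mul_nonneg (hx.trans (le_of_lt hb)) (exp_pos _).le
  have hint := integral_Ioi_of_hasDerivAt_of_nonneg' hd hpos ht
  have hii := integrableOn_Ioi_deriv_of_nonneg' hd hpos ht
  have h3 : ∫⁻ b in Ioi x, ENNReal.ofReal (rayleighPDF x b) *
      ENNReal.ofReal (rexp (θ * (b ^ 2 - x ^ 2))) = ∫⁻ b in Ioi x,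
      ENNReal.ofReal (b * rexp (-((1 - 2 * θ) * (b ^ 2 - x ^ 2) / 2))) := by
    refine setLIntegral_congr_fun measurableSet_Ioi fun b hb => ?_
    rw [← ENNReal.ofReal_mul (rayleighPDF_nonneg hx hb), rayleighPDF, mul_assoc, ← exp_add]
    congr 3; ring
  rw [h3, ← ofReal_integral_eq_lintegral_ofReal hii
    ((ae_restrict_iff' measurableSet_Ioi).2 (.of_forall hpos)), hint]
  simp

lemma isProbabilityMeasure_rayleigh (hx : 0 ≤ x) : IsProbabilityMeasure (rayleigh x) :=
  ⟨by simpa using lintegral_exp_sq_rayleigh hx (θ := 0) (by norm_num)⟩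

lemma integrable_exp_sq_rayleigh (hx : 0 ≤ x) {θ : ℝ} (hθ : θ < 1 / 2) :
    Integrable (fun b => rexp (θ * (b ^ 2 - x ^ 2))) (rayleigh x) := by
  refine ⟨by fun_prop, ?_⟩
  rw [hasFiniteIntegral_iff_ofReal (.of_forall fun _ => (exp_pos _).le),
    lintegral_exp_sq_rayleigh hx hθ]
  exact ENNReal.ofReal_lt_top

lemma integrable_of_le_exp_sq_rayleigh (hx : 0 ≤ x) {g : ℝ → ℝ} (hg : Measurable g) {C θ : ℝ}
    (hθ : θ < 1 / 2) (h : ∀ b, x < b → |g b| ≤ C * rexp (θ * (b ^ 2 - x ^ 2))) :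
    Integrable g (rayleigh x) := by
  refine ((integrable_exp_sq_rayleigh hx hθ).const_mul C).mono' hg.aestronglyMeasurable ?_
  filter_upwards [ae_rayleigh_lt x] with b hb using h b hb

lemma integrable_sq_rayleigh (hx : 0 ≤ x) : Integrable (fun b => b ^ 2) (rayleigh x) := by
  refine integrable_of_le_exp_sq_rayleigh hx (by fun_prop) (C := 4 + x ^ 2) (θ := 1 / 4)
    (by norm_num) fun b hb => ?_
  rw [abs_of_nonneg (sq_nonneg b)]
  have h0 : 0 ≤ b ^ 2 - x ^ 2 := by nlinarith
  have := add_one_le_exp (1 / 4 * (b ^ 2 - x ^ 2))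
  nlinarith [sq_nonneg x, mul_nonneg (sq_nonneg x) h0]

lemma integral_sq_rayleigh (hx : 0 ≤ x) : ∫ b, b ^ 2 ∂rayleigh x = x ^ 2 + 2 := by
  have hi := (integrable_rayleigh_iff hx _).1 (integrable_sq_rayleigh hx)
  rw [integral_rayleigh hx]
  have hd : ∀ b ∈ Ici x, HasDerivAt
      (fun b : ℝ => rexp (x ^ 2 / 2) * (-(b ^ 2 * rexp (-b ^ 2 / 2) + 2 * rexp (-b ^ 2 / 2))))
      (rayleighPDF x b * b ^ 2) b := by
    intro b _
    have h := ((((hasDerivAt_pow 2 b).mul (hasDerivAt_exp_neg_sq_half b)).add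
      ((hasDerivAt_exp_neg_sq_half b).const_mul 2)).fun_neg).const_mul (rexp (x ^ 2 / 2))
    refine h.congr_deriv ?_
    rw [rayleighPDF_eq]; simp; ring
  have ht : Tendsto (fun b : ℝ => rexp (x ^ 2 / 2) *
      (-(b ^ 2 * rexp (-b ^ 2 / 2) + 2 * rexp (-b ^ 2 / 2)))) atTop (𝓝 0) := by
    simpa using (((tendsto_pow_mul_exp_neg_sq_half 2).add
      (tendsto_exp_neg_sq_half.const_mul 2)).neg).const_mul (rexp (x ^ 2 / 2))
  rw [integral_Ioi_of_hasDerivAt_of_tendsto' hd hi ht]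
  have h1 : rexp (x ^ 2 / 2) * rexp (-x ^ 2 / 2) = 1 := by rw [← exp_add]; simp [neg_div]
  linear_combination (x ^ 2 + 2) * h1

lemma integral_inv_rayleigh (hx : 0 ≤ x) :
    ∫ b, b⁻¹ ∂rayleigh x = rexp (x ^ 2 / 2) * gaussTail x := by
  rw [integral_rayleigh hx, gaussTail, ← integral_const_mul]
  refine setIntegral_congr_fun measurableSet_Ioi fun b hb => ?_
  have hb' : b ≠ 0 := (lt_of_le_of_lt hx hb).ne'
  rw [rayleighPDF_eq]; field_simp

lemma integrable_inv_rayleigh (hx : 0 < x) : Integrable (fun b => b⁻¹) (rayleigh x) := by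
  refine integrable_of_le_exp_sq_rayleigh hx.le (by fun_prop) (C := x⁻¹) (θ := 0)
    (by norm_num) fun b hb => ?_
  have hb' : 0 < b := hx.trans hb
  rw [abs_of_pos (by positivity)]
  simpa using inv_anti₀ hx hb.le

/-- The exponential in the density cancels e^{b²/2}, which leaves ∫ b · gaussTail b. Its
antiderivative is ½((b² - 1) gaussTail b - b e^{-b²/2}). -/
lemma integral_mills_rayleigh (hx : 0 ≤ x)
    (hi : Integrable (fun b => rexp (b ^ 2 / 2) * gaussTail b) (rayleigh x)) :
    ∫ b, rexp (b ^ 2 / 2) * gaussTail b ∂rayleigh x =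
      rexp (x ^ 2 / 2) * ((1 - x ^ 2) / 2 * gaussTail x + x / 2 * rexp (-x ^ 2 / 2)) := by
  have hi := (integrable_rayleigh_iff hx _).1 hi
  rw [integral_rayleigh hx]
  have hd : ∀ b ∈ Ici x, HasDerivAt
      (fun b : ℝ => rexp (x ^ 2 / 2) *
        ((b ^ 2 - 1) / 2 * gaussTail b - b / 2 * rexp (-b ^ 2 / 2)))
      (rayleighPDF x b * (rexp (b ^ 2 / 2) * gaussTail b)) b := by
    intro b _
    have h := ((((((hasDerivAt_pow 2 b).sub_const 1).div_const 2).mul (hasDerivAt_gaussTail b)).sub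
      (((hasDerivAt_id b).div_const 2).mul (hasDerivAt_exp_neg_sq_half b)))).const_mul
        (rexp (x ^ 2 / 2))
    refine h.congr_deriv ?_
    have h1 : rexp (b ^ 2 / 2) * rexp (-b ^ 2 / 2) = 1 := by rw [← exp_add]; simp [neg_div]
    rw [rayleighPDF_eq]; simp
    linear_combination (-(rexp (x ^ 2 / 2) * b * gaussTail b)) * h1
  have hH : Tendsto (fun b : ℝ => (b ^ 2 - 1) / 2 * gaussTail b) atTop (𝓝 0) := by
    refine squeeze_zero' (g := fun b => b ^ 2 * rexp (-b ^ 2 / 2)) ?_ ?_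
      (tendsto_pow_mul_exp_neg_sq_half 2)
    · filter_upwards [eventually_ge_atTop 1] with b hb
      exact mul_nonneg (by nlinarith) (gaussTail_nonneg b)
    · filter_upwards [eventually_ge_atTop 1] with b hb
      have h2 := gaussTail_mul_le (b := b)
      have h3 := gaussTail_nonneg b
      have : (b ^ 2 - 1) / 2 ≤ b ^ 2 * b := by nlinarith
      calc (b ^ 2 - 1) / 2 * gaussTail b ≤ b ^ 2 * b * gaussTail b := by gcongr
        _ = b ^ 2 * (b * gaussTail b) := by ring
        _ ≤ _ := by gcongr
  have hE : Tendsto (fun b : ℝ => b / 2 * rexp (-b ^ 2 / 2)) atTop (𝓝 0) := by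
    have := (tendsto_pow_mul_exp_neg_sq_half 1).const_mul (1 / 2)
    rw [mul_zero] at this
    refine this.congr fun b => by ring
  have ht := (hH.sub hE).const_mul (rexp (x ^ 2 / 2))
  rw [sub_zero, mul_zero] at ht
  rw [integral_Ioi_of_hasDerivAt_of_tendsto' hd hi ht]
  ring

end Rayleigh

/-! ### Exponential moments of Lipschitz functions of a Rayleigh variable -/

section Symmetrization

variable {x : ℝ}

/-- Under `rayleigh x` the variable b² - x² is exponential. The squared difference of two
independent copies is thus controlled by a sum of two independent exponential variables. -/
lemma sq_sub_le_of_le (hx : 0 ≤ x) {b b' : ℝ} (hb : x < b) (hb' : x < b') :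
    (b - b') ^ 2 ≤ (b ^ 2 - x ^ 2) + (b' ^ 2 - x ^ 2) := by
  nlinarith [mul_pos (sub_pos.2 hb) (sub_pos.2 hb'), mul_nonneg hx (sub_pos.2 hb).le,
    mul_nonneg hx (sub_pos.2 hb').le]

/-- Exchanging b and b' turns the exponential into a hyperbolic cosine. The assumed bound on it
factors, and each factor is an exponential moment of b² - x². -/
lemma lintegral_lintegral_exp_le (hx : 0 ≤ x) {Y : ℝ → ℝ} (hY : Measurable Y) {K θ l : ℝ}
    (hK : 0 ≤ K) (hθ : θ < 1 / 2)
    (h : ∀ b b', x < b → x < b' → cosh (l * (Y b - Y b')) ≤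
      K * (rexp (θ * (b ^ 2 - x ^ 2)) * rexp (θ * (b' ^ 2 - x ^ 2)))) :
    ∫⁻ b, ∫⁻ b', ENNReal.ofReal (rexp (l * (Y b - Y b'))) ∂rayleigh x ∂rayleigh x ≤
      ENNReal.ofReal (K * (1 / (1 - 2 * θ)) ^ 2) := by
  have := isProbabilityMeasure_rayleigh hx
  set S := ∫⁻ b, ∫⁻ b', ENNReal.ofReal (rexp (l * (Y b - Y b'))) ∂rayleigh x ∂rayleigh x with hS
  have hsw : S = ∫⁻ b, ∫⁻ b', ENNReal.ofReal (rexp (l * (Y b' - Y b))) ∂rayleigh x ∂rayleigh x := by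
    rw [hS, lintegral_lintegral_swap]
    exact Measurable.aemeasurable (by fun_prop)
  have h2 : S + S ≤ 2 * ENNReal.ofReal (K * (1 / (1 - 2 * θ)) ^ 2) := by
    calc S + S = ∫⁻ b, ∫⁻ b', (ENNReal.ofReal (rexp (l * (Y b - Y b'))) +
          ENNReal.ofReal (rexp (l * (Y b' - Y b)))) ∂rayleigh x ∂rayleigh x := by
          nth_rewrite 2 [hsw]
          rw [hS, ← lintegral_add_left]
          · refine lintegral_congr fun b => ?_
            rw [lintegral_add_left (by fun_prop)]
          · refine Measurable.lintegral_prod_right (f := fun b b' : ℝ =>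
              ENNReal.ofReal (rexp (l * (Y b - Y b')))) (by fun_prop)
      _ ≤ ∫⁻ b, ∫⁻ b', 2 * ENNReal.ofReal K * ENNReal.ofReal (rexp (θ * (b ^ 2 - x ^ 2))) *
          ENNReal.ofReal (rexp (θ * (b' ^ 2 - x ^ 2))) ∂rayleigh x ∂rayleigh x := by
          refine lintegral_mono_ae ?_
          filter_upwards [ae_rayleigh_lt x] with b hb
          refine lintegral_mono_ae ?_
          filter_upwards [ae_rayleigh_lt x] with b' hb'
          have h3 := h b b' hb hb'
          rw [← ENNReal.ofReal_add (exp_pos _).le (exp_pos _).le,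
            show (2 : ℝ≥0∞) = ENNReal.ofReal 2 by simp, ← ENNReal.ofReal_mul (by norm_num),
            ← ENNReal.ofReal_mul (by positivity), ← ENNReal.ofReal_mul (by positivity)]
          apply ENNReal.ofReal_le_ofReal
          rw [cosh_eq, show -(l * (Y b - Y b')) = l * (Y b' - Y b) by ring] at h3
          linarith
      _ = 2 * ENNReal.ofReal (K * (1 / (1 - 2 * θ)) ^ 2) := by
          have h4 : ∀ b : ℝ, ∫⁻ b', 2 * ENNReal.ofReal K *
              ENNReal.ofReal (rexp (θ * (b ^ 2 - x ^ 2))) *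
              ENNReal.ofReal (rexp (θ * (b' ^ 2 - x ^ 2))) ∂rayleigh x =
              (2 * ENNReal.ofReal K * ENNReal.ofReal (1 / (1 - 2 * θ))) *
                ENNReal.ofReal (rexp (θ * (b ^ 2 - x ^ 2))) := fun b => by
            rw [lintegral_const_mul _ (by fun_prop), lintegral_exp_sq_rayleigh hx hθ]; ring
          simp_rw [h4]
          have h5 : 0 ≤ 1 / (1 - 2 * θ) := by apply div_nonneg <;> linarith
          rw [lintegral_const_mul _ (by fun_prop), lintegral_exp_sq_rayleigh hx hθ,
            ENNReal.ofReal_mul hK, sq, ENNReal.ofReal_mul h5]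
          ring
  rw [← two_mul] at h2
  exact (ENNReal.mul_le_mul_iff_right (by simp) (by simp)).1 h2

lemma abs_le_of_lipschitz {Y : ℝ → ℝ} {d : ℝ}
    (h : ∀ b b', x < b → x < b' → |Y b - Y b'| ≤ |b - b'| + d) {b : ℝ} (hb : x < b) :
    |Y b| ≤ |Y (x + 1)| + (b - x) + 1 + d := by
  have h1 := h b (x + 1) hb (by linarith)
  have h2 := abs_sub_abs_le_abs_sub (Y b) (Y (x + 1))
  have h3 : |b - (x + 1)| ≤ (b - x) + 1 := by rw [abs_le]; constructor <;> linarith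
  linarith

lemma integrable_exp_of_lipschitz (hx : 0 ≤ x) {Y : ℝ → ℝ} (hY : Measurable Y) {d : ℝ}
    (h : ∀ b b', x < b → x < b' → |Y b - Y b'| ≤ |b - b'| + d) (l c : ℝ) :
    Integrable (fun b => rexp (l * (c - Y b))) (rayleigh x) := by
  refine integrable_of_le_exp_sq_rayleigh hx (by fun_prop)
    (C := rexp (|l| * (|c| + |Y (x + 1)| + 1 + d) + l ^ 2)) (θ := 1 / 4) (by norm_num) fun b hb => ?_
  rw [abs_of_pos (exp_pos _), ← exp_add]
  gcongr
  have h1 := abs_le_of_lipschitz h hb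
  have h2 : l * (c - Y b) ≤ |l| * (|c| + |Y b|) := by
    calc l * (c - Y b) ≤ |l * (c - Y b)| := le_abs_self _
      _ = |l| * |c - Y b| := abs_mul _ _
      _ ≤ _ := by gcongr; exact abs_sub _ _
  have h3 : |l| * (|c| + |Y b|) ≤ |l| * (|c| + (|Y (x + 1)| + (b - x) + 1 + d)) := by gcongr
  have h4 : |l| * (b - x) ≤ l ^ 2 + 1 / 4 * (b - x) ^ 2 := by
    nlinarith [sq_nonneg (|l| - 1 / 2 * (b - x)), sq_abs l]
  have h5 : (b - x) ^ 2 ≤ b ^ 2 - x ^ 2 := by nlinarith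
  nlinarith

lemma integrable_of_lipschitz (hx : 0 ≤ x) {Y : ℝ → ℝ} (hY : Measurable Y) {d : ℝ}
    (h : ∀ b b', x < b → x < b' → |Y b - Y b'| ≤ |b - b'| + d) : Integrable Y (rayleigh x) := by
  have h1 := integrable_exp_of_lipschitz hx hY h 1 0
  have h2 := integrable_exp_of_lipschitz hx hY h (-1) 0
  refine (h1.add h2).mono' hY.aestronglyMeasurable (.of_forall fun b => ?_)
  simp only [Pi.add_apply, norm_eq_abs, zero_sub, mul_neg, neg_mul, one_mul, neg_neg]
  have e1 := add_one_le_exp (Y b)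
  have e2 := add_one_le_exp (-Y b)
  have e3 := exp_pos (Y b)
  have e4 := exp_pos (-Y b)
  rw [abs_le]; constructor <;> linarith

/-- Jensen's inequality in an independent copy b', the first half of the symmetrization. -/
lemma exp_sub_integral_le (hx : 0 ≤ x) {Y : ℝ → ℝ} (hY : Measurable Y) {d : ℝ}
    (h : ∀ b b', x < b → x < b' → |Y b - Y b'| ≤ |b - b'| + d) (l b : ℝ) :
    ENNReal.ofReal (rexp (l * (Y b - ∫ b', Y b' ∂rayleigh x))) ≤
      ∫⁻ b', ENNReal.ofReal (rexp (l * (Y b - Y b'))) ∂rayleigh x := by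
  have := isProbabilityMeasure_rayleigh hx
  have hi := integrable_of_lipschitz hx hY h
  have hJ := convexOn_exp.map_integral_le (μ := rayleigh x) (f := fun b' => l * (Y b - Y b'))
    continuous_exp.continuousOn isClosed_univ (by simp)
    (((integrable_const (Y b)).sub hi).const_mul l) (integrable_exp_of_lipschitz hx hY h l (Y b))
  rw [← ofReal_integral_eq_lintegral_ofReal (integrable_exp_of_lipschitz hx hY h l (Y b))
    (.of_forall fun _ => (exp_pos _).le)]
  refine ENNReal.ofReal_le_ofReal (le_trans (le_of_eq ?_) hJ)
  rw [integral_const_mul, integral_sub (integrable_const _) hi]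
  simp

/-- A function of a Rayleigh variable that is Lipschitz up to a bounded error is sub-Gaussian. -/
lemma lintegral_exp_rayleigh_le (hx : 0 ≤ x) {Y : ℝ → ℝ} (hY : Measurable Y)
    (h : ∀ b b', x < b → x < b' → |Y b - Y b'| ≤ |b - b'| + 1.05) {l : ℝ} (hl : 0 ≤ l) :
    ∫⁻ b, ENNReal.ofReal (rexp (l * (Y b - ∫ b', Y b' ∂rayleigh x))) ∂rayleigh x ≤
      ENNReal.ofReal (rexp (9 * l ^ 2)) := by
  refine (lintegral_mono fun b => exp_sub_integral_le hx hY h l b).trans ?_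
  -- For small l, cosh t ≤ exp(t²/2) and Young's inequality give θ = 0.75 l² and the total exponent
  -- 1.66 l² + 2 · 3.6 l² = 8.86 l². For larger l this θ may reach 1/2, where the exponential moment
  -- is infinite; there cosh t ≤ exp|t| is used, with l|b - b'| ≤ 2l² + (b - b')²/8.
  by_cases hl2 : l ≤ 1 / 2
  · have hl3 : l ^ 2 ≤ 1 / 4 := by nlinarith
    refine (lintegral_lintegral_exp_le hx hY (K := rexp (1.66 * l ^ 2)) (θ := 0.75 * l ^ 2)
      (l := l) (exp_pos _).le (by linarith) fun b b' hb hb' => ?_).trans ?_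
    · refine (cosh_le_exp_half_sq _).trans ?_
      rw [← exp_add, ← exp_add]
      gcongr
      have h1 := h b b' hb hb'
      have h2 := sq_sub_le_of_le hx hb hb'
      have h3 : (Y b - Y b') ^ 2 ≤ (|b - b'| + 1.05) ^ 2 := by
        rw [← sq_abs (Y b - Y b')]; gcongr
      have h4 : (|b - b'| + 1.05) ^ 2 ≤ 1.5 * (b - b') ^ 2 + 3.32 := by
        rw [← sq_abs (b - b')]; nlinarith [sq_nonneg (|b - b'| - 2.1)]
      rw [mul_pow]
      nlinarith [mul_le_mul_of_nonneg_left (h3.trans h4) (sq_nonneg l),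
        mul_le_mul_of_nonneg_left h2 (sq_nonneg l)]
    · refine ENNReal.ofReal_le_ofReal ?_
      have h5 : 1 / (1 - 2 * (0.75 * l ^ 2)) ≤ rexp (3.6 * l ^ 2) := by
        rw [div_le_iff₀ (by linarith)]
        have := add_one_le_exp (3.6 * l ^ 2)
        nlinarith [sq_nonneg l]
      calc rexp (1.66 * l ^ 2) * (1 / (1 - 2 * (0.75 * l ^ 2))) ^ 2
          ≤ rexp (1.66 * l ^ 2) * rexp (3.6 * l ^ 2) ^ 2 := by
            gcongr; apply div_nonneg <;> linarith
        _ = rexp (8.86 * l ^ 2) := by rw [← exp_nat_mul, ← exp_add]; congr 1; push_cast; ring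
        _ ≤ _ := by gcongr; nlinarith [sq_nonneg l]
  · push Not at hl2
    have hl3 : 1 / 4 ≤ l ^ 2 := by nlinarith
    refine (lintegral_lintegral_exp_le hx hY (K := rexp (1.05 * l + 2 * l ^ 2)) (θ := 1 / 8)
      (l := l) (exp_pos _).le (by norm_num) fun b b' hb hb' => ?_).trans ?_
    · have h0 : cosh (l * (Y b - Y b')) ≤ rexp |l * (Y b - Y b')| := by
        rw [← cosh_abs, cosh_eq]
        have : rexp (-|l * (Y b - Y b')|) ≤ rexp |l * (Y b - Y b')| := by
          gcongr; linarith [abs_nonneg (l * (Y b - Y b'))]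
        linarith
      refine h0.trans ?_
      rw [← exp_add, ← exp_add]
      gcongr
      have h1 := h b b' hb hb'
      have h2 := sq_sub_le_of_le hx hb hb'
      rw [abs_mul, abs_of_nonneg hl]
      have h3 : l * |Y b - Y b'| ≤ l * (|b - b'| + 1.05) := by gcongr
      have h4 : l * |b - b'| ≤ 2 * l ^ 2 + (b - b') ^ 2 / 8 := by
        rw [← sq_abs (b - b')]; nlinarith [sq_nonneg (4 * l - |b - b'|)]
      nlinarith
    · refine ENNReal.ofReal_le_ofReal ?_
      have h5 : (1 / (1 - 2 * (1 / 8 : ℝ))) ^ 2 ≤ rexp (4 * l ^ 2) := by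
        have := add_one_le_exp (4 * l ^ 2)
        refine le_trans ?_ this
        norm_num; nlinarith
      calc rexp (1.05 * l + 2 * l ^ 2) * (1 / (1 - 2 * (1 / 8 : ℝ))) ^ 2
          ≤ rexp (1.05 * l + 2 * l ^ 2) * rexp (4 * l ^ 2) := by gcongr
        _ = rexp (1.05 * l + 6 * l ^ 2) := by rw [← exp_add]; congr 1; ring
        _ ≤ _ := by gcongr; nlinarith

end Symmetrization

/-! ### Huber functions -/

section Huber

/-- The value of `p w - C p²` at its maximizer `p ∈ [0, 1]`. -/
noncomputable def huber (C w : ℝ) : ℝ :=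
  max 0 (min 1 (w / (2 * C))) * w - C * max 0 (min 1 (w / (2 * C))) ^ 2

variable {C : ℝ} (hC : 0 < C)
include hC

lemma le_huber (w : ℝ) {p : ℝ} (hp : 0 ≤ p) (hp1 : p ≤ 1) : p * w - C * p ^ 2 ≤ huber C w := by
  unfold huber
  obtain ⟨r, rfl⟩ : ∃ r, w = r * (2 * C) := ⟨w / (2 * C), by field_simp⟩
  rw [mul_div_cancel_right₀ _ (by positivity)]
  rcases le_total r 0 with h | h
  · rw [max_eq_left (by simp [h])]
    nlinarith [mul_nonneg hp (mul_nonneg hC.le (neg_nonneg.2 h)), mul_nonneg hC.le (sq_nonneg p)]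
  · rcases le_total r 1 with h1 | h1
    · rw [min_eq_right h1, max_eq_right h]
      nlinarith [mul_nonneg hC.le (sq_nonneg (p - r))]
    · rw [min_eq_left h1, max_eq_right zero_le_one]
      nlinarith [mul_nonneg hC.le (mul_nonneg (sub_nonneg.2 hp1) (sub_nonneg.2 h1)),
        mul_nonneg hC.le (sq_nonneg (p - 1))]

/-- The maximum of p w - C p² without the constraint on p is w²/(4C). -/
lemma huber_le_sq (w : ℝ) : huber C w ≤ w ^ 2 / (4 * C) := by
  unfold huber
  rw [le_div_iff₀ (by positivity)]
  nlinarith [sq_nonneg (w - 2 * C * max 0 (min 1 (w / (2 * C))))]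

/-- The maximizer for w competes in the problem for w', and the two values differ there by p (w -
w') with 0 ≤ p ≤ 1. -/
lemma huber_sub_le {w w' d : ℝ} (hd : 0 ≤ d) (h : w - w' ≤ d) : huber C w - huber C w' ≤ d := by
  have h0 : 0 ≤ max 0 (min 1 (w / (2 * C))) := le_max_left _ _
  have h1 : max 0 (min 1 (w / (2 * C))) ≤ 1 := max_le zero_le_one (min_le_left _ _)
  have := le_huber hC w' h0 h1
  conv_lhs => rw [huber]
  nlinarith [mul_le_mul_of_nonneg_left h h0]

end Huber

lemma measurable_huber (C : ℝ) : Measurable (huber C) := by unfold huber; fun_prop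

/-! ### Upper envelopes of lines and the expected maximum -/

section Envelope

variable {X : Type*} [Fintype X] {m s : X → ℝ} {x : ℝ}

/-- The upper envelope of the lines `b ↦ m y + b * s y`. -/
noncomputable def env (m s : X → ℝ) (b : ℝ) : ℝ := ⨆ y, (m y + b * s y)

/-- An upper bound for the expected maximum of Gaussian variables with means `m y` and standard
deviations `s y`. -/
noncomputable def optBound (m s : X → ℝ) (x : ℝ) : ℝ :=
  env m s x + ∑ y, ∫ n, max (m y + n * s y - env m s x) 0 ∂gaussianReal 0 1

lemma le_env (m s : X → ℝ) (b : ℝ) (y : X) : m y + b * s y ≤ env m s b :=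
  le_ciSup (f := fun y => m y + b * s y) (Set.finite_range _).bddAbove y

lemma env_le {X : Type*} [Nonempty X] {m s : X → ℝ} {b c : ℝ} (h : ∀ y, m y + b * s y ≤ c) :
    env m s b ≤ c :=
  ciSup_le h

variable [Nonempty X]

lemma env_eq {b : ℝ} {y : X} (h : ∀ z, m z + b * s z ≤ m y + b * s y) :
    env m s b = m y + b * s y := le_antisymm (env_le h) (le_env m s b y)

lemma env_mono (hs : ∀ y, 0 ≤ s y) {b b' : ℝ} (h : b ≤ b') : env m s b ≤ env m s b' :=
  env_le fun y => (by nlinarith [hs y, mul_le_mul_of_nonneg_right h (hs y)] :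
    m y + b * s y ≤ m y + b' * s y).trans (le_env m s b' y)

lemma env_sub_le (hs1 : ∀ y, s y ≤ 1) {b b' : ℝ} (h : b ≤ b') :
    env m s b' ≤ env m s b + (b' - b) :=
  env_le fun y => by
    have := le_env m s b y
    nlinarith [mul_le_mul_of_nonneg_left (hs1 y) (sub_nonneg.2 h)]

lemma lipschitzWith_env (hs : ∀ y, 0 ≤ s y) (hs1 : ∀ y, s y ≤ 1) : LipschitzWith 1 (env m s) := by
  refine LipschitzWith.of_le_add fun b b' => ?_
  rcases le_total b b' with h | h
  · exact (env_mono hs h).trans (by linarith [dist_nonneg (x := b) (y := b')])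
  · rw [Real.dist_eq, abs_of_nonneg (sub_nonneg.2 h)]; exact env_sub_le hs1 h

/-- Envelope theorem: the envelope minus the active line is nonnegative and vanishes at b, hence has
a minimum there. -/
lemma hasDerivAt_env {b : ℝ} {y : X} (h : ∀ z, m z + b * s z ≤ m y + b * s y)
    (hd : DifferentiableAt ℝ (env m s) b) : HasDerivAt (env m s) (s y) b := by
  have hl : HasDerivAt (fun b => m y + b * s y) (s y) b := by
    simpa using ((hasDerivAt_id b).mul_const (s y)).const_add (m y)
  have hmin : IsLocalMin (fun b => env m s b - (m y + b * s y)) b := by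
    refine .of_forall fun b' => ?_
    change env m s b - (m y + b * s y) ≤ env m s b' - (m y + b' * s y)
    rw [env_eq h, sub_self]
    exact sub_nonneg.2 (le_env m s b' y)
  have := hmin.hasDerivAt_eq_zero (hd.hasDerivAt.sub hl)
  rw [← sub_eq_zero.1 this]
  exact hd.hasDerivAt

/-- The gap `(1 - κ M(b)) / b` between the tails of a Rayleigh and a Gaussian variable, where `M` is
the Mills ratio. -/
noncomputable def millsGap (b : ℝ) : ℝ := (1 - kappa * (rexp (b ^ 2 / 2) * gaussTail b)) / b

lemma measurable_millsGap : Measurable millsGap := by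
  have := continuous_gaussTail.measurable
  unfold millsGap; fun_prop

lemma exp_mul_gaussTail_le {b c : ℝ} (h : gaussTail b ≤ c * rexp (-b ^ 2 / 2)) :
    rexp (b ^ 2 / 2) * gaussTail b ≤ c := by
  calc rexp (b ^ 2 / 2) * gaussTail b ≤ rexp (b ^ 2 / 2) * (c * rexp (-b ^ 2 / 2)) := by gcongr
    _ = c := by rw [mul_left_comm, ← exp_add]; simp [neg_div]

lemma le_exp_mul_gaussTail {b c d : ℝ} (h : c * rexp (-b ^ 2 / 2) ≤ d * gaussTail b) :
    c ≤ d * (rexp (b ^ 2 / 2) * gaussTail b) := by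
  calc c = rexp (b ^ 2 / 2) * (c * rexp (-b ^ 2 / 2)) := by
        rw [mul_left_comm, ← exp_add]; simp [neg_div]
    _ ≤ rexp (b ^ 2 / 2) * (d * gaussTail b) := by gcongr
    _ = _ := by ring

lemma millsGap_nonneg {b : ℝ} (hb : 0.9 ≤ b) : 0 ≤ millsGap b := by
  refine div_nonneg (sub_nonneg.2 ?_) (by linarith)
  have h1 := exp_mul_gaussTail_le (gaussTail_le_rational hb)
  have h2 : (b + 1.04) / (b ^ 2 + 1.04 * b + 1) ≤ 1 := by
    rw [div_le_one (by positivity)]; nlinarith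
  have h3 : 0 ≤ rexp (b ^ 2 / 2) * gaussTail b := mul_nonneg (exp_pos _).le (gaussTail_nonneg b)
  nlinarith [kappa_lt, kappa_pos]

lemma mul_millsGap_le {b : ℝ} (hb : 0.9 ≤ b) : b * millsGap b ≤ 0.494 * √b := by
  have h1 := le_exp_mul_gaussTail (one_sub_le_gaussTail hb)
  rw [millsGap, mul_div_cancel₀ _ (by linarith)]
  linarith

lemma millsGap_le {b : ℝ} (hb : 0.9 ≤ b) : millsGap b ≤ 0.525 := by
  have h1 := mul_millsGap_le hb
  have h2 : 0.945 ≤ √b := Real.le_sqrt_of_sq_le (by norm_num; linarith)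
  have h3 := Real.sq_sqrt (show 0 ≤ b by linarith)
  have h4 : b * millsGap b ≤ b * 0.525 := by nlinarith
  exact le_of_mul_le_mul_left h4 (by linarith)

/-- The square of `mul_millsGap_le`, with 0.494² < 0.2441. The form c/b is chosen because 1/b has an
explicit mean under `rayleigh x`. -/
lemma millsGap_sq_le {b : ℝ} (hb : 0.9 ≤ b) : millsGap b ^ 2 ≤ 0.2441 * b⁻¹ := by
  have h1 := mul_millsGap_le hb
  have h0 := mul_nonneg (show 0 ≤ b by linarith) (millsGap_nonneg hb)
  have h3 := Real.sq_sqrt (show 0 ≤ b by linarith)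
  have h4 : (b * millsGap b) ^ 2 ≤ (0.494 * √b) ^ 2 := by gcongr
  rw [mul_pow, mul_pow, h3] at h4
  have hb' : 0 < b := by linarith
  rw [← div_eq_mul_inv, le_div_iff₀ hb']
  nlinarith [sq_nonneg (millsGap b)]

/-- The derivative of the function `e^{-b²/2} - κ H(b)`. -/
lemma hasDerivAt_exp_sub_gaussTail (b : ℝ) :
    HasDerivAt (fun b => rexp (-b ^ 2 / 2) - kappa * gaussTail b)
      ((kappa - b) * rexp (-b ^ 2 / 2)) b :=
  ((hasDerivAt_exp_neg_sq_half b).sub ((hasDerivAt_gaussTail b).const_mul kappa)).congr_deriv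
    (by ring)

/-- It supplies the absolute continuity for the integration by parts; the value of the constant is
immaterial. -/
lemma lipschitzWith_exp_sub_gaussTail :
    LipschitzWith 2 (fun b => rexp (-b ^ 2 / 2) - kappa * gaussTail b) := by
  refine lipschitzWith_of_nnnorm_deriv_le
    (fun b => (hasDerivAt_exp_sub_gaussTail b).differentiableAt) fun b => ?_
  rw [(hasDerivAt_exp_sub_gaussTail b).deriv, ← NNReal.coe_le_coe, coe_nnnorm, norm_eq_abs,
    abs_mul, abs_of_pos (exp_pos _)]
  have h1 : |kappa - b| ≤ 1 + |b| := by
    refine (abs_sub _ _).trans ?_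
    rw [abs_of_pos kappa_pos]; linarith [kappa_lt]
  have h2 : 1 + b ^ 2 / 2 ≤ rexp (b ^ 2 / 2) := by linarith [add_one_le_exp (b ^ 2 / 2)]
  have h3 : 1 + |b| ≤ 2 * rexp (b ^ 2 / 2) := by nlinarith [sq_abs b, sq_nonneg (|b| - 1)]
  calc |kappa - b| * rexp (-b ^ 2 / 2) ≤ (2 * rexp (b ^ 2 / 2)) * rexp (-b ^ 2 / 2) := by
        gcongr; exact h1.trans h3
    _ = 2 := by rw [mul_assoc, ← exp_add]; simp [neg_div]

lemma integrable_id_rayleigh (hx : 0 ≤ x) : Integrable (fun b => b) (rayleigh x) := by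
  have := isProbabilityMeasure_rayleigh hx
  refine ((integrable_sq_rayleigh hx).add (integrable_const 1)).mono'
    measurable_id.aestronglyMeasurable (.of_forall fun b => ?_)
  simp only [Pi.add_apply, norm_eq_abs]
  nlinarith [sq_nonneg (|b| - 1), sq_abs b]

lemma restrict_absolutelyContinuous_rayleigh (hx : 0 ≤ x) :
    volume.restrict (Ioi x) ≪ rayleigh x := by
  refine withDensity_absolutelyContinuous' (measurable_rayleighPDF x).ennreal_ofReal.aemeasurable ?_
  refine (ae_restrict_iff' measurableSet_Ioi).2 (.of_forall fun b hb => ?_)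
  have : 0 < rayleighPDF x b := mul_pos (lt_of_le_of_lt hx hb) (exp_pos _)
  simpa using this

/-- Integration by parts for a Lipschitz function against the law `rayleigh x`. -/
lemma integral_deriv_mul_millsGap (hx : 0.9 ≤ x) {φ p : ℝ → ℝ} (hφ : LipschitzWith 1 φ)
    (hp : Measurable p) (hp1 : ∀ b, |p b| ≤ 1)
    (hd : ∀ᵐ b ∂volume.restrict (Ioi x), HasDerivAt φ (p b) b) :
    ∫ b, (p b * millsGap b + (φ b - φ x) * (kappa * b⁻¹ - 1)) ∂rayleigh x = 0 := by
  have hx0 : 0 < x := by linarith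
  have := isProbabilityMeasure_rayleigh hx0.le
  have hF : ∀ b, x < b → |φ b - φ x| ≤ b - x := fun b hb => by
    have := hφ.dist_le_mul b x
    rwa [Real.dist_eq, Real.dist_eq, NNReal.coe_one, one_mul, abs_of_pos (sub_pos.2 hb)] at this
  have hint : Integrable (fun b => p b * millsGap b + (φ b - φ x) * (kappa * b⁻¹ - 1))
      (rayleigh x) := by
    have := measurable_millsGap
    have := hφ.continuous.measurable
    refine ((integrable_id_rayleigh hx0.le).add (integrable_const 2)).mono'
      (Measurable.aestronglyMeasurable (by fun_prop)) ?_
    filter_upwards [ae_rayleigh_lt x] with b hb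
    have h1 := millsGap_nonneg (hx.trans hb.le)
    have h2 := millsGap_le (hx.trans hb.le)
    have hb0 : 0 < b := hx0.trans hb
    have h3 : |kappa * b⁻¹ - 1| ≤ 1 := by
      have h5 : b⁻¹ ≤ 0.9⁻¹ := inv_anti₀ (by norm_num) (hx.trans hb.le)
      have h6 : 0 < b⁻¹ := by positivity
      have h7 := kappa_lt
      have h8 := kappa_pos
      rw [abs_le]; constructor
      · nlinarith [mul_pos h8 h6]
      · norm_num at h5; nlinarith
    have h4 : |(φ b - φ x) * (kappa * b⁻¹ - 1)| ≤ b := by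
      rw [abs_mul]
      nlinarith [hF b hb, abs_nonneg (φ b - φ x), abs_nonneg (kappa * b⁻¹ - 1)]
    have h5 : |p b * millsGap b| ≤ 2 := by
      rw [abs_mul, abs_of_nonneg h1]; nlinarith [hp1 b, abs_nonneg (p b)]
    simp only [norm_eq_abs, Pi.add_apply]
    exact (abs_add_le _ _).trans (by linarith)
  have hi := (integrable_rayleigh_iff hx0.le _).1 hint
  rw [integral_rayleigh hx0.le]
  have hlim := intervalIntegral_tendsto_integral_Ioi x hi tendsto_id
  refine tendsto_nhds_unique hlim ?_
  -- The weight `rayleighPDF x b * millsGap b` equals e^{x²/2}(e^{-b²/2} - κ gaussTail b), and its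
  -- derivative is `rayleighPDF x b * (kappa * b⁻¹ - 1)`. For |X| = 2e^{x²/2} this weight is the
  -- Rayleigh tail minus |X| times the Gaussian tail. The integrand is thus the derivative of a
  -- product that vanishes at x and at infinity.
  have heq : ∀ᶠ R in atTop, rexp (x ^ 2 / 2) *
      ((φ R - φ x) * (rexp (-R ^ 2 / 2) - kappa * gaussTail R)) = ∫ b in x..id R,
        rayleighPDF x b * (p b * millsGap b + (φ b - φ x) * (kappa * b⁻¹ - 1)) := by
    filter_upwards [eventually_gt_atTop x] with R hR
    have hA : AbsolutelyContinuousOnInterval (fun b => φ b - φ x) x R :=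
      ((hφ.sub (LipschitzWith.const (φ x))).lipschitzOnWith).absolutelyContinuousOnInterval
    have hB : AbsolutelyContinuousOnInterval
        (fun b => rexp (-b ^ 2 / 2) - kappa * gaussTail b) x R :=
      lipschitzWith_exp_sub_gaussTail.lipschitzOnWith.absolutelyContinuousOnInterval
    have h := hA.integral_deriv_mul_eq_sub hB
    simp only [sub_self, zero_mul, sub_zero] at h
    rw [← h, ← intervalIntegral.integral_const_mul]
    refine intervalIntegral.integral_congr_ae ?_
    rw [uIoc_of_le hR.le]
    have hd' := (ae_restrict_iff' measurableSet_Ioi).1 hd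
    filter_upwards [hd'] with b hb hbR
    have hb0 : b ≠ 0 := (hx0.trans hbR.1).ne'
    rw [((hb hbR.1).sub_const _).deriv, (hasDerivAt_exp_sub_gaussTail b).deriv, rayleighPDF_eq,
      millsGap]
    have h1 : rexp (b ^ 2 / 2) * rexp (-(b ^ 2 / 2)) = 1 := by rw [← exp_add]; simp
    rw [neg_div]
    field_simp
    linear_combination (p b * kappa * gaussTail b) * h1
  refine Tendsto.congr' heq ?_
  rw [← mul_zero (rexp (x ^ 2 / 2))]
  refine Tendsto.const_mul _ ?_
  refine squeeze_zero_norm' ?_ ((tendsto_pow_mul_exp_neg_sq_half 1).const_mul 2 |>.trans (by simp))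
  filter_upwards [eventually_gt_atTop x] with R hR
  have hR0 : 0 < R := hx0.trans hR
  have hH := gaussTail_mul_le (b := R)
  have hH0 := gaussTail_nonneg R
  have hK : |rexp (-R ^ 2 / 2) - kappa * gaussTail R| ≤ 2 * rexp (-R ^ 2 / 2) := by
    have h9 : 0.9 * gaussTail R ≤ rexp (-R ^ 2 / 2) := by nlinarith
    have := exp_pos (-R ^ 2 / 2)
    rw [abs_le]; constructor <;> nlinarith [kappa_lt, kappa_pos]
  rw [norm_eq_abs, abs_mul, pow_one]
  calc |φ R - φ x| * |rexp (-R ^ 2 / 2) - kappa * gaussTail R| ≤ R * (2 * rexp (-R ^ 2 / 2)) := by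
        gcongr; linarith [hF R hR]
    _ = _ := by ring

end Envelope

/-! ### The one-step regret for domains with at least three points -/

section Large

variable {X : Type*} [Fintype X] [Nonempty X] {m s : X → ℝ} {x : ℝ}

lemma max_line_sub_env_le (hs : ∀ y, 0 ≤ s y) (x n : ℝ) (y : X) :
    max (m y + n * s y - env m s x) 0 ≤ env m s (max n x) - env m s x := by
  refine max_le (sub_le_sub_right ?_ _) (sub_nonneg.2 (env_mono hs (le_max_right _ _)))
  exact (le_env m s n y).trans (env_mono hs (le_max_left _ _))

lemma integrable_id_gaussianReal : Integrable (fun n : ℝ => n) (gaussianReal 0 1) :=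
  (memLp_id_gaussianReal 1).integrable (by simp)

lemma integrable_env_max_sub (hs : ∀ y, 0 ≤ s y) (hs1 : ∀ y, s y ≤ 1) (x : ℝ) :
    Integrable (fun n => env m s (max n x) - env m s x) (gaussianReal 0 1) := by
  have hc := (lipschitzWith_env (m := m) hs hs1).continuous
  refine (integrable_id_gaussianReal.norm.add (integrable_const |x|)).mono'
    (Continuous.aestronglyMeasurable (by fun_prop)) (.of_forall fun n => ?_)
  have h1 := env_sub_le (m := m) hs1 (le_max_right n x)
  have h2 := env_mono (m := m) hs (le_max_right n x)
  rw [Real.norm_eq_abs, abs_of_nonneg (sub_nonneg.2 h2)]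
  simp only [Pi.add_apply, Real.norm_eq_abs]
  rcases le_total n x with h | h
  · rw [max_eq_right h, sub_self]; positivity
  · rw [max_eq_left h] at h1 ⊢
    linarith [le_abs_self n, neg_abs_le x]

lemma integrable_max_line_sub (a b : ℝ) :
    Integrable (fun n => max (a + n * b) 0) (gaussianReal 0 1) :=
  ((integrable_const a).add (integrable_id_gaussianReal.mul_const b)).pos_part

lemma integral_gaussianReal_std (g : ℝ → ℝ) :
    ∫ n, g n ∂gaussianReal 0 1 = kappa / 2 * ∫ n, rexp (-n ^ 2 / 2) * g n := by
  rw [integral_gaussianReal_eq_integral_smul one_ne_zero, ← integral_const_mul]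
  congr 1 with n
  have : (√(2 * π))⁻¹ = kappa / 2 := by
    rw [kappa, Real.sqrt_div' _ pi_pos.le, Real.sqrt_mul' _ pi_pos.le]
    have := Real.sq_sqrt (show (0 : ℝ) ≤ 2 by norm_num)
    have h2 := Real.sqrt_pos.2 (show (0 : ℝ) < 2 by norm_num)
    have h3 := Real.sqrt_pos.2 pi_pos
    field_simp
    linarith
  simp only [gaussianPDFReal, NNReal.coe_one, mul_one, sub_zero, this, smul_eq_mul, mul_assoc]

/-- The one-sided excess of the envelope under the Gaussian law in terms of `rayleigh x`. -/
lemma integral_env_max_sub {X : Type*} {m s : X → ℝ} {x : ℝ} (hx : 0 < x) :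
    2 * rexp (x ^ 2 / 2) * ∫ n, (env m s (max n x) - env m s x) ∂gaussianReal 0 1 =
      ∫ b, (env m s b - env m s x) * (kappa * b⁻¹) ∂rayleigh x := by
  rw [integral_gaussianReal_std, integral_rayleigh hx.le,
    ← setIntegral_eq_integral_of_forall_compl_eq_zero
    (s := Ioi x), ← integral_const_mul, ← integral_const_mul]
  · refine setIntegral_congr_fun measurableSet_Ioi fun b hb => ?_
    have hb' : b ≠ 0 := (hx.trans hb).ne'
    simp only [max_eq_left (le_of_lt (mem_Ioi.1 hb)), rayleighPDF_eq]
    field_simp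
  · intro n hn
    rw [max_eq_right (not_lt.1 (mt mem_Ioi.2 hn)), sub_self, mul_zero]

/-- Integration by parts for the envelope, whose slope is almost everywhere the standard deviation
of the selected point. -/
lemma integral_env_sub_eq (hx : 0.9 ≤ x) (hs : ∀ y, 0 ≤ s y) (hs1 : ∀ y, s y ≤ 1)
    {sel : ℝ → X} (hp : Measurable fun b => s (sel b))
    (hmax : ∀ᵐ b ∂rayleigh x, ∀ z, m z + b * s z ≤ m (sel b) + b * s (sel b)) :
    ∫ b, (env m s b - env m s x) * (kappa * b⁻¹) ∂rayleigh x =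
      ∫ b, (env m s b - s (sel b) * millsGap b) ∂rayleigh x - env m s x := by
  have hx0 : 0 < x := by linarith
  have := isProbabilityMeasure_rayleigh hx0.le
  have hlip := lipschitzWith_env (m := m) hs hs1
  have hmg := measurable_millsGap
  have hem := hlip.continuous.measurable
  have hd : ∀ᵐ b ∂volume.restrict (Ioi x), HasDerivAt (env m s) (s (sel b)) b := by
    filter_upwards [(restrict_absolutelyContinuous_rayleigh hx0.le).ae_le hmax,
      ae_restrict_of_ae hlip.ae_differentiableAt] with b h1 h2
    exact hasDerivAt_env h1 h2
  have h := integral_deriv_mul_millsGap hx hlip hp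
    (fun b => by rw [abs_of_nonneg (hs _)]; exact hs1 _) hd
  have hF : ∀ b, x < b → 0 ≤ env m s b - env m s x ∧ env m s b - env m s x ≤ b - x := fun b hb =>
    ⟨sub_nonneg.2 (env_mono hs hb.le), by linarith [env_sub_le (m := m) hs1 hb.le]⟩
  have i1 : Integrable (fun b => (env m s b - env m s x) * (kappa * b⁻¹)) (rayleigh x) := by
    refine (integrable_const 1).mono' (Measurable.aestronglyMeasurable (by fun_prop)) ?_
    filter_upwards [ae_rayleigh_lt x] with b hb
    have hb0 : 0 < b := hx0.trans hb
    rw [Real.norm_eq_abs, abs_of_nonneg (mul_nonneg (hF b hb).1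
      (mul_nonneg kappa_pos.le (by positivity)))]
    calc (env m s b - env m s x) * (kappa * b⁻¹) ≤ b * (1 * b⁻¹) := by
          have := hF b hb
          have h1 : 0 ≤ kappa * b⁻¹ := mul_nonneg kappa_pos.le (by positivity)
          have h2 : kappa ≤ 1 := by linarith [kappa_lt]
          gcongr
          linarith
      _ = 1 := by field_simp
  have i2 : Integrable (fun b => env m s b - s (sel b) * millsGap b) (rayleigh x) := by
    refine (((integrable_id_rayleigh hx0.le).add
      (integrable_const (|env m s x| + 1)))).mono' (hem.sub (hp.mul hmg)).aestronglyMeasurable ?_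
    filter_upwards [ae_rayleigh_lt x] with b hb
    have := hF b hb
    have h1 := millsGap_nonneg (hx.trans hb.le)
    have h2 := millsGap_le (hx.trans hb.le)
    have h3 : s (sel b) * millsGap b ≤ 1 * 0.525 := by gcongr; exact hs1 _
    have h4 := mul_nonneg (hs (sel b)) h1
    simp only [Pi.add_apply, Real.norm_eq_abs]
    rw [abs_le]
    constructor <;> linarith [neg_abs_le (env m s x), le_abs_self (env m s x)]
  have h2 : ∫ b, (s (sel b) * millsGap b + (env m s b - env m s x) * (kappa * b⁻¹ - 1)) ∂rayleigh x =
      ∫ b, (((env m s b - env m s x) * (kappa * b⁻¹)) -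
        ((env m s b - s (sel b) * millsGap b) - env m s x)) ∂rayleigh x := by
    congr 1 with b; ring
  have i3 : Integrable (fun b => env m s b - s (sel b) * millsGap b - env m s x) (rayleigh x) :=
    i2.sub (integrable_const _)
  rw [h2, integral_sub i1 i3, integral_sub i2 (integrable_const _)] at h
  simp only [integral_const, probReal_univ, one_smul] at h
  linarith

/-- All |X| summands are bounded by the same Gaussian excess of the envelope. Since |X| = 2e^{x²/2},
their number is exactly the factor that converts this excess into an integral against `rayleigh x`.
-/
lemma optBound_le (hx : 0.9 ≤ x) (hcard : (Fintype.card X : ℝ) = 2 * rexp (x ^ 2 / 2))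
    (hs : ∀ y, 0 ≤ s y) (hs1 : ∀ y, s y ≤ 1)
    {sel : ℝ → X} (hp : Measurable fun b => s (sel b))
    (hmax : ∀ᵐ b ∂rayleigh x, ∀ z, m z + b * s z ≤ m (sel b) + b * s (sel b)) :
    optBound m s x ≤ ∫ b, (env m s b - s (sel b) * millsGap b) ∂rayleigh x := by
  have h1 : ∀ y, ∫ n, max (m y + n * s y - env m s x) 0 ∂gaussianReal 0 1 ≤
      ∫ n, (env m s (max n x) - env m s x) ∂gaussianReal 0 1 := fun y => by
    refine integral_mono ?_ (integrable_env_max_sub hs hs1 x) fun n =>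
      max_line_sub_env_le hs x n y
    simpa [sub_add_eq_add_sub] using integrable_max_line_sub (m y - env m s x) (s y)
  have h2 := Finset.sum_le_sum fun y (_ : y ∈ Finset.univ) => h1 y
  rw [Finset.sum_const, Finset.card_univ, nsmul_eq_mul, hcard,
    integral_env_max_sub (by linarith), integral_env_sub_eq hx hs hs1 hp hmax] at h2
  rw [optBound]
  linarith

/-- With M the Mills ratio, b · millsGap(b) = 1 - κM(b), so the cross term in the square cancels the
2 of E b² = x² + 2 up to 2κ E M(b). Since E M(b) = ((1 - x²)M(x) + x)/2 and E b⁻¹ = M(x), it remains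
to prove κ((1 - x²)M(x) + x) + 0.2441 M(x) ≤ 1. -/
lemma integral_sub_millsGap_sq_le (hx : 0.9 ≤ x) :
    Integrable (fun b => (b - millsGap b) ^ 2) (rayleigh x) ∧
      ∫ b, (b - millsGap b) ^ 2 ∂rayleigh x ≤ x ^ 2 + 1 := by
  have hx0 : 0 < x := by linarith
  have := isProbabilityMeasure_rayleigh hx0.le
  have hmg := measurable_millsGap
  have hgt := continuous_gaussTail.measurable
  have hM : ∀ b, 0.9 ≤ b → rexp (b ^ 2 / 2) * gaussTail b ≤ (b + 1.04) / (b ^ 2 + 1.04 * b + 1) :=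
    fun b hb => exp_mul_gaussTail_le (gaussTail_le_rational hb)
  have iM : Integrable (fun b => rexp (b ^ 2 / 2) * gaussTail b) (rayleigh x) := by
    refine (integrable_const 1).mono' (Measurable.aestronglyMeasurable (by fun_prop)) ?_
    filter_upwards [ae_rayleigh_lt x] with b hb
    rw [Real.norm_eq_abs, abs_of_nonneg (mul_nonneg (exp_pos _).le (gaussTail_nonneg b))]
    have hb' := hx.trans hb.le
    refine (hM b hb').trans ?_
    rw [div_le_one (by positivity)]; nlinarith
  have j1 : Integrable (fun b => b ^ 2 - 2) (rayleigh x) :=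
    (integrable_sq_rayleigh hx0.le).sub (integrable_const _)
  have j2 : Integrable (fun b => b ^ 2 - 2 + 2 * kappa * (rexp (b ^ 2 / 2) * gaussTail b))
      (rayleigh x) := j1.add (iM.const_mul _)
  have iB : Integrable (fun b => b ^ 2 - 2 + 2 * kappa * (rexp (b ^ 2 / 2) * gaussTail b) +
      0.2441 * b⁻¹) (rayleigh x) :=
    j2.add ((integrable_inv_rayleigh hx0).const_mul _)
  have hle : ∀ᵐ b ∂rayleigh x, (b - millsGap b) ^ 2 ≤
      b ^ 2 - 2 + 2 * kappa * (rexp (b ^ 2 / 2) * gaussTail b) + 0.2441 * b⁻¹ := by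
    filter_upwards [ae_rayleigh_lt x] with b hb
    have h1 := millsGap_sq_le (hx.trans hb.le)
    have h2 : b * millsGap b = 1 - kappa * (rexp (b ^ 2 / 2) * gaussTail b) := by
      rw [millsGap, mul_div_cancel₀ _ (by linarith)]
    nlinarith
  have iS : Integrable (fun b => (b - millsGap b) ^ 2) (rayleigh x) := by
    refine iB.mono' (Measurable.aestronglyMeasurable (by fun_prop)) ?_
    filter_upwards [hle] with b hb
    rwa [Real.norm_eq_abs, abs_of_nonneg (sq_nonneg _)]
  refine ⟨iS, (integral_mono_ae iS iB hle).trans ?_⟩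
  rw [integral_add j2 ((integrable_inv_rayleigh hx0).const_mul _),
    integral_add j1 (iM.const_mul _),
    integral_sub (integrable_sq_rayleigh hx0.le) (integrable_const _), integral_const_mul,
    integral_const_mul, integral_sq_rayleigh hx0.le, integral_inv_rayleigh hx0.le,
    integral_mills_rayleigh hx0.le iM]
  have hE : rexp (x ^ 2 / 2) * rexp (-x ^ 2 / 2) = 1 := by rw [← exp_add]; simp [neg_div]
  have hlow := le_exp_mul_gaussTail (b := x) (c := x / (1 + x ^ 2)) (d := 1)
    (by simpa using le_gaussTail_rational hx0.le)
  have hup := hM x hx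
  set M := rexp (x ^ 2 / 2) * gaussTail x with hMdef
  have hre : rexp (x ^ 2 / 2) * ((1 - x ^ 2) / 2 * gaussTail x + x / 2 * rexp (-x ^ 2 / 2)) =
      ((1 - x ^ 2) * M + x) / 2 := by
    rw [hMdef]; linear_combination (x / 2) * hE
  rw [hre]
  simp only [integral_const, probReal_univ, one_smul]
  have hM0 : 0 ≤ M := mul_nonneg (exp_pos _).le (gaussTail_nonneg x)
  have hk := kappa_lt
  have hk0 := kappa_pos
  rw [le_div_iff₀ (by positivity)] at hup
  suffices kappa * ((1 - x ^ 2) * M + x) + 0.2441 * M ≤ 1 by linarith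
  -- The sign of 1 - x² decides which bound on M is useful in the first term: the upper one for x ≤
  -- 1, the lower one for x ≥ 1.
  rcases le_total x 1 with h | h
  · have h1 : kappa * ((1 - x ^ 2) * M + x) ≤ 0.79789 * ((1 - x ^ 2) * M + x) := by
      have : 0 ≤ (1 - x ^ 2) * M := mul_nonneg (by nlinarith) hM0
      gcongr
    have h2 : (0.79789 * (1 - x ^ 2) + 0.2441) * (M * (x ^ 2 + 1.04 * x + 1)) ≤
        (0.79789 * (1 - x ^ 2) + 0.2441) * (x + 1.04) := by
      refine mul_le_mul_of_nonneg_left hup ?_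
      nlinarith
    have h3 : (0.79789 * (1 - x ^ 2) + 0.2441) * (x + 1.04) ≤
        (1 - 0.79789 * x) * (x ^ 2 + 1.04 * x + 1) := by nlinarith
    have h4 : (0.79789 * (1 - x ^ 2) + 0.2441) * M ≤ 1 - 0.79789 * x := by
      refine le_of_mul_le_mul_right (a := x ^ 2 + 1.04 * x + 1) ?_ (by positivity)
      linarith
    linarith
  · have h1 : (1 - x ^ 2) * M + x ≤ 1 := by
      have : x / (1 + x ^ 2) ≤ M := by simpa using hlow
      have h2 : (1 - x ^ 2) * M ≤ (1 - x ^ 2) * (x / (1 + x ^ 2)) :=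
        mul_le_mul_of_nonpos_left this (by nlinarith)
      have h3 : (1 - x ^ 2) * (x / (1 + x ^ 2)) + x = 2 * x / (1 + x ^ 2) := by
        field_simp; ring
      have h4 : 2 * x / (1 + x ^ 2) ≤ 1 := by
        rw [div_le_one (by positivity)]; nlinarith [sq_nonneg (x - 1)]
      linarith
    have h2 : M ≤ 0.68 := by
      refine le_of_mul_le_mul_right (a := x ^ 2 + 1.04 * x + 1) ?_ (by positivity)
      nlinarith
    nlinarith

/-- The exponential moments of the one-step regret under optimal selection, for domains with at
least three points. -/
lemma lintegral_exp_optBound_le_of_large (hx : 0.9 ≤ x)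
    (hcard : (Fintype.card X : ℝ) = 2 * rexp (x ^ 2 / 2))
    (hs : ∀ y, 0 ≤ s y) (hs1 : ∀ y, s y ≤ 1)
    {sel : ℝ → X} (hp : Measurable fun b => s (sel b))
    (hmax : ∀ᵐ b ∂rayleigh x, ∀ z, m z + b * s z ≤ m (sel b) + b * s (sel b))
    {C l : ℝ} (hC : 0 < C) (hl : 0 ≤ l) :
    ∫⁻ b, ENNReal.ofReal (rexp (l * (optBound m s x - m (sel b) - C * s (sel b) ^ 2 -
      (x ^ 2 + 1) / (4 * C)))) ∂rayleigh x ≤ ENNReal.ofReal (rexp (9 * l ^ 2)) := by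
  have hx0 : 0 < x := by linarith
  have hlip := lipschitzWith_env (m := m) hs hs1
  have hmg := measurable_millsGap
  have hem := hlip.continuous.measurable
  have hhm := measurable_huber C
  -- With s taken at the selected point, b s - C s² = s · millsGap(b) + ((b - millsGap(b)) s - C
  -- s²), and the last bracket is at most the Huber value. Together with `optBound_le` and E huber ≤
  -- (x² + 1)/(4C), this bounds the gap of the step by Y - E Y.
  set Y : ℝ → ℝ := fun b => s (sel b) * millsGap b - env m s b + huber C (b - millsGap b) with hY
  have hYm : Measurable Y := by
    have := hhm.comp (measurable_id.sub hmg)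
    exact ((hp.mul hmg).sub hem).add this
  -- The increments of -env and of the Huber term have opposite signs apart from 0.525, so their
  -- slopes do not add. Another 0.525 comes from s · millsGap, whence 1.05.
  have key : ∀ b b', x < b → x < b' → b' ≤ b → |Y b - Y b'| ≤ |b - b'| + 1.05 := by
    intro b b' hb hb' hbb
    have u0 := millsGap_nonneg (hx.trans hb.le)
    have u1 := millsGap_le (hx.trans hb.le)
    have v0 := millsGap_nonneg (hx.trans hb'.le)
    have v1 := millsGap_le (hx.trans hb'.le)
    have e0 := env_mono (m := m) hs hbb
    have e1 := env_sub_le (m := m) hs1 hbb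
    have p1 : s (sel b) * millsGap b ≤ 1 * 0.525 := by gcongr; exact hs1 _
    have p2 : s (sel b') * millsGap b' ≤ 1 * 0.525 := by gcongr; exact hs1 _
    have p3 := mul_nonneg (hs (sel b)) u0
    have p4 := mul_nonneg (hs (sel b')) v0
    have q1 := huber_sub_le hC (w := b - millsGap b) (w' := b' - millsGap b')
      (d := b - b' + 0.525) (by linarith) (by linarith)
    have q2 := huber_sub_le hC (w := b' - millsGap b') (w' := b - millsGap b)
      (d := 0.525) (by norm_num) (by linarith)
    rw [abs_of_nonneg (sub_nonneg.2 hbb), abs_le]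
    constructor <;> simp only [hY] <;> linarith
  have hY1 : ∀ b b', x < b → x < b' → |Y b - Y b'| ≤ |b - b'| + 1.05 := by
    intro b b' hb hb'
    rcases le_total b' b with h | h
    · exact key b b' hb hb' h
    · rw [abs_sub_comm, abs_sub_comm b]; exact key b' b hb' hb h
  refine le_trans (lintegral_mono_ae ?_) (lintegral_exp_rayleigh_le hx0.le hYm hY1 hl)
  have hYi := integrable_of_lipschitz hx0.le hYm hY1
  obtain ⟨hSi, hS⟩ := integral_sub_millsGap_sq_le hx
  have hHi : Integrable (fun b => huber C (b - millsGap b)) (rayleigh x) := by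
    refine (hSi.div_const (4 * C)).mono'
      (hhm.comp (measurable_id.sub hmg)).aestronglyMeasurable (.of_forall fun b => ?_)
    have h0 : 0 ≤ huber C (b - millsGap b) := by
      simpa using le_huber hC (b - millsGap b) (p := 0) le_rfl zero_le_one
    rw [Real.norm_eq_abs, abs_of_nonneg h0]
    exact huber_le_sq hC _
  have hH : ∫ b, huber C (b - millsGap b) ∂rayleigh x ≤ (x ^ 2 + 1) / (4 * C) := by
    refine (integral_mono hHi (hSi.div_const (4 * C)) fun b => huber_le_sq hC _).trans ?_
    rw [integral_div]; gcongr
  have hopt := optBound_le hx hcard hs hs1 hp hmax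
  have hEY : ∫ b, Y b ∂rayleigh x = ∫ b, huber C (b - millsGap b) ∂rayleigh x -
      ∫ b, (env m s b - s (sel b) * millsGap b) ∂rayleigh x := by
    have : ∀ b, env m s b - s (sel b) * millsGap b = huber C (b - millsGap b) - Y b :=
      fun b => by simp only [hY]; ring
    simp_rw [this]
    rw [integral_sub hHi hYi]; ring
  filter_upwards [hmax] with b hb
  refine ENNReal.ofReal_le_ofReal (exp_le_exp.2 (mul_le_mul_of_nonneg_left ?_ hl))
  have h1 := env_eq hb
  have h2 := le_huber hC (b - millsGap b) (hs (sel b)) (hs1 (sel b))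
  rw [hEY]
  simp only [hY]
  linarith

end Large

/-! ### Numerical inequalities for two arms -/

section TwoPoint

/-- The linear term is kept exactly, so that it cancels when a centred two-point variable is
averaged. -/
lemma exp_le_add_exp_sq (t : ℝ) : rexp t ≤ t + rexp (t ^ 2) := by
  have h2 := add_one_le_exp (t ^ 2)
  rcases le_or_gt |t| 1 with h | h
  · have := (abs_le.1 (abs_exp_sub_one_sub_id_le h)).2
    linarith
  · rcases lt_abs.1 h with h | h
    · have : rexp t ≤ rexp (t ^ 2) := exp_le_exp.2 (by nlinarith)
      linarith
    · have : rexp t ≤ 1 := exp_le_one_iff.2 (by linarith)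
      nlinarith

/-- Exponential moments of a random variable with the value `a₁` with probability `e^{-α²/2}` and
the value `a₀` otherwise. -/
lemma two_point_mgf_le {α p a₀ a₁ l : ℝ} (hα : 0 < α) (hp : p = rexp (-α ^ 2 / 2))
    (h0 : a₀ ≤ 0.4 * p) (h1 : a₁ ≤ 0 ∨ a₁ ≤ α - 0.6) (hm : (1 - p) * a₀ + p * a₁ ≤ 0)
    (hl : 0 ≤ l) :
    (1 - p) * rexp (l * a₀) + p * rexp (l * a₁) ≤ rexp (9 * l ^ 2) := by
  have hp0 : 0 < p := hp ▸ exp_pos _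
  have hp1 : p < 1 := by rw [hp, exp_lt_one_iff]; have := pow_pos hα 2; linarith
  have hq : 0 < 1 - p := by linarith
  rcases le_or_gt a₀ 0 with ha0 | ha0
  · rcases le_or_gt a₁ 0 with ha1 | ha1
    · have e0 : rexp (l * a₀) ≤ 1 := exp_le_one_iff.2 (mul_nonpos_of_nonneg_of_nonpos hl ha0)
      have e1 : rexp (l * a₁) ≤ 1 := exp_le_one_iff.2 (mul_nonpos_of_nonneg_of_nonpos hl ha1)
      have : 1 ≤ rexp (9 * l ^ 2) := one_le_exp (by positivity)
      nlinarith
    · have h1' : a₁ ≤ α - 0.6 := h1.resolve_left (by linarith)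
      -- Completing the square: lα - α²/2 ≤ l²/2.
      have hpα : p * rexp (l * α) ≤ rexp (l ^ 2 / 2) := by
        rw [hp, ← exp_add, exp_le_exp]; nlinarith [sq_nonneg (l - α)]
      have hea : rexp (l * a₁) ≤ rexp (l * α) :=
        exp_le_exp.2 (mul_le_mul_of_nonneg_left (by linarith) hl)
      rcases le_or_gt (1 / 2) (l ^ 2) with h2 | h2
      · have e0 : rexp (l * a₀) ≤ 1 := exp_le_one_iff.2 (mul_nonpos_of_nonneg_of_nonpos hl ha0)
        have e1 : (1 : ℝ) ≤ rexp (l ^ 2 / 2) := one_le_exp (by positivity)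
        have e2 : 2 ≤ rexp 1 := by linarith [add_one_le_exp (1 : ℝ)]
        calc (1 - p) * rexp (l * a₀) + p * rexp (l * a₁)
            ≤ 1 * 1 + p * rexp (l * α) := by gcongr; linarith
          _ ≤ rexp 1 * rexp (l ^ 2 / 2) := by nlinarith
          _ = rexp (1 + l ^ 2 / 2) := (exp_add _ _).symm
          _ ≤ _ := exp_le_exp.2 (by linarith)
      -- Raising a₀ to -z makes the mean exactly 0; the linear terms then cancel.
      · set z := p * a₁ / (1 - p) with hz
        have hz0 : 0 ≤ z := by positivity
        have hz1 : a₀ ≤ -z := by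
          rw [hz, ← neg_div, le_div_iff₀ hq]; linarith
        -- The inequality α - 0.6 ≤ 0.42 α² has negative discriminant, and p α²/2 ≤ 1 - p because
        -- e^{α²/2} ≥ 1 + α²/2.
        have hz2 : z ≤ 0.84 := by
          have e1 : 1 + α ^ 2 / 2 ≤ rexp (α ^ 2 / 2) := by linarith [add_one_le_exp (α ^ 2 / 2)]
          have e2 : p * rexp (α ^ 2 / 2) = 1 := by rw [hp, ← exp_add]; simp [neg_div]
          have e3 : p * (α ^ 2 / 2) ≤ 1 - p := by nlinarith
          rw [hz, div_le_iff₀ hq]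
          have e4 : a₁ ≤ 0.84 * (α ^ 2 / 2) := by nlinarith [sq_nonneg (α - 1.19)]
          nlinarith
        have e0 : rexp (l * a₀) ≤ -(l * z) + rexp (l ^ 2) := by
          refine (exp_le_exp.2 (by nlinarith : l * a₀ ≤ -(l * z))).trans
            ((exp_le_add_exp_sq _).trans ?_)
          refine (add_le_add_iff_left _).2 (exp_le_exp.2 ?_)
          have : z ^ 2 ≤ 1 := by nlinarith
          nlinarith [sq_nonneg l]
        have e1 : rexp (l * a₁) ≤ l * a₁ + rexp (l ^ 2 * α ^ 2) := by
          refine (exp_le_add_exp_sq _).trans ?_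
          rw [mul_pow]
          gcongr
          linarith
        -- The left side is the power p^{1 - 2l²}, and convexity of exp bounds it by (1 - 2l²) p +
        -- 2l². This uses l² < 1/2.
        have e2 : p * rexp (l ^ 2 * α ^ 2) ≤ p + 2 * l ^ 2 * (1 - p) := by
          have hc := convexOn_exp.2 (mem_univ (-α ^ 2 / 2)) (mem_univ 0)
            (by linarith : 0 ≤ 1 - 2 * l ^ 2) (by positivity : 0 ≤ 2 * l ^ 2) (by ring)
          simp only [smul_eq_mul, mul_zero, add_zero, exp_zero, mul_one] at hc
          rw [← hp] at hc
          rw [hp, ← exp_add, ← hp]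
          refine (le_of_eq (congrArg _ (by ring))).trans (hc.trans (le_of_eq (by ring)))
        have e3 : p * a₁ = (1 - p) * z := by rw [hz]; field_simp
        have e4 : 2 * l ^ 2 + rexp (l ^ 2) ≤ rexp (9 * l ^ 2) := by
          have f1 : 1 ≤ rexp (l ^ 2) := one_le_exp (by positivity)
          have f2 := add_one_le_exp (8 * l ^ 2)
          have f3 : rexp (9 * l ^ 2) = rexp (8 * l ^ 2) * rexp (l ^ 2) := by
            rw [← exp_add]; ring_nf
          rw [f3]; nlinarith [sq_nonneg l]
        have e5 : 1 ≤ rexp (9 * l ^ 2) := one_le_exp (by positivity)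
        calc (1 - p) * rexp (l * a₀) + p * rexp (l * a₁)
            ≤ (1 - p) * (-(l * z) + rexp (l ^ 2)) + p * (l * a₁ + rexp (l ^ 2 * α ^ 2)) := by
              gcongr
          _ = (1 - p) * rexp (l ^ 2) + p * rexp (l ^ 2 * α ^ 2) := by linear_combination l * e3
          _ ≤ p + (1 - p) * (2 * l ^ 2 + rexp (l ^ 2)) := by linarith
          _ ≤ p * rexp (9 * l ^ 2) + (1 - p) * rexp (9 * l ^ 2) := by gcongr; nlinarith
          _ = _ := by ring
  · set z := (1 - p) * a₀ / p with hz
    have hz0 : 0 ≤ z := by positivity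
    have hz1 : a₁ ≤ -z := by rw [hz, ← neg_div, le_div_iff₀ hp0]; linarith
    have hz2 : z ≤ 1 := by rw [hz, div_le_one hp0]; nlinarith
    have e0 : rexp (l * a₀) ≤ l * a₀ + rexp (9 * l ^ 2) := by
      refine (exp_le_add_exp_sq _).trans ?_
      refine (add_le_add_iff_left _).2 (exp_le_exp.2 ?_)
      have : a₀ ^ 2 ≤ 1 := by nlinarith
      nlinarith [sq_nonneg l]
    have e1 : rexp (l * a₁) ≤ -(l * z) + rexp (9 * l ^ 2) := by
      refine (exp_le_exp.2 (by nlinarith : l * a₁ ≤ -(l * z))).trans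
        ((exp_le_add_exp_sq _).trans ?_)
      refine (add_le_add_iff_left _).2 (exp_le_exp.2 ?_)
      have : z ^ 2 ≤ 1 := by nlinarith
      nlinarith [sq_nonneg l]
    have e3 : p * z = (1 - p) * a₀ := by rw [hz]; field_simp
    calc (1 - p) * rexp (l * a₀) + p * rexp (l * a₁)
        ≤ (1 - p) * (l * a₀ + rexp (9 * l ^ 2)) + p * (-(l * z) + rexp (9 * l ^ 2)) := by gcongr
      _ = _ := by linear_combination (-l) * e3

/-- This is θ² - 1.6θ + 1 ≤ 0.36 e^{α²/2} for θ = α + 0.4/(1 + α²), with a Taylor polynomial in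
place of the exponential and denominators cleared. -/
lemma two_arm_polynomial {α : ℝ} (hα : 0.7 ≤ α) :
    (α * (1 + α ^ 2) + 0.4) ^ 2 - 1.6 * (α * (1 + α ^ 2) + 0.4) * (1 + α ^ 2) + (1 + α ^ 2) ^ 2 ≤
      0.36 * (1 + α ^ 2 / 2 + α ^ 4 / 8 + α ^ 6 / 48) * (1 + α ^ 2) ^ 2 := by
  rw [← sub_nonneg]
  rcases le_total α 1.3 with h | h
  · obtain ⟨u, rfl⟩ : ∃ u, α = 0.7 + u := ⟨α - 0.7, by ring⟩
    have hu : 0 ≤ u := by linarith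
    have hu1 : u ≤ 0.6 := by norm_num at h ⊢; linarith
    have h2 : u ^ 2 ≤ 0.36 := by nlinarith
    have h3 : u ^ 3 ≤ 0.36 * u := by nlinarith
    have h4 : u ^ 4 ≤ 0.216 * u := by nlinarith [pow_nonneg hu 3]
    have h5 := pow_nonneg hu 5
    have h6 := pow_nonneg hu 6
    have h7 := pow_nonneg hu 7
    have h8 := pow_nonneg hu 8
    have h9 := pow_nonneg hu 9
    have h10 := pow_nonneg hu 10
    have h22 := sq_nonneg u
    ring_nf
    linarith
  · obtain ⟨u, rfl⟩ : ∃ u, α = 1.3 + u := ⟨α - 1.3, by ring⟩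
    have hu : 0 ≤ u := by linarith
    ring_nf
    positivity

/-- The mean of the one-step regret with two arms whose standard deviations are `s₁` and
`s₁ + d`. -/
lemma two_arm_mean_nonpos {α p s₁ d C A : ℝ} (hα : 0 < α) (hp : p = rexp (-α ^ 2 / 2))
    (hs : 0 ≤ s₁) (hd : 0 ≤ d) (hC : 0 < C) (hA : A ≤ 0.8 * s₁ + d * (0.4 * p / (1 + α ^ 2))) :
    (1 - p) * (A - C * s₁ ^ 2 - 1 / (4 * C)) +
      p * (A + d * α - C * (s₁ + d) ^ 2 - 1 / (4 * C)) ≤ 0 := by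
  have hp0 : 0 < p := hp ▸ exp_pos _
  have hp1 : p < 1 := by rw [hp, exp_lt_one_iff]; have := pow_pos hα 2; linarith
  have hq : 0 < 1 - p := by linarith
  -- The square is replaced by its tangents, so that the claim becomes linear in s₁ and d, with free
  -- slopes w.
  have hw : ∀ s w : ℝ, w * s - w ^ 2 * (1 / (4 * C)) ≤ C * s ^ 2 := fun s w => by
    have : C * s ^ 2 - (w * s - w ^ 2 * (1 / (4 * C))) = C * (s - w / (2 * C)) ^ 2 := by
      field_simp; ring
    nlinarith [mul_nonneg hC.le (sq_nonneg (s - w / (2 * C)))]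
  have hK : 0 < 1 / (4 * C) := by positivity
  set θ := α + 0.4 / (1 + α ^ 2) with hθ
  have hAθ : A + p * (d * α) ≤ 0.8 * s₁ + d * (p * θ) := by
    have : d * (p * θ) = d * (0.4 * p / (1 + α ^ 2)) + p * (d * α) := by rw [hθ]; ring
    linarith
  -- The first condition compares the coefficients of s₁, the second those of d, and the third the
  -- terms in 1/(4C).
  obtain ⟨w₀, w₁, hw0, hw1, hw2⟩ : ∃ w₀ w₁ : ℝ, 0.8 ≤ (1 - p) * w₀ + p * w₁ ∧ p * θ ≤ p * w₁ ∧
      (1 - p) * w₀ ^ 2 + p * w₁ ^ 2 ≤ 1 := by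
    rcases le_or_gt θ 1 with h | h
    · exact ⟨1, 1, by linarith, by gcongr, by linarith⟩
    -- With w₁ = θ the slope w₀ is chosen to make the mean exactly 0.8. The second moment condition
    -- then reads p(θ² - 1.6θ + 1) ≤ 1 - 0.8² = 0.36.
    · refine ⟨(0.8 - p * θ) / (1 - p), θ, by field_simp; linarith, le_rfl, ?_⟩
      have hα7 : 0.7 ≤ α := by
        by_contra! hc
        have : 1 - α < 0.4 / (1 + α ^ 2) := by linarith
        rw [lt_div_iff₀ (by positivity)] at this
        nlinarith [mul_pos (sub_pos.2 hc) hα, sq_nonneg α,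
          mul_nonneg (sub_pos.2 hc).le (sq_nonneg (α - 0.15))]
      have hpoly := two_arm_polynomial hα7
      have hθ' : α * (1 + α ^ 2) + 0.4 = θ * (1 + α ^ 2) := by rw [hθ]; field_simp
      rw [hθ'] at hpoly
      have h1 : θ ^ 2 - 1.6 * θ + 1 ≤ 0.36 * (1 + α ^ 2 / 2 + α ^ 4 / 8 + α ^ 6 / 48) := by
        refine le_of_mul_le_mul_right (a := (1 + α ^ 2) ^ 2) ?_ (by positivity)
        linarith
      have h2 : 1 + α ^ 2 / 2 + α ^ 4 / 8 + α ^ 6 / 48 ≤ rexp (α ^ 2 / 2) := by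
        have := Real.sum_le_exp_of_nonneg (x := α ^ 2 / 2) (by positivity) 4
        simp only [Finset.sum_range_succ, Finset.sum_range_zero, Nat.factorial] at this
        norm_num at this
        nlinarith
      have h3 : p * rexp (α ^ 2 / 2) = 1 := by rw [hp, ← exp_add]; simp [neg_div]
      have h4 : p * (θ ^ 2 - 1.6 * θ + 1) ≤ 0.36 := by nlinarith
      have h5 : (1 - p) * ((0.8 - p * θ) / (1 - p)) ^ 2 = (0.8 - p * θ) ^ 2 / (1 - p) := by
        field_simp
      rw [h5, ← le_sub_iff_add_le, div_le_iff₀ hq]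
      nlinarith
  have a0 := mul_le_mul_of_nonneg_left (hw s₁ w₀) hq.le
  have a1 := mul_le_mul_of_nonneg_left (hw (s₁ + d) w₁) hp0.le
  have a2 := mul_le_mul_of_nonneg_right hw2 hK.le
  have a3 := mul_le_mul_of_nonneg_right hw0 hs
  have a4 := mul_le_mul_of_nonneg_left hw1 hd
  linarith

end TwoPoint

/-! ### The one-step regret for two points, and the estimate for all domain sizes -/

section TwoArms

lemma setIntegral_mul_exp_neg_sq_half {α : ℝ} (hα : 0 ≤ α) :
    ∫ n in Ioi α, n * rexp (-n ^ 2 / 2) = rexp (-α ^ 2 / 2) := by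
  have := isProbabilityMeasure_rayleigh hα
  have h := integral_rayleigh hα fun _ => (1 : ℝ)
  simp only [integral_const, probReal_univ, one_smul, mul_one, rayleighPDF_eq] at h
  rw [integral_const_mul] at h
  have h2 : rexp (-α ^ 2 / 2) * rexp (α ^ 2 / 2) = 1 := by rw [← exp_add]; simp [neg_div]
  calc _ = (rexp (-α ^ 2 / 2) * rexp (α ^ 2 / 2)) * ∫ n in Ioi α, n * rexp (-n ^ 2 / 2) := by
        rw [h2, one_mul]
    _ = _ := by rw [mul_assoc, ← h, mul_one]

lemma integral_max_sub_le {α : ℝ} (hα : 0 ≤ α) :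
    ∫ n, max (n - α) 0 ∂gaussianReal 0 1 ≤ kappa / 2 * (rexp (-α ^ 2 / 2) / (1 + α ^ 2)) := by
  rw [integral_gaussianReal_std, ← setIntegral_eq_integral_of_forall_compl_eq_zero (s := Ioi α)]
  · refine mul_le_mul_of_nonneg_left ?_ (by linarith [kappa_pos])
    have h1 : ∫ n in Ioi α, rexp (-n ^ 2 / 2) * max (n - α) 0 =
        ∫ n in Ioi α, (n * rexp (-n ^ 2 / 2) - α * rexp (-n ^ 2 / 2)) := by
      refine setIntegral_congr_fun measurableSet_Ioi fun n hn => ?_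
      simp only [max_eq_left (sub_nonneg.2 (le_of_lt (mem_Ioi.1 hn)))]
      ring
    rw [h1, integral_sub integrable_mul_exp_neg_sq_half.integrableOn
      (integrable_exp_neg_sq_half.const_mul _).integrableOn, integral_const_mul,
      setIntegral_mul_exp_neg_sq_half hα]
    have h2 := le_gaussTail_rational hα
    have h3 : rexp (-α ^ 2 / 2) / (1 + α ^ 2) =
        rexp (-α ^ 2 / 2) - α * (α / (1 + α ^ 2) * rexp (-α ^ 2 / 2)) := by
      field_simp; ring
    rw [h3]
    exact sub_le_sub_left (mul_le_mul_of_nonneg_left h2 hα) _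
  · intro n hn
    rw [max_eq_right (sub_nonpos.2 (not_lt.1 (mt mem_Ioi.2 hn))), mul_zero]

lemma integral_max_le : ∫ n, max n 0 ∂gaussianReal 0 1 ≤ kappa / 2 := by
  simpa using integral_max_sub_le le_rfl

lemma rayleigh_zero_Ioi {α : ℝ} (hα : 0 < α) :
    rayleigh 0 (Ioi α) = ENNReal.ofReal (rexp (-α ^ 2 / 2)) := by
  have h0 := lintegral_rayleigh (x := 0) (F := (Ioi α).indicator 1)
    (measurable_one.indicator measurableSet_Ioi)
  have := isProbabilityMeasure_rayleigh hα.le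
  have h1 := lintegral_rayleigh (x := α) (F := 1) measurable_one
  rw [lintegral_indicator_one measurableSet_Ioi] at h0
  simp only [Pi.one_apply, lintegral_one, measure_univ, mul_one] at h1
  have h2 : ∫⁻ b in Ioi 0, ENNReal.ofReal (rayleighPDF 0 b) * (Ioi α).indicator 1 b =
      ∫⁻ b in Ioi α, ENNReal.ofReal (rayleighPDF 0 b) := by
    rw [← lintegral_indicator measurableSet_Ioi, ← lintegral_indicator measurableSet_Ioi]
    congr 1 with b
    by_cases hb : b ∈ Ioi α
    · have : b ∈ Ioi 0 := hα.trans hb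
      simp [hb, this]
    · simp [hb, Set.indicator]
  have h3 : ∀ b, ENNReal.ofReal (rayleighPDF 0 b) =
      ENNReal.ofReal (rexp (-α ^ 2 / 2)) * ENNReal.ofReal (rayleighPDF α b) := fun b => by
    rw [← ENNReal.ofReal_mul (exp_pos _).le, rayleighPDF_eq, rayleighPDF_eq,
      ← mul_assoc (rexp (-α ^ 2 / 2)), ← exp_add]
    simp [neg_div]
  rw [h0, h2]
  simp_rw [h3]
  rw [lintegral_const_mul _ (measurable_rayleighPDF α).ennreal_ofReal, ← h1, mul_one]

lemma lintegral_two_values_rayleigh {α a₀ a₁ : ℝ} (hα : 0 < α) (h0 : 0 ≤ a₀) (h1 : 0 ≤ a₁) :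
    ∫⁻ b, ENNReal.ofReal (if α < b then a₁ else a₀) ∂rayleigh 0 =
      ENNReal.ofReal ((1 - rexp (-α ^ 2 / 2)) * a₀ + rexp (-α ^ 2 / 2) * a₁) := by
  have := isProbabilityMeasure_rayleigh le_rfl
  have h2 : ∀ b, ENNReal.ofReal (if α < b then a₁ else a₀) =
      (Ioi α).indicator (fun _ => ENNReal.ofReal a₁) b +
        (Ioi α)ᶜ.indicator (fun _ => ENNReal.ofReal a₀) b := fun b => by
    by_cases hb : α < b
    · simp [hb]
    · simp [hb, not_lt.1 hb]
  have hp1 : rexp (-α ^ 2 / 2) ≤ 1 := exp_le_one_iff.2 (by have := sq_nonneg α; linarith)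
  simp_rw [h2]
  rw [lintegral_add_left (measurable_const.indicator measurableSet_Ioi),
    lintegral_indicator_const measurableSet_Ioi,
    lintegral_indicator_const measurableSet_Ioi.compl, prob_compl_eq_one_sub measurableSet_Ioi,
    rayleigh_zero_Ioi hα, ← ENNReal.ofReal_one, ← ENNReal.ofReal_sub _ (exp_pos _).le,
    ← ENNReal.ofReal_mul h1, ← ENNReal.ofReal_mul h0,
    ← ENNReal.ofReal_add (by positivity) (mul_nonneg h0 (by linarith))]
  congr 1
  ring

variable {X : Type*} [Fintype X] [Nonempty X] {m s : X → ℝ}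

lemma integrable_max_sub (α : ℝ) :
    Integrable (fun n => max (n - α) 0) (gaussianReal 0 1) :=
  (integrable_id_gaussianReal.sub (integrable_const α)).pos_part

/-- The exponential moments of the one-step regret under optimal selection, for domains with
two points. -/
lemma lintegral_exp_optBound_le_of_two (hcard : Fintype.card X = 2)
    (hs : ∀ y, 0 ≤ s y) (hs1 : ∀ y, s y ≤ 1) {sel : ℝ → X}
    (hmax : ∀ᵐ b ∂rayleigh 0, ∀ z, m z + b * s z ≤ m (sel b) + b * s (sel b))
    {C l : ℝ} (hC : 0 < C) (hl : 0 ≤ l) :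
    ∫⁻ b, ENNReal.ofReal (rexp (l * (optBound m s 0 - m (sel b) - C * s (sel b) ^ 2 -
      1 / (4 * C)))) ∂rayleigh 0 ≤ ENNReal.ofReal (rexp (9 * l ^ 2)) := by
  classical
  have := isProbabilityMeasure_rayleigh le_rfl
  have hψ : ∀ t : ℝ, t ≤ C * t ^ 2 + 1 / (4 * C) := fun t => by
    have : C * t ^ 2 + 1 / (4 * C) - t = C * (t - 1 / (2 * C)) ^ 2 := by field_simp; ring
    nlinarith [mul_nonneg hC.le (sq_nonneg (t - 1 / (2 * C)))]
  have hk : kappa / 2 ≤ 0.4 := by linarith [kappa_lt]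
  have hmain : ∀ b, (optBound m s 0 - m (sel b) - C * s (sel b) ^ 2 - 1 / (4 * C) ≤ 0) →
      ENNReal.ofReal (rexp (l * (optBound m s 0 - m (sel b) - C * s (sel b) ^ 2 -
        1 / (4 * C)))) ≤ 1 := fun b hb => by
    rw [ENNReal.ofReal_le_one, exp_le_one_iff]
    exact mul_nonpos_of_nonneg_of_nonpos hl hb
  have hone : (1 : ℝ≥0∞) ≤ ENNReal.ofReal (rexp (9 * l ^ 2)) := by
    rw [ENNReal.one_le_ofReal]; exact one_le_exp (by positivity)
  have hnonpos : (∀ᵐ b ∂rayleigh 0,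
      optBound m s 0 - m (sel b) - C * s (sel b) ^ 2 - 1 / (4 * C) ≤ 0) →
      ∫⁻ b, ENNReal.ofReal (rexp (l * (optBound m s 0 - m (sel b) - C * s (sel b) ^ 2 -
      1 / (4 * C)))) ∂rayleigh 0 ≤ ENNReal.ofReal (rexp (9 * l ^ 2)) := fun h => by
    refine le_trans (lintegral_mono_ae (h.mono hmain)) ?_
    simpa using hone
  obtain ⟨y₁, y₂, hne, huniv, h12⟩ : ∃ y₁ y₂ : X, y₁ ≠ y₂ ∧ (Finset.univ : Finset X) = {y₁, y₂} ∧
      s y₁ ≤ s y₂ := by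
    obtain ⟨a, b, hab, h⟩ := Finset.card_eq_two.1 (Finset.card_univ.trans hcard)
    rcases le_total (s a) (s b) with h' | h'
    · exact ⟨a, b, hab, by rw [h], h'⟩
    · exact ⟨b, a, hab.symm, by rw [h, Finset.pair_comm], h'⟩
  have hcases : ∀ y, y = y₁ ∨ y = y₂ := fun y => by
    have := Finset.mem_univ y; rw [huniv] at this; simpa using this
  have hopt : optBound m s 0 = env m s 0 +
      (∫ n, max (m y₁ + n * s y₁ - env m s 0) 0 ∂gaussianReal 0 1 +
        ∫ n, max (m y₂ + n * s y₂ - env m s 0) 0 ∂gaussianReal 0 1) := by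
    rw [optBound, huniv, Finset.sum_pair hne]
  have hpos : Integrable (fun n : ℝ => max n 0) (gaussianReal 0 1) := by
    simpa using integrable_max_sub 0
  have hline : ∀ a t : ℝ, a ≤ 0 → 0 ≤ t →
      ∫ n, max (a + n * t) 0 ∂gaussianReal 0 1 ≤ 0.4 * t := fun a t ha ht => by
    have h1 : ∫ n, max (a + n * t) 0 ∂gaussianReal 0 1 ≤ ∫ n, t * max n 0 ∂gaussianReal 0 1 := by
      refine integral_mono (integrable_max_line_sub a t) (hpos.const_mul t) fun n => max_le ?_ ?_
      · nlinarith [le_max_left n 0]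
      · exact mul_nonneg ht (le_max_right _ _)
    rw [integral_const_mul] at h1
    nlinarith [integral_max_le]
  have hb0 := ae_rayleigh_lt 0
  -- If y₂ has both the larger mean and the larger deviation, its line is on top for all b > 0. The
  -- gap is then nonpositive, since 0.4(s₁ + s₂) ≤ 0.8 s₂ and t ≤ C t² + 1/(4C).
  rcases le_or_gt (m y₁) (m y₂) with hm | hm
  · have henv : env m s 0 = m y₂ := by
      rw [env_eq (y := y₂)]
      · ring
      · intro z; rcases hcases z with rfl | rfl <;> simp [hm]
    have h1 := hline (m y₁ - m y₂) (s y₁) (by linarith) (hs _)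
    have h2 := hline 0 (s y₂) le_rfl (hs _)
    have e1 : ∀ n, m y₁ + n * s y₁ - m y₂ = m y₁ - m y₂ + n * s y₁ := fun n => by ring
    have e2 : ∀ n, m y₂ + n * s y₂ - m y₂ = 0 + n * s y₂ := fun n => by ring
    simp only [henv, e1, e2] at hopt
    refine hnonpos ?_
    filter_upwards [hmax, hb0] with b hb hb0
    have h3 := hψ (s (sel b))
    have h4 := hs (sel b)
    rcases hcases (sel b) with h | h <;> rw [h] at h3 h4 ⊢
    · have h5 := hb y₂
      rw [h] at h5
      have h6 := mul_le_mul_of_nonneg_left h12 hb0.le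
      have h7 : s y₂ = s y₁ := le_antisymm (le_of_mul_le_mul_left (by linarith) hb0) h12
      rw [h7] at h2 h5 hopt
      linarith
    · linarith
  · have henv : env m s 0 = m y₁ := by
      rw [env_eq (y := y₁)]
      · ring
      · intro z; rcases hcases z with rfl | rfl <;> simp [hm.le]
    have h1 := hline 0 (s y₁) le_rfl (hs _)
    have e1 : ∀ n, m y₁ + n * s y₁ - m y₁ = 0 + n * s y₁ := fun n => by ring
    have e2 : ∀ n, m y₂ + n * s y₂ - m y₁ = (m y₂ - m y₁) + n * s y₂ := fun n => by ring
    simp only [henv, e1, e2] at hopt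
    rcases h12.eq_or_lt with heq | hlt
    · have h2 := hline (m y₂ - m y₁) (s y₂) (by linarith) (hs _)
      refine hnonpos ?_
      filter_upwards [hmax] with b hb
      have h3 := hψ (s (sel b))
      have h4 := hs (sel b)
      rcases hcases (sel b) with h | h <;> rw [h] at h3 h4 ⊢
      · linarith
      · have h5 := hb y₁
        rw [h, heq] at h5
        linarith
    · set d := s y₂ - s y₁ with hd
      have hd0 : 0 < d := sub_pos.2 hlt
      have hd1 : d ≤ 1 := by linarith [hs1 y₂, hs y₁]
      -- The two lines cross at b = α. The riskier point y₂ is selected exactly beyond α, which has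
      -- probability p = e^{-α²/2}, so the gap takes only the two values a₀ and a₁.
      set α := (m y₁ - m y₂) / d with hα
      have hα0 : 0 < α := div_pos (sub_pos.2 hm) hd0
      have hdα : d * α = m y₁ - m y₂ := by rw [hα]; field_simp
      set p := rexp (-α ^ 2 / 2) with hp
      have hp0 : 0 < p := exp_pos _
      have hp1 : p < 1 := by rw [hp, exp_lt_one_iff]; have := pow_pos hα0 2; linarith
      have hg : ∫ n, max (n - α) 0 ∂gaussianReal 0 1 ≤ 0.4 * p / (1 + α ^ 2) := by
        refine (integral_max_sub_le hα0.le).trans ?_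
        rw [mul_div_assoc]
        gcongr
      have h2 : ∫ n, max (m y₂ - m y₁ + n * s y₂) 0 ∂gaussianReal 0 1 ≤
          0.4 * s y₁ + d * (0.4 * p / (1 + α ^ 2)) := by
        have h3 : ∫ n, max (m y₂ - m y₁ + n * s y₂) 0 ∂gaussianReal 0 1 ≤
            ∫ n, (s y₁ * max n 0 + d * max (n - α) 0) ∂gaussianReal 0 1 := by
          refine integral_mono (integrable_max_line_sub _ _)
            ((hpos.const_mul _).add ((integrable_max_sub α).const_mul _)) fun n => max_le ?_ ?_
          · have i1 := mul_le_mul_of_nonneg_left (le_max_left n 0) (hs y₁)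
            have i2 := mul_le_mul_of_nonneg_left (le_max_left (n - α) 0) hd0.le
            have i3 : d * (n - α) = n * s y₂ - n * s y₁ - (m y₁ - m y₂) := by
              rw [mul_sub, hdα, hd]; ring
            linarith
          · exact add_nonneg (mul_nonneg (hs _) (le_max_right _ _))
              (mul_nonneg hd0.le (le_max_right _ _))
        rw [integral_add (hpos.const_mul _) ((integrable_max_sub α).const_mul _),
          integral_const_mul, integral_const_mul] at h3
        have i1 := mul_le_mul_of_nonneg_left (integral_max_le.trans hk) (hs y₁)
        have i2 := mul_le_mul_of_nonneg_left hg hd0.le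
        linarith
      set A := optBound m s 0 - m y₁ with hAdef
      have hA : A ≤ 0.8 * s y₁ + d * (0.4 * p / (1 + α ^ 2)) := by rw [hAdef, hopt]; linarith
      have hmean := two_arm_mean_nonpos hα0 hp (hs y₁) hd0.le hC hA
      have hs2 : s y₁ + d = s y₂ := by rw [hd]; ring
      rw [hs2] at hmean
      have hq : 0.4 * p / (1 + α ^ 2) ≤ 0.4 * p :=
        div_le_self (by positivity) (by nlinarith [sq_nonneg α])
      have hdq : d * (0.4 * p / (1 + α ^ 2)) ≤ d * (0.4 * p) := by gcongr
      set a₀ := A - C * s y₁ ^ 2 - 1 / (4 * C) with ha0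
      set a₁ := A + d * α - C * s y₂ ^ 2 - 1 / (4 * C) with ha1
      have b0 : a₀ ≤ 0.4 * p := by
        have := hψ (s y₁)
        have := hs y₁
        have : d * (0.4 * p) ≤ 1 * (0.4 * p) := by gcongr
        linarith
      -- From A ≤ 0.8 s₁ + 0.4 d and C t² + 1/(4C) ≥ t at t = s₁ + d one gets a₁ ≤ d(α - 0.6), and d
      -- ≤ 1.
      have b1 : a₁ ≤ 0 ∨ a₁ ≤ α - 0.6 := by
        have := hψ (s y₂)
        have := hs y₁
        have h4 : d * (0.4 * p) ≤ d * (0.4 * 1) := by gcongr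
        have h3 : a₁ ≤ d * (α - 0.6) := by rw [mul_sub]; linarith
        rcases le_total α 0.6 with h | h
        · exact .inl (h3.trans (mul_nonpos_of_nonneg_of_nonpos hd0.le (by linarith)))
        · exact .inr (h3.trans (mul_le_of_le_one_left (by linarith) hd1))
      have hmgf := two_point_mgf_le hα0 hp b0 b1 hmean hl
      refine le_trans (lintegral_mono_ae ?_)
        ((lintegral_two_values_rayleigh hα0 (exp_pos (l * a₀)).le (exp_pos (l * a₁)).le).le.trans
          (ENNReal.ofReal_le_ofReal hmgf))
      have hneα : ∀ᵐ b ∂rayleigh 0, b ≠ α :=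
        (rayleigh_absolutelyContinuous 0).ae_le (Measure.ae_ne volume α)
      filter_upwards [hmax, hneα] with b hb hbα
      refine ENNReal.ofReal_le_ofReal ?_
      have key : d * (b - α) = b * s y₂ - b * s y₁ - (m y₁ - m y₂) := by
        rw [mul_sub, hdα, hd]; ring
      rcases lt_or_gt_of_ne hbα with h | h
      · rw [if_neg (not_lt.2 h.le)]
        have hsel : sel b = y₁ := by
          refine (hcases _).resolve_right fun h' => ?_
          have := hb y₁
          rw [h'] at this
          have := mul_neg_of_pos_of_neg hd0 (sub_neg.2 h)
          linarith
        rw [hsel]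
      · rw [if_pos h]
        have hsel : sel b = y₂ := by
          refine (hcases _).resolve_left fun h' => ?_
          have := hb y₂
          rw [h'] at this
          have := mul_pos hd0 (sub_pos.2 h)
          linarith
        rw [hsel, ha1, hAdef, hdα]
        exact le_of_eq (by ring_nf)

/-- The exponential moments of the one-step regret under the randomized selection rule. -/
lemma lintegral_exp_optBound_le (hcard : 2 ≤ Fintype.card X)
    (hs : ∀ y, 0 ≤ s y) (hs1 : ∀ y, s y ≤ 1) {sel : ℝ → X} (hsel : Measurable[_, ⊤] sel)
    (hmax : ∀ᵐ b ∂shiftedExp (shift (Fintype.card X)) (1 / 2),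
      ∀ z, m z + √b * s z ≤ m (sel b) + √b * s (sel b))
    {C l : ℝ} (hC : 0 < C) (hl : 0 ≤ l) :
    ∫⁻ b, ENNReal.ofReal (rexp (l * (optBound m s √(shift (Fintype.card X)) - m (sel b) -
      C * s (sel b) ^ 2 - (shift (Fintype.card X) + 1) / (4 * C))))
        ∂shiftedExp (shift (Fintype.card X)) (1 / 2) ≤ ENNReal.ofReal (rexp (9 * l ^ 2)) := by
  have hN : (2 : ℝ) ≤ Fintype.card X := by exact_mod_cast hcard
  have hS0 : 0 ≤ shift (Fintype.card X) :=
    mul_nonneg two_pos.le (Real.log_nonneg (by linarith))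
  set x := √(shift (Fintype.card X)) with hx
  have hx0 : 0 ≤ x := Real.sqrt_nonneg _
  have hxS : shift (Fintype.card X) = x ^ 2 := (Real.sq_sqrt hS0).symm
  have hm2 : Measurable fun b => s (sel b) := (measurable_from_top (f := s)).comp hsel
  have hF : Measurable fun b => ENNReal.ofReal (rexp (l * (optBound m s x - m (sel b) -
      C * s (sel b) ^ 2 - (x ^ 2 + 1) / (4 * C)))) :=
    (measurable_from_top (f := fun y => ENNReal.ofReal (rexp (l * (optBound m s x - m y -
      C * s y ^ 2 - (x ^ 2 + 1) / (4 * C)))))).comp hsel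
  rw [hxS, shiftedExp_eq_map_rayleigh hx0] at hmax ⊢
  rw [lintegral_map hF (by fun_prop)]
  have hmax' : ∀ᵐ b ∂rayleigh x, ∀ z, m z + b * s z ≤ m (sel (b ^ 2)) + b * s (sel (b ^ 2)) := by
    filter_upwards [ae_rayleigh_lt x, ae_of_ae_map (by fun_prop) hmax] with b hb hbm z
    have := hbm z
    rwa [Real.sqrt_sq (hx0.trans hb.le)] at this
  rcases hcard.eq_or_lt with h | h
  · have hx00 : x = 0 := by rw [hx, ← h, shift]; norm_num
    rw [hx00] at hmax' ⊢
    have := lintegral_exp_optBound_le_of_two h.symm hs hs1 (sel := fun b => sel (b ^ 2)) hmax' hC hl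
    simpa using this
  · have hN3 : (3 : ℝ) ≤ Fintype.card X := by exact_mod_cast h
    have hexp : (Fintype.card X : ℝ) = 2 * rexp (x ^ 2 / 2) := by
      rw [← hxS, shift, mul_div_cancel_left₀ _ (two_ne_zero), Real.exp_log (by linarith)]
      ring
    -- Three points give x ≥ √(2 log(3/2)) ≈ 0.9005, which is why the Mills ratio estimates start at
    -- 0.9.
    have hx9 : 0.9 ≤ x := by
      by_contra! hlt
      have h1 : x ^ 2 / 2 < 0.405 := by nlinarith
      have h2 : rexp (x ^ 2 / 2) < 1.5 := by
        have h3 : rexp (x ^ 2 / 2) < rexp 0.405 := exp_lt_exp.2 h1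
        have h4 : rexp 0.405 ≤ 1.5 := by
          have := Real.exp_bound' (x := 0.405) (by norm_num) (by norm_num) (n := 5) (by norm_num)
          refine this.trans ?_
          simp only [Finset.sum_range_succ, Finset.sum_range_zero, Nat.factorial]
          norm_num
        linarith
      linarith
    exact lintegral_exp_optBound_le_of_large hx9 hexp hs hs1 (sel := fun b => sel (b ^ 2))
      (hm2.comp (measurable_id.pow_const 2)) hmax' hC hl

end TwoArms

/-! ### The information gain of a fixed design -/

section PiGaussian

variable {ι : Type*} [Fintype ι] {v : ι → ℝ≥0}

/-- The density of independent centred Gaussian variables with variances `v`. -/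
noncomputable def piGaussianPDF (v : ι → ℝ≥0) (y : ι → ℝ) : ℝ := ∏ i, gaussianPDFReal 0 (v i) (y i)

lemma measurable_piGaussianPDF (v : ι → ℝ≥0) : Measurable (piGaussianPDF v) := by
  have := fun i => measurable_gaussianPDFReal 0 (v i)
  unfold piGaussianPDF; fun_prop

lemma piGaussianPDF_pos (hv : ∀ i, v i ≠ 0) (y : ι → ℝ) : 0 < piGaussianPDF v y :=
  Finset.prod_pos fun i _ => gaussianPDFReal_pos 0 (v i) (y i) (hv i)

lemma log_piGaussianPDF (hv : ∀ i, v i ≠ 0) (y : ι → ℝ) :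
    log (piGaussianPDF v y) = ∑ i, (-(log (2 * π * v i)) / 2 - y i ^ 2 / (2 * v i)) := by
  rw [piGaussianPDF, Real.log_prod fun i _ => (gaussianPDFReal_pos 0 (v i) (y i) (hv i)).ne']
  refine Finset.sum_congr rfl fun i _ => ?_
  have hv' : (0 : ℝ) < v i := by have := pos_iff_ne_zero.2 (hv i); exact_mod_cast this
  rw [gaussianPDFReal, Real.log_mul (by positivity) (exp_pos _).ne', Real.log_exp, Real.log_inv,
    Real.log_sqrt (by positivity)]
  ring

lemma pi_gaussianReal (hv : ∀ i, v i ≠ 0) :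
    Measure.pi (fun i => gaussianReal 0 (v i)) =
      volume.withDensity fun y => ENNReal.ofReal (piGaussianPDF v y) := by
  refine Measure.pi_eq fun s hs => ?_
  have hi : ∀ i, Integrable (gaussianPDFReal 0 (v i)) (volume.restrict (s i)) := fun i =>
    (integrable_gaussianPDFReal 0 (v i)).integrableOn
  have hpi : Integrable (piGaussianPDF v) (Measure.pi fun i => volume.restrict (s i)) :=
    Integrable.fintype_prod hi
  rw [withDensity_apply _ (MeasurableSet.univ_pi hs), volume_pi, Measure.restrict_pi_pi,
    ← ofReal_integral_eq_lintegral_ofReal hpi (.of_forall fun y => (piGaussianPDF_pos hv y).le)]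
  unfold piGaussianPDF
  rw [integral_fintype_prod_eq_prod (𝕜 := ℝ) fun i => gaussianPDFReal 0 (v i),
    ENNReal.ofReal_prod_of_nonneg]
  · refine Finset.prod_congr rfl fun i _ => ?_
    rw [gaussianReal_apply_eq_integral _ (hv i)]
  · exact fun i _ => integral_nonneg fun y => gaussianPDFReal_nonneg 0 (v i) y

end PiGaussian

/-! ### Innovations as a volume-preserving change of variables -/

section Innovation

variable {X : Type*} {k : X → X → ℝ} {σ : ℝ} {a : ℕ → X} {T : ℕ}

/-- The matrix that maps the observations to the innovations, that is, to the differences between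
the observations and their predictions from the previous ones. -/
noncomputable def innovMatrix (k : X → X → ℝ) (σ : ℝ) (a : ℕ → X) (T : ℕ) :
    Matrix (Fin T) (Fin T) ℝ :=
  1 - Matrix.of fun (t i : Fin T) => if h : i < t then
    postWeight k σ (fun j : Fin t => a j) (a t) ⟨i, h⟩ else 0

lemma innovMatrix_mulVec (y : Fin T → ℝ) (t : Fin T) :
    (innovMatrix k σ a T *ᵥ y) t = y t -
      postMean k σ (fun j : Fin t => a j) (fun j => y ⟨j, j.2.trans t.2⟩) (a t) := by
  rw [innovMatrix, sub_mulVec, one_mulVec, Pi.sub_apply, postMean_eq_sum, mulVec, dotProduct]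
  congr 1
  symm
  refine Fintype.sum_of_injective (fun j : Fin t => (⟨j, j.2.trans t.2⟩ : Fin T)) ?_ _ _ ?_ ?_
  · intro i j h
    simpa [Fin.ext_iff] using h
  · intro i hi
    have : ¬ i < t := fun h => hi ⟨⟨i, h⟩, rfl⟩
    simp [this]
  · intro j
    have : (⟨j, j.2.trans t.2⟩ : Fin T) < t := j.2
    simp [this]

/-- A prediction involves only earlier observations, so the matrix is lower triangular with unit
diagonal and the change of variables has no Jacobian factor. -/
lemma det_innovMatrix : (innovMatrix k σ a T).det = 1 := by
  rw [Matrix.det_of_isLowerTriangular]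
  · simp [innovMatrix]
  · intro i j h
    have h' : i < j := by simpa using h
    simp [innovMatrix, h'.not_gt, h'.ne]

lemma measurePreserving_innovMatrix :
    MeasurePreserving (innovMatrix k σ a T *ᵥ ·) volume volume := by
  have h := Real.map_matrix_volume_pi_eq_smul_volume_pi (M := innovMatrix k σ a T)
    (by rw [det_innovMatrix]; exact one_ne_zero)
  rw [det_innovMatrix] at h
  simp only [inv_one, abs_one, ENNReal.ofReal_one, one_smul] at h
  exact ⟨by fun_prop, h⟩

lemma measurableEmbedding_innovMatrix : MeasurableEmbedding (innovMatrix k σ a T *ᵥ ·) := by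
  have hdet : IsUnit (innovMatrix k σ a T).det := by rw [det_innovMatrix]; exact isUnit_one
  refine MeasurableEmbedding.of_measurable_inverse (g := ((innovMatrix k σ a T)⁻¹ *ᵥ ·))
    (by fun_prop)
    ?_ (by fun_prop) fun y => ?_
  · have : range (innovMatrix k σ a T *ᵥ ·) = univ := by
      refine eq_univ_of_forall fun y => ⟨(innovMatrix k σ a T)⁻¹ *ᵥ y, ?_⟩
      simp [mulVec_mulVec, mul_nonsing_inv _ hdet]
    rw [this]; exact .univ
  · simp [mulVec_mulVec, nonsing_inv_mul _ hdet]

lemma innovMatrix_mulVec_fixedObs {Ω : Type*} {f : X → Ω → ℝ} {ε : ℕ → Ω → ℝ}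
    (a : ℕ → X) (T : ℕ) (ω : Ω) (t : Fin T) :
    (innovMatrix k σ a T *ᵥ fixedObs f ε (fun i : Fin T => a i) ω) t =
      postError k σ f ε (fun j : Fin t => a j) (a t) ω + ε t ω := by
  rw [innovMatrix_mulVec, postError]
  change f (a t) ω + ε t ω - postMean k σ _ (fixedObs f ε (fun j : Fin t => a j) ω) _ = _
  ring

end Innovation

/-! ### Independence of the innovations -/

namespace IsGPModel

variable {X Ω : Type*} {k : X → X → ℝ} {σ : ℝ} [MeasurableSpace Ω] {P : Measure Ω}
  [IsProbabilityMeasure P] {f : X → Ω → ℝ} {ε : ℕ → Ω → ℝ} (hm : IsGPModel P k σ f ε)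
include hm

lemma cov_fixedObs_noise {n : ℕ} (q : Fin n → X) (i : Fin n) {t : ℕ} (ht : n ≤ t) :
    cov[fun ω => fixedObs f ε q ω i, ε t; P] = 0 := by
  have h1 : cov[fun ω => fixedObs f ε q ω i, ε t; P] = _ :=
    covariance_add_left (hm.memLp_f (q i)) (hm.memLp_noise (i : ℕ)) (hm.memLp_noise t)
  rw [h1, hm.cov_f_noise, hm.cov_noise, if_neg (i.2.trans_le ht).ne, add_zero]

lemma cov_postError_noise {n : ℕ} (q : Fin n → X) (z : X) {t : ℕ} (ht : n ≤ t) :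
    cov[postError k σ f ε q z, ε t; P] = 0 := by
  rw [hm.cov_postError_left q z (hm.memLp_noise t), hm.cov_f_noise, Finset.sum_eq_zero, sub_zero]
  intro i _
  rw [hm.cov_fixedObs_noise q i ht, mul_zero]

lemma memLp_innovation (a : ℕ → X) (t : ℕ) :
    MemLp (fun ω => postError k σ f ε (fun j : Fin t => a j) (a t) ω + ε t ω) 2 P :=
  (hm.memLp_postError _ _).add (hm.memLp_noise t)

lemma variance_innovation [Fintype X] (hk : (Matrix.of k).PosSemidef) (hσ : 0 < σ) (a : ℕ → X)
    (t : ℕ) : Var[fun ω => postError k σ f ε (fun j : Fin t => a j) (a t) ω + ε t ω; P] =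
      postVar k σ (fun j : Fin t => a j) (a t) + σ ^ 2 := by
  have h : Var[fun ω => postError k σ f ε (fun j : Fin t => a j) (a t) ω + ε t ω; P] = _ :=
    variance_add (hm.memLp_postError (fun j : Fin t => a j) (a t)) (hm.memLp_noise t)
  rw [h, hm.variance_postError hk hσ, hm.cov_postError_noise _ _ le_rfl,
    ← covariance_self (hm.measurable_noise t).aemeasurable, hm.cov_noise, if_pos rfl]
  ring

/-- The later innovation is uncorrelated with every earlier observation, and the earlier innovation
is a linear combination of such observations. -/
lemma cov_innovation_of_lt [Fintype X] (hk : (Matrix.of k).PosSemidef) (hσ : 0 < σ) (a : ℕ → X)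
    {s t : ℕ} (hst : s < t) :
    cov[fun ω => postError k σ f ε (fun j : Fin s => a j) (a s) ω + ε s ω,
      fun ω => postError k σ f ε (fun j : Fin t => a j) (a t) ω + ε t ω; P] = 0 := by
  have hY := hm.memLp_innovation a t
  have hobs : ∀ j, j < t → cov[fun ω => f (a j) ω + ε j ω,
      fun ω => postError k σ f ε (fun j : Fin t => a j) (a t) ω + ε t ω; P] = 0 := fun j hj => by
    have h1 : cov[fun ω => fixedObs f ε (fun j : Fin t => a j) ω ⟨j, hj⟩,
        fun ω => postError k σ f ε (fun j : Fin t => a j) (a t) ω + ε t ω; P] = _ :=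
      covariance_add_right (hm.memLp_fixedObs (fun j : Fin t => a j) ⟨j, hj⟩)
        (hm.memLp_postError (fun j : Fin t => a j) (a t)) (hm.memLp_noise t)
    rw [covariance_comm _ (postError k σ f ε (fun j : Fin t => a j) (a t)),
      hm.cov_postError_fixedObs hk hσ, hm.cov_fixedObs_noise _ _ le_rfl, add_zero] at h1
    exact h1
  have h2 : cov[fun ω => postError k σ f ε (fun j : Fin s => a j) (a s) ω + ε s ω,
      fun ω => postError k σ f ε (fun j : Fin t => a j) (a t) ω + ε t ω; P] = _ :=
    covariance_add_left (hm.memLp_postError (fun j : Fin s => a j) (a s)) (hm.memLp_noise s) hY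
  have h3 : cov[fun ω => f (a s) ω + ε s ω,
      fun ω => postError k σ f ε (fun j : Fin t => a j) (a t) ω + ε t ω; P] = _ :=
    covariance_add_left (hm.memLp_f (a s)) (hm.memLp_noise s) hY
  rw [hobs s hst] at h3
  rw [h2, hm.cov_postError_left _ _ hY, Finset.sum_eq_zero, sub_zero, ← h3]
  intro i _
  have : cov[fun ω => fixedObs f ε (fun j : Fin s => a j) ω i,
    fun ω => postError k σ f ε (fun j : Fin t => a j) (a t) ω + ε t ω; P] = 0 :=
    hobs i (i.2.trans hst)
  rw [this, mul_zero]

lemma cov_innovation [Fintype X] (hk : (Matrix.of k).PosSemidef) (hσ : 0 < σ) (a : ℕ → X)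
    {s t : ℕ} (hst : s ≠ t) :
    cov[fun ω => postError k σ f ε (fun j : Fin s => a j) (a s) ω + ε s ω,
      fun ω => postError k σ f ε (fun j : Fin t => a j) (a t) ω + ε t ω; P] = 0 := by
  rcases hst.lt_or_gt with h | h
  · exact hm.cov_innovation_of_lt hk hσ a h
  · rw [covariance_comm]; exact hm.cov_innovation_of_lt hk hσ a h

/-- The innovations are independent. -/
lemma map_innovation [Fintype X] (hk : (Matrix.of k).PosSemidef) (hσ : 0 < σ) (a : ℕ → X)
    (T : ℕ) :
    P.map (fun ω => innovMatrix k σ a T *ᵥ fixedObs f ε (fun i : Fin T => a i) ω) =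
      Measure.pi fun t : Fin T =>
        gaussianReal 0 (postVar k σ (fun j : Fin t => a j) (a t) + σ ^ 2).toNNReal := by
  let L : ((X → ℝ) × (Fin T → ℝ)) →ₗ[ℝ] (Fin T → ℝ) :=
    (innovMatrix k σ a T).mulVecLin ∘ₗ
      (LinearMap.funLeft ℝ ℝ (fun i : Fin T => a i) ∘ₗ LinearMap.fst ℝ (X → ℝ) (Fin T → ℝ) +
        LinearMap.snd ℝ (X → ℝ) (Fin T → ℝ))
  have hG : HasGaussianLaw
      (fun ω => innovMatrix k σ a T *ᵥ fixedObs f ε (fun i : Fin T => a i) ω) P :=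
    hm.hasGaussianLaw_linear T L
  have heq : (fun ω => innovMatrix k σ a T *ᵥ fixedObs f ε (fun i : Fin T => a i) ω) =
      fun ω (t : Fin T) => postError k σ f ε (fun j : Fin t => a j) (a t) ω + ε t ω := by
    funext ω t; exact innovMatrix_mulVec_fixedObs a T ω t
  rw [heq] at hG ⊢
  have hind := hG.iIndepFun_of_covariance_eq_zero
    (X := fun (t : Fin T) ω => postError k σ f ε (fun j : Fin t => a j) (a t) ω + ε t ω)
    fun i j hij => hm.cov_innovation hk hσ a (Fin.val_injective.ne hij)
  have hmeas : ∀ t : Fin T, Measurable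
      fun ω => postError k σ f ε (fun j : Fin t => a j) (a t) ω + ε t ω := fun t =>
    (hm.measurable_postError _ _).add (hm.measurable_noise _)
  rw [(iIndepFun_iff_map_fun_eq_pi_map fun t => (hmeas t).aemeasurable).1 hind]
  congr 1 with t
  have h1 : HasGaussianLaw
      (fun ω => postError k σ f ε (fun j : Fin t => a j) (a t) ω + ε t ω) P := hG.eval t
  have h2 : ∫ ω, (postError k σ f ε (fun j : Fin t => a j) (a t) ω + ε t ω) ∂P = 0 := by
    rw [integral_add ((hm.memLp_postError _ _).integrable (by norm_num))
      ((hm.memLp_noise _).integrable (by norm_num)), hm.integral_postError, hm.integral_noise,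
      add_zero]
  rw [h1.map_eq_gaussianReal, h2, hm.variance_innovation hk hσ]

end IsGPModel

open InformationTheory

/-! ### Divergence from densities -/

section KullbackLeibler

/-- The Kullback-Leibler divergence of two measures with positive densities. -/
lemma klDiv_withDensity {A : Type*} [MeasurableSpace A] {l μ ν : Measure A}
    [IsProbabilityMeasure μ] [IsProbabilityMeasure ν] {g h : A → ℝ} (hg : Measurable g)
    (hh : Measurable h) (hg0 : ∀ y, 0 < g y) (hh0 : ∀ y, 0 < h y)
    (hμ : μ = l.withDensity fun y => ENNReal.ofReal (g y))
    (hν : ν = l.withDensity fun y => ENNReal.ofReal (h y))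
    (hi : Integrable (fun y => log (g y) - log (h y)) μ) :
    klDiv μ ν ≠ ∞ ∧ (klDiv μ ν).toReal = ∫ y, (log (g y) - log (h y)) ∂μ := by
  have hr : Measurable fun y => ENNReal.ofReal (g y / h y) := (hg.div hh).ennreal_ofReal
  have hμν : μ = ν.withDensity fun y => ENNReal.ofReal (g y / h y) := by
    rw [hν, ← withDensity_mul _ hh.ennreal_ofReal hr, hμ]
    congr 1 with y
    rw [Pi.mul_apply, ← ENNReal.ofReal_mul (hh0 y).le, mul_div_cancel₀ _ (hh0 y).ne']
  have hac : μ ≪ ν := by rw [hμν]; exact withDensity_absolutelyContinuous _ _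
  have hrn : μ.rnDeriv ν =ᵐ[μ] fun y => ENNReal.ofReal (g y / h y) := by
    have := Measure.rnDeriv_withDensity ν hr
    rw [← hμν] at this
    exact hac.ae_le this
  have hllr : llr μ ν =ᵐ[μ] fun y => log (g y) - log (h y) := by
    filter_upwards [hrn] with y hy
    rw [llr, hy, ENNReal.toReal_ofReal (div_pos (hg0 y) (hh0 y)).le,
      Real.log_div (hg0 y).ne' (hh0 y).ne']
  refine ⟨klDiv_ne_top hac (hi.congr hllr.symm), ?_⟩
  rw [toReal_klDiv_of_measure_eq hac (by simp), integral_congr_ae hllr]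

end KullbackLeibler

/-! ### Mutual information of a design and the sum of posterior variances -/

namespace IsGPModel

variable {X Ω : Type*} {k : X → X → ℝ} {σ : ℝ} [MeasurableSpace Ω] {P : Measure Ω}
  [IsProbabilityMeasure P] {f : X → Ω → ℝ} {ε : ℕ → Ω → ℝ} (hm : IsGPModel P k σ f ε)
include hm

/-- In innovation coordinates the law is a product of Gaussians; it is pulled back along the
volume-preserving embedding. -/
lemma map_fixedObs [Fintype X] (hk : (Matrix.of k).PosSemidef) (hσ : 0 < σ) (a : ℕ → X) (T : ℕ) :
    P.map (fixedObs f ε (fun i : Fin T => a i)) = volume.withDensity fun y => ENNReal.ofReal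
      (piGaussianPDF (fun t : Fin T => (postVar k σ (fun j : Fin t => a j) (a t) + σ ^ 2).toNNReal)
        (innovMatrix k σ a T *ᵥ y)) := by
  have hv : ∀ t : Fin T, (postVar k σ (fun j : Fin t => a j) (a t) + σ ^ 2).toNNReal ≠ 0 :=
    fun t => by
      have := hm.postVar_nonneg hk hσ (fun j : Fin t => a j) (a t)
      exact (Real.toNNReal_pos.2 (by positivity)).ne'
  have hΦ := measurableEmbedding_innovMatrix (k := k) (σ := σ) (a := a) (T := T)
  rw [← hΦ.comap_map (P.map _), ← hΦ.comap_map (volume.withDensity _)]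
  congr 1
  have h1 := hm.map_innovation hk hσ a T
  rw [pi_gaussianReal hv] at h1
  rw [Measure.map_map hΦ.measurable (hm.measurable_fixedObs _)]
  refine h1.trans ?_
  ext s hs
  rw [hΦ.map_apply, withDensity_apply _ hs, withDensity_apply _ (hΦ.measurable hs)]
  exact (measurePreserving_innovMatrix.setLIntegral_comp_preimage hs
    (measurable_piGaussianPDF _).ennreal_ofReal).symm

/-- Given the noise-free outputs, the observations are these plus independent noise. The law of the
noise-free outputs stays in the reference measure because it may be singular: the kernel is only
semidefinite and points may repeat. -/
lemma map_fixedObs_prod (hσ : 0 < σ) (a : ℕ → X) (T : ℕ) :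
    P.map (fun ω => (fixedObs f ε (fun i : Fin T => a i) ω, fun i : Fin T => f (a i) ω)) =
      ((volume : Measure (Fin T → ℝ)).prod (P.map fun ω (i : Fin T) => f (a i) ω)).withDensity
        fun p => ENNReal.ofReal (piGaussianPDF (fun _ => (σ ^ 2).toNNReal) (p.1 - p.2)) := by
  have hv : ∀ _ : Fin T, (σ ^ 2).toNNReal ≠ 0 := fun _ => (Real.toNNReal_pos.2 (by positivity)).ne'
  have hZ : Measurable fun ω (i : Fin T) => f (a i) ω :=
    measurable_pi_lambda _ fun i => hm.measurable_f _
  have hE : Measurable fun ω (i : Fin T) => ε i ω :=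
    measurable_pi_lambda _ fun i => hm.measurable_noise _
  have hind : IndepFun (fun ω (i : Fin T) => ε i ω) (fun ω (i : Fin T) => f (a i) ω) P :=
    (hm.indep_f_noise.comp (φ := fun (g : X → ℝ) (i : Fin T) => g (a i))
      (ψ := fun (e : ℕ → ℝ) (i : Fin T) => e i) (by fun_prop) (by fun_prop)).symm
  have hmapE : P.map (fun ω (i : Fin T) => ε i ω) = volume.withDensity fun y =>
      ENNReal.ofReal (piGaussianPDF (fun _ : Fin T => (σ ^ 2).toNNReal) y) := by
    have h : iIndepFun (fun i : Fin T => ε i) P :=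
      hm.iIndep_noise.precomp (g := fun i : Fin T => (i : ℕ)) Fin.val_injective
    rw [← pi_gaussianReal hv, (iIndepFun_iff_map_fun_eq_pi_map
      fun i => (hm.measurable_noise _).aemeasurable).1 h]
    congr 1 with i
    rw [(hm.law_noise i).map_eq]
  have hlaw := (indepFun_iff_map_prod_eq_prod_map_map hE.aemeasurable hZ.aemeasurable).1 hind
  have := Measure.isProbabilityMeasure_map (μ := P) hZ.aemeasurable
  have hD := (measurable_piGaussianPDF (fun _ : Fin T => (σ ^ 2).toNNReal)).ennreal_ofReal
  have hD1 : Measurable fun p : (Fin T → ℝ) × (Fin T → ℝ) =>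
      ENNReal.ofReal (piGaussianPDF (fun _ : Fin T => (σ ^ 2).toNNReal) p.1) :=
    hD.comp measurable_fst
  have hD2 : Measurable fun p : (Fin T → ℝ) × (Fin T → ℝ) =>
      ENNReal.ofReal (piGaussianPDF (fun _ : Fin T => (σ ^ 2).toNNReal) (p.1 - p.2)) :=
    hD.comp (measurable_fst.sub measurable_snd)
  refine Measure.ext_of_lintegral _ fun F hF => ?_
  have hadd : Measurable fun p : (Fin T → ℝ) × (Fin T → ℝ) => (p.1 + p.2, p.2) := by fun_prop
  have hcomp : P.map (fun ω => (fixedObs f ε (fun i : Fin T => a i) ω, fun i : Fin T => f (a i) ω)) =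
      (P.map fun ω => (fun i : Fin T => ε i ω, fun i : Fin T => f (a i) ω)).map
        fun p => (p.1 + p.2, p.2) := by
    rw [Measure.map_map hadd (hE.prodMk hZ)]
    congr 1
    funext ω
    simp only [Function.comp_apply, Prod.mk.injEq, and_true]
    funext i
    simp [fixedObs, add_comm]
  rw [hcomp, hlaw, lintegral_map hF hadd, hmapE, lintegral_withDensity_eq_lintegral_mul _
    hD2 hF, prod_withDensity_left hD]
  change ∫⁻ p, (F ∘ fun p : (Fin T → ℝ) × (Fin T → ℝ) => (p.1 + p.2, p.2)) p ∂_ = _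
  rw [lintegral_withDensity_eq_lintegral_mul _ hD1 (hF.comp hadd),
    lintegral_prod_symm' _ (hD1.mul (hF.comp hadd)), lintegral_prod_symm' _ (hD2.mul hF)]
  refine lintegral_congr fun z => ?_
  refine Eq.trans (lintegral_congr fun y => ?_) (lintegral_add_right_eq_self (fun y => ENNReal.ofReal
    (piGaussianPDF (fun _ : Fin T => (σ ^ 2).toNNReal) (y - z)) * F (y, z)) z)
  simp

/-- In the log-density ratio the quadratic terms in noise and innovation both have mean ½ per step
and cancel. The logarithms of the variance ratios remain. -/
lemma klDiv_fixedObs [Fintype X] (hk : (Matrix.of k).PosSemidef) (hσ : 0 < σ) (a : ℕ → X)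
    (T : ℕ) :
    mutualInfo P (fixedObs f ε (fun i : Fin T => a i)) (fun ω (i : Fin T) => f (a i) ω) ≠ ∞ ∧
    (mutualInfo P (fixedObs f ε (fun i : Fin T => a i)) (fun ω (i : Fin T) => f (a i) ω)).toReal =
      ∑ t ∈ Finset.range T, log (1 + postVar k σ (fun j : Fin t => a j) (a t) / σ ^ 2) / 2 := by
  set V : Fin T → ℝ := fun t => postVar k σ (fun j : Fin t => a j) (a t) + σ ^ 2 with hV
  have hpv : ∀ t : Fin T, 0 ≤ postVar k σ (fun j : Fin t => a j) (a t) := fun t =>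
    hm.postVar_nonneg hk hσ (fun j : Fin t => a j) (a t)
  have hσ2 : 0 < σ ^ 2 := by positivity
  have hV0 : ∀ t, 0 < V t := fun t => add_pos_of_nonneg_of_pos (hpv t) hσ2
  have hv : ∀ t : Fin T, (V t).toNNReal ≠ 0 := fun t => (Real.toNNReal_pos.2 (hV0 t)).ne'
  have hw : ∀ _ : Fin T, (σ ^ 2).toNNReal ≠ 0 := fun _ => (Real.toNNReal_pos.2 hσ2).ne'
  have hY := hm.measurable_fixedObs (fun i : Fin T => a i)
  have hZ : Measurable fun ω (i : Fin T) => f (a i) ω :=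
    measurable_pi_lambda _ fun i => hm.measurable_f _
  have hYZ := hY.prodMk hZ
  have := Measure.isProbabilityMeasure_map (μ := P) hZ.aemeasurable
  have := Measure.isProbabilityMeasure_map (μ := P) hY.aemeasurable
  have := Measure.isProbabilityMeasure_map (μ := P) hYZ.aemeasurable
  have hg : Measurable fun p : (Fin T → ℝ) × (Fin T → ℝ) =>
      piGaussianPDF (fun _ : Fin T => (σ ^ 2).toNNReal) (p.1 - p.2) :=
    (measurable_piGaussianPDF _).comp (by fun_prop)
  have hh0 : Measurable fun y : Fin T → ℝ =>
      piGaussianPDF (fun t => (V t).toNNReal) (innovMatrix k σ a T *ᵥ y) :=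
    (measurable_piGaussianPDF _).comp (by fun_prop)
  have hh : Measurable fun p : (Fin T → ℝ) × (Fin T → ℝ) =>
      piGaussianPDF (fun t => (V t).toNNReal) (innovMatrix k σ a T *ᵥ p.1) :=
    hh0.comp measurable_fst
  have hgh : Measurable fun p : (Fin T → ℝ) × (Fin T → ℝ) =>
      log (piGaussianPDF (fun _ : Fin T => (σ ^ 2).toNNReal) (p.1 - p.2)) -
      log (piGaussianPDF (fun t => (V t).toNNReal) (innovMatrix k σ a T *ᵥ p.1)) :=
    hg.log.sub hh.log
  have hν := congrArg (fun m => m.prod (P.map fun ω (i : Fin T) => f (a i) ω))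
    (hm.map_fixedObs hk hσ a T)
  rw [prod_withDensity_left hh0.ennreal_ofReal] at hν
  have hlog : ∀ ω, log (piGaussianPDF (fun _ : Fin T => (σ ^ 2).toNNReal)
        (fixedObs f ε (fun i : Fin T => a i) ω - fun i : Fin T => f (a i) ω)) -
      log (piGaussianPDF (fun t => (V t).toNNReal)
        (innovMatrix k σ a T *ᵥ fixedObs f ε (fun i : Fin T => a i) ω)) =
      ∑ t : Fin T, ((log (2 * π * V t) - log (2 * π * σ ^ 2)) / 2 - ε t ω ^ 2 / (2 * σ ^ 2) +
        (postError k σ f ε (fun j : Fin t => a j) (a t) ω + ε t ω) ^ 2 / (2 * V t)) := fun ω => by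
    rw [log_piGaussianPDF hw, log_piGaussianPDF hv, ← Finset.sum_sub_distrib]
    refine Finset.sum_congr rfl fun t _ => ?_
    rw [innovMatrix_mulVec_fixedObs, Real.coe_toNNReal _ hσ2.le, Real.coe_toNNReal _ (hV0 t).le]
    simp only [Pi.sub_apply, fixedObs, add_sub_cancel_left]
    ring
  have i1 : ∀ t : Fin T, Integrable (fun ω => ε t ω ^ 2 / (2 * σ ^ 2)) P := fun t =>
    (hm.memLp_noise t).integrable_sq.div_const _
  have i2 : ∀ t : Fin T, Integrable (fun ω =>
      (postError k σ f ε (fun j : Fin t => a j) (a t) ω + ε t ω) ^ 2 / (2 * V t)) P := fun t =>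
    (hm.memLp_innovation a t).integrable_sq.div_const _
  have i3 : ∀ t : Fin T, Integrable (fun ω => (log (2 * π * V t) - log (2 * π * σ ^ 2)) / 2 -
      ε t ω ^ 2 / (2 * σ ^ 2)) P := fun t => (integrable_const _).sub (i1 t)
  have i4 : ∀ t : Fin T, Integrable (fun ω =>
      (log (2 * π * V t) - log (2 * π * σ ^ 2)) / 2 - ε t ω ^ 2 / (2 * σ ^ 2) +
        (postError k σ f ε (fun j : Fin t => a j) (a t) ω + ε t ω) ^ 2 / (2 * V t)) P :=
    fun t => (i3 t).add (i2 t)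
  have hsum := integrable_finsetSum Finset.univ fun t _ => i4 t
  have hi : Integrable (fun p : (Fin T → ℝ) × (Fin T → ℝ) =>
      log (piGaussianPDF (fun _ : Fin T => (σ ^ 2).toNNReal) (p.1 - p.2)) -
      log (piGaussianPDF (fun t => (V t).toNNReal) (innovMatrix k σ a T *ᵥ p.1)))
      (P.map fun ω => (fixedObs f ε (fun i : Fin T => a i) ω, fun i : Fin T => f (a i) ω)) := by
    rw [integrable_map_measure hgh.aestronglyMeasurable hYZ.aemeasurable]
    refine hsum.congr (.of_forall fun ω => ?_)
    simp only [Function.comp_apply, hlog]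
  obtain ⟨h1, h2⟩ := klDiv_withDensity hg hh (fun p => piGaussianPDF_pos hw _)
    (fun p => piGaussianPDF_pos hv _) (hm.map_fixedObs_prod hσ a T) hν hi
  refine ⟨h1, h2.trans ?_⟩
  rw [integral_map hYZ.aemeasurable hgh.aestronglyMeasurable]
  simp_rw [hlog]
  rw [integral_finsetSum _ fun t _ => i4 t, Finset.sum_range]
  refine Finset.sum_congr rfl fun t _ => ?_
  have j1 : ∫ ω, ε t ω ^ 2 ∂P = σ ^ 2 := by
    have := variance_of_integral_eq_zero (hm.measurable_noise t).aemeasurable (hm.integral_noise t)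
    rw [← this, ← covariance_self (hm.measurable_noise t).aemeasurable, hm.cov_noise, if_pos rfl]
  have j2 : ∫ ω, (postError k σ f ε (fun j : Fin t => a j) (a t) ω + ε t ω) ^ 2 ∂P = V t := by
    have h0 : ∫ ω, (postError k σ f ε (fun j : Fin t => a j) (a t) ω + ε t ω) ∂P = 0 := by
      rw [integral_add ((hm.memLp_postError _ _).integrable (by norm_num))
        ((hm.memLp_noise _).integrable (by norm_num)), hm.integral_postError, hm.integral_noise,
        add_zero]
    have := variance_of_integral_eq_zero (hm.memLp_innovation a t).aestronglyMeasurable.aemeasurable h0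
    rw [← this, hm.variance_innovation hk hσ]
  rw [integral_add (i3 t) (i2 t), integral_sub (integrable_const _) (i1 t), integral_div,
    integral_div, integral_div, j1, j2]
  have h3 : 1 + postVar k σ (fun j : Fin t => a j) (a t) / σ ^ 2 = V t / σ ^ 2 := by
    rw [hV]; field_simp; ring
  rw [h3, Real.log_div (hV0 t).ne' hσ2.ne', Real.log_mul (by positivity) (hV0 t).ne',
    Real.log_mul (by positivity) hσ2.ne']
  simp only [integral_const, probReal_univ, one_smul]
  have := (hV0 t).ne'
  field_simp
  ring

/-- The posterior variances along any design are controlled by the maximum information gain. -/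
lemma sum_postVar_le [Fintype X] (hk : (Matrix.of k).PosSemidef) (hk1 : ∀ z, k z z ≤ 1)
    (hσ : 0 < σ) (a : ℕ → X) (T : ℕ) :
    ∑ t ∈ Finset.range T, postVar k σ (fun j : Fin t => a j) (a t) ≤
      2 / log (1 + (σ ^ 2)⁻¹) * maxInfoGain P f ε T := by
  have hσ2 : 0 < σ ^ 2 := by positivity
  have hL : 0 < log (1 + (σ ^ 2)⁻¹) := Real.log_pos (by linarith [inv_pos.2 hσ2])
  have hle : (mutualInfo P (fixedObs f ε (fun i : Fin T => a i))
      (fun ω (i : Fin T) => f (a i) ω)).toReal ≤ maxInfoGain P f ε T := by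
    classical
    -- Finiteness matters: `toReal` sends ∞ to 0. The supremum is over finitely many designs, hence
    -- attained and finite.
    have hne : ∀ q : Fin T → X, mutualInfo P (fun ω (i : Fin T) => f (q i) ω + ε i ω)
        (fun ω (i : Fin T) => f (q i) ω) ≠ ∞ := fun q => by
      have : Nonempty X := ⟨a 0⟩
      have := (hm.klDiv_fixedObs hk hσ (fun i => if h : i < T then q ⟨i, h⟩ else a 0) T).1
      simp only [Fin.is_lt, dif_pos, Fin.eta] at this
      exact this
    refine ENNReal.toReal_mono ?_ (le_iSup (fun q : Fin T → X =>
      mutualInfo P (fun ω (i : Fin T) => f (q i) ω + ε i ω) (fun ω (i : Fin T) => f (q i) ω))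
      fun i => a i)
    obtain ⟨q, hq⟩ := (Set.finite_range fun q : Fin T → X => mutualInfo P
      (fun ω (i : Fin T) => f (q i) ω + ε i ω) fun ω (i : Fin T) => f (q i) ω).isCompact.sSup_mem
        ⟨_, fun i => a i, rfl⟩
    rw [← sSup_range, ← hq]
    exact hne q
  rw [(hm.klDiv_fixedObs hk hσ a T).2] at hle
  refine le_trans ?_ (mul_le_mul_of_nonneg_left hle (by positivity))
  rw [Finset.mul_sum]
  refine Finset.sum_le_sum fun t _ => ?_
  have h0 := hm.postVar_nonneg hk hσ (fun j : Fin t => a j) (a t)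
  have h1 := (postVar_le hk hσ (fun j : Fin t => a j) (a t)).trans (hk1 _)
  set v := postVar k σ (fun j : Fin t => a j) (a t)
  -- Concavity of log on the segment from 1 to 1 + σ⁻², at the weight v ≤ 1: v log(1 + σ⁻²) ≤ log(1
  -- + v/σ²).
  have hc := strictConcaveOn_log_Ioi.concaveOn.2 (mem_Ioi.2 (by positivity : (0 : ℝ) < 1 + (σ ^ 2)⁻¹))
    (mem_Ioi.2 one_pos) h0 (sub_nonneg.2 h1) (by ring)
  simp only [smul_eq_mul, mul_one, log_one, mul_zero, add_zero] at hc
  have he : v * (1 + (σ ^ 2)⁻¹) + (1 - v) = 1 + v / σ ^ 2 := by field_simp; ring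
  rw [he] at hc
  rw [div_mul_div_comm, le_div_iff₀ (by positivity)]
  linarith

end IsGPModel

/-! ### Auxiliary facts on independence, integrals and conditional expectations -/

section Auxiliary

variable {Ω A B C ι : Type*} [MeasurableSpace Ω] [MeasurableSpace A] [MeasurableSpace B]
  [MeasurableSpace C] {P : Measure Ω}

lemma indepFun_prodMk_of_indepFun [IsProbabilityMeasure P] {F : Ω → A} {G : Ω → B} {H : Ω → C}
    (hF : Measurable F) (hG : Measurable G) (hH : Measurable H) (hFG : IndepFun F G P)
    (h : IndepFun (fun ω => (F ω, G ω)) H P) : IndepFun F (fun ω => (G ω, H ω)) P := by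
  have := Measure.isProbabilityMeasure_map (μ := P) hF.aemeasurable
  have := Measure.isProbabilityMeasure_map (μ := P) hG.aemeasurable
  have := Measure.isProbabilityMeasure_map (μ := P) hH.aemeasurable
  have hGH : IndepFun G H P := h.comp (φ := Prod.snd) (ψ := id) measurable_snd measurable_id
  rw [indepFun_iff_map_prod_eq_prod_map_map hF.aemeasurable (hG.prodMk hH).aemeasurable,
    (indepFun_iff_map_prod_eq_prod_map_map hG.aemeasurable hH.aemeasurable).1 hGH,
    ← Measure.prodAssoc_prod,
    ← (indepFun_iff_map_prod_eq_prod_map_map hF.aemeasurable hG.aemeasurable).1 hFG,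
    ← (indepFun_iff_map_prod_eq_prod_map_map (hF.prodMk hG).aemeasurable hH.aemeasurable).1 h,
    Measure.map_map MeasurableEquiv.prodAssoc.measurable ((hF.prodMk hG).prodMk hH)]
  rfl

/-- By independence and Fubini, U can be frozen while the Gaussian error is integrated out; the
error is written as √v times a standard variable. -/
lemma setIntegral_max_add [IsProbabilityMeasure P] {U : Ω → B} {ξ : Ω → ℝ} (hU : Measurable U)
    (hξ : Measurable ξ) (hind : IndepFun ξ U P) {v : ℝ} (hv : 0 ≤ v)
    (hlaw : P.map ξ = gaussianReal 0 v.toNNReal) {φ : B → ℝ} (hφ : Measurable φ)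
    (hi : Integrable (fun ω => φ (U ω)) P) (hξi : Integrable ξ P) {S : Set B}
    (hS : MeasurableSet S) :
    ∫ ω in U ⁻¹' S, max (φ (U ω) + ξ ω) 0 ∂P =
      ∫ ω in U ⁻¹' S, ∫ n, max (φ (U ω) + n * √v) 0 ∂gaussianReal 0 1 ∂P := by
  have := Measure.isProbabilityMeasure_map (μ := P) hU.aemeasurable
  have hF : Measurable fun p : B × ℝ => max (φ p.1 + p.2) 0 := by fun_prop
  have hprod := (indepFun_iff_map_prod_eq_prod_map_map hU.aemeasurable hξ.aemeasurable).1 hind.symm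
  rw [hlaw] at hprod
  have hint : Integrable (fun p : B × ℝ => max (φ p.1 + p.2) 0)
      ((P.map U).prod (gaussianReal 0 v.toNNReal)) := by
    rw [← hprod, integrable_map_measure hF.aestronglyMeasurable (hU.prodMk hξ).aemeasurable]
    exact (hi.add hξi).pos_part
  have hgauss : gaussianReal 0 v.toNNReal = (gaussianReal 0 1).map fun n => n * √v := by
    rw [gaussianReal_map_mul_const, mul_zero]
    congr 1
    ext
    simp [Real.sq_sqrt hv, hv]
  have hG : Measurable fun u : B => ∫ n, max (φ u + n * √v) 0 ∂gaussianReal 0 1 :=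
    (StronglyMeasurable.integral_prod_right' (f := fun p : B × ℝ => max (φ p.1 + p.2 * √v) 0)
      (Measurable.stronglyMeasurable (by fun_prop))).measurable
  calc ∫ ω in U ⁻¹' S, max (φ (U ω) + ξ ω) 0 ∂P
      = ∫ p in S ×ˢ univ, max (φ p.1 + p.2) 0 ∂(P.map fun ω => (U ω, ξ ω)) := by
        rw [setIntegral_map (hS.prod .univ) hF.aestronglyMeasurable (hU.prodMk hξ).aemeasurable]
        congr 2
        ext; simp
    _ = ∫ u in S, ∫ n, max (φ u + n * √v) 0 ∂gaussianReal 0 1 ∂(P.map U) := by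
        rw [hprod, setIntegral_prod _ hint.integrableOn]
        congr 1 with u
        rw [setIntegral_univ, hgauss, integral_map (by fun_prop)
          (Measurable.aestronglyMeasurable (by fun_prop))]
    _ = _ := by
        rw [setIntegral_map hS hG.aestronglyMeasurable hU.aemeasurable]

lemma measurable_apply_query {Y : Type*} [Countable ι] {g : ι → Ω → Y} [MeasurableSpace Y]
    (hg : ∀ z, Measurable (g z)) {x : Ω → ι} (hx : Measurable[_, ⊤] x) :
    Measurable fun ω => g (x ω) ω := by
  let _ : MeasurableSpace ι := ⊤
  have h : Measurable fun p : ι × Ω => g p.1 p.2 := measurable_from_prod_countable_right hg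
  exact h.comp (hx.prodMk measurable_id)

variable [Finite ι]

lemma integrable_of_fibers (Q : Ω → ι) {g : Ω → ℝ} (h : ∀ q, IntegrableOn g (Q ⁻¹' {q}) P) :
    Integrable g P := by
  rw [← integrableOn_univ, ← Set.preimage_univ (f := Q), ← Set.iUnion_of_singleton ι,
    Set.preimage_iUnion]
  exact integrableOn_finite_iUnion.2 h

lemma setIntegral_le_of_fibers {Q : Ω → ι} (hQ : ∀ q, MeasurableSet (Q ⁻¹' {q})) {g h : Ω → ℝ}
    (hg : Integrable g P) (hh : Integrable h P) {S : Set Ω} (hS : MeasurableSet S)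
    (hle : ∀ q, ∫ ω in S ∩ Q ⁻¹' {q}, g ω ∂P ≤ ∫ ω in S ∩ Q ⁻¹' {q}, h ω ∂P) :
    ∫ ω in S, g ω ∂P ≤ ∫ ω in S, h ω ∂P := by
  have := Fintype.ofFinite ι
  have hU : S = ⋃ q, S ∩ Q ⁻¹' {q} := by ext ω; simp
  have hd : Pairwise (Function.onFun Disjoint fun q => S ∩ Q ⁻¹' {q}) := fun q q' hne =>
    Set.disjoint_left.2 fun ω h1 h2 => hne (h1.2.symm.trans h2.2)
  rw [hU, integral_iUnion_fintype (fun q => hS.inter (hQ q)) hd fun q => hg.integrableOn,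
    integral_iUnion_fintype (fun q => hS.inter (hQ q)) hd fun q => hh.integrableOn]
  exact Finset.sum_le_sum fun q _ => hle q

end Auxiliary

/-! ### Comparison and tail bounds for conditional expectations -/

section CondExp

variable {Ω : Type*} {m mΩ : MeasurableSpace Ω} {P : Measure Ω} [IsProbabilityMeasure P]

lemma condExp_le_condExp_of_setIntegral_le (hm : m ≤ mΩ) {g h : Ω → ℝ} (hg : Integrable g P)
    (hh : Integrable h P)
    (hle : ∀ S, MeasurableSet[m] S → ∫ ω in S, g ω ∂P ≤ ∫ ω in S, h ω ∂P) :
    P[g | m] ≤ᵐ[P] P[h | m] := by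
  refine ae_le_of_ae_le_trim (hm := hm) ?_
  refine ae_le_of_forall_setIntegral_le (integrable_condExp.trim hm stronglyMeasurable_condExp)
    (integrable_condExp.trim hm stronglyMeasurable_condExp) fun S hS _ => ?_
  rw [← setIntegral_trim hm stronglyMeasurable_condExp hS,
    ← setIntegral_trim hm stronglyMeasurable_condExp hS, setIntegral_condExp hm hg hS,
    setIntegral_condExp hm hh hS]
  exact hle S hS

/-- Chernoff's bound for a conditional expectation. -/
lemma measure_condExp_gt_le (hm : m ≤ mΩ) {Y : Ω → ℝ} (hY : Integrable Y P) {l K u : ℝ}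
    (hl : 0 ≤ l) (hK : ∫⁻ ω, ENNReal.ofReal (rexp (l * Y ω)) ∂P ≤ ENNReal.ofReal K) :
    P {ω | u < P[Y | m] ω} ≤ ENNReal.ofReal (K * rexp (-(l * u))) := by
  have hexp : Continuous fun y : ℝ => rexp (l * y) := by fun_prop
  have hi : Integrable ((fun y : ℝ => rexp (l * y)) ∘ Y) P := by
    refine ⟨hexp.comp_aestronglyMeasurable hY.1, ?_⟩
    refine (hasFiniteIntegral_iff_ofReal (.of_forall fun ω => (exp_pos _).le)).2 ?_
    exact hK.trans_lt ENNReal.ofReal_lt_top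
  have hconv : ConvexOn ℝ univ fun y : ℝ => rexp (l * y) :=
    convexOn_exp.comp_linearMap (LinearMap.mulLeft ℝ l)
  -- Conditional Jensen: the conditional expectation inherits the exponential moment bound of Y.
  have hJ := hconv.map_condExp_le hm (hexp.lowerSemicontinuous.lowerSemicontinuousOn _) (by simp)
    isClosed_univ hY hi
  have hmeas : Measurable fun ω => ENNReal.ofReal (rexp (l * P[Y | m] ω)) := by
    have : Measurable (P[Y | m]) := (stronglyMeasurable_condExp.mono hm).measurable
    fun_prop
  have h1 : ∫⁻ ω, ENNReal.ofReal (rexp (l * P[Y | m] ω)) ∂P ≤ ENNReal.ofReal K := by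
    calc ∫⁻ ω, ENNReal.ofReal (rexp (l * P[Y | m] ω)) ∂P
        ≤ ∫⁻ ω, ENNReal.ofReal (P[(fun y : ℝ => rexp (l * y)) ∘ Y | m] ω) ∂P :=
          lintegral_mono_ae (hJ.mono fun ω hω => ENNReal.ofReal_le_ofReal hω)
      _ = ENNReal.ofReal (∫ ω, P[(fun y : ℝ => rexp (l * y)) ∘ Y | m] ω ∂P) := by
          refine (ofReal_integral_eq_lintegral_ofReal integrable_condExp ?_).symm
          exact hJ.mono fun ω hω => (exp_pos _).le.trans hω
      _ = ∫⁻ ω, ENNReal.ofReal (rexp (l * Y ω)) ∂P := by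
          rw [integral_condExp hm]
          exact ofReal_integral_eq_lintegral_ofReal hi (.of_forall fun ω => (exp_pos _).le)
      _ ≤ _ := hK
  have h2 := (mul_meas_ge_le_lintegral hmeas (ENNReal.ofReal (rexp (l * u)))).trans h1
  have h3 : P {ω | u < P[Y | m] ω} ≤
      P {ω | ENNReal.ofReal (rexp (l * u)) ≤ ENNReal.ofReal (rexp (l * P[Y | m] ω))} :=
    measure_mono fun ω (hω : u < _) => ENNReal.ofReal_le_ofReal
      (exp_le_exp.2 (mul_le_mul_of_nonneg_left hω.le hl))
  calc P {ω | u < P[Y | m] ω}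
      = ENNReal.ofReal (rexp (-(l * u))) * (ENNReal.ofReal (rexp (l * u)) *
          P {ω | u < P[Y | m] ω}) := by
        rw [← mul_assoc, ← ENNReal.ofReal_mul (exp_pos _).le, ← exp_add, neg_add_cancel, exp_zero,
          ENNReal.ofReal_one, one_mul]
    _ ≤ ENNReal.ofReal (rexp (-(l * u))) * ENNReal.ofReal K := by
        gcongr
        exact (mul_le_mul_right h3 _).trans h2
    _ = _ := by rw [← ENNReal.ofReal_mul (exp_pos _).le, mul_comm]

end CondExp

/-! ### Measurability and integrability of `optBound` -/

section OptBound

variable {X A : Type*} [Fintype X] [MeasurableSpace A] {m s : A → X → ℝ} {x : ℝ}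

lemma measurable_env (hm : ∀ y, Measurable fun a => m a y) (hs : ∀ y, Measurable fun a => s a y) :
    Measurable fun a => env (m a) (s a) x :=
  Measurable.iSup fun y => (hm y).add ((hs y).const_mul x)

lemma measurable_optBound (hm : ∀ y, Measurable fun a => m a y)
    (hs : ∀ y, Measurable fun a => s a y) : Measurable fun a => optBound (m a) (s a) x := by
  have he := measurable_env (x := x) hm hs
  refine he.add (Finset.measurable_sum _ fun y _ => ?_)
  refine (StronglyMeasurable.integral_prod_right' (f := fun p : A × ℝ =>
    max (m p.1 y + p.2 * s p.1 y - env (m p.1) (s p.1) x) 0) ?_).measurable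
  refine Measurable.stronglyMeasurable ?_
  have h1 := (hm y).comp (measurable_fst : Measurable (Prod.fst : A × ℝ → A))
  have h2 := (hs y).comp (measurable_fst : Measurable (Prod.fst : A × ℝ → A))
  have h3 := he.comp (measurable_fst : Measurable (Prod.fst : A × ℝ → A))
  exact ((h1.add (measurable_snd.mul h2)).sub h3).max measurable_const

variable [Nonempty X]

lemma abs_env_le {m s : X → ℝ} (hs : ∀ y, 0 ≤ s y) (hs1 : ∀ y, s y ≤ 1) :
    |env m s x| ≤ ∑ y, |m y| + |x| := by
  have hb : ∀ y, |m y + x * s y| ≤ ∑ y, |m y| + |x| := fun y => by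
    refine (abs_add_le _ _).trans (add_le_add (Finset.single_le_sum (f := fun y => |m y|)
      (fun _ _ => abs_nonneg _) (Finset.mem_univ y)) ?_)
    rw [abs_mul, abs_of_nonneg (hs y)]
    exact mul_le_of_le_one_right (abs_nonneg _) (hs1 y)
  obtain ⟨y⟩ := ‹Nonempty X›
  rw [abs_le]
  exact ⟨((abs_le.1 (hb y)).1).trans (le_env m s x y), env_le fun z => (abs_le.1 (hb z)).2⟩

lemma abs_optBound_le {m s : X → ℝ} (hs : ∀ y, 0 ≤ s y) (hs1 : ∀ y, s y ≤ 1) :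
    |optBound m s x| ≤ (∑ y, |m y| + |x|) +
      ∑ y, (|m y| + (∑ y, |m y| + |x|) + ∫ n, |n| ∂gaussianReal 0 1) := by
  have he := abs_env_le (m := m) (x := x) hs hs1
  refine (abs_add_le _ _).trans (add_le_add he ((Finset.abs_sum_le_sum_abs _ _).trans
    (Finset.sum_le_sum fun y _ => ?_)))
  rw [abs_of_nonneg (integral_nonneg fun n => le_max_right _ _)]
  have h1 : ∫ n, max (m y + n * s y - env m s x) 0 ∂gaussianReal 0 1 ≤
      ∫ n, ((|m y| + (∑ y, |m y| + |x|)) + |n|) ∂gaussianReal 0 1 := by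
    refine integral_mono ?_ ((integrable_const _).add integrable_id_gaussianReal.abs) fun n => ?_
    · simpa [sub_add_eq_add_sub] using integrable_max_line_sub (m y - env m s x) (s y)
    · have h2 : n * s y ≤ |n| := by
        refine (le_abs_self _).trans ?_
        rw [abs_mul, abs_of_nonneg (hs y)]
        exact mul_le_of_le_one_right (abs_nonneg _) (hs1 y)
      refine max_le ?_ (add_nonneg (add_nonneg (abs_nonneg _) ((abs_nonneg _).trans he))
        (abs_nonneg _))
      have := le_abs_self (m y)
      have := neg_abs_le (env m s x)
      linarith
  refine h1.trans (le_of_eq ?_)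
  rw [integral_add (integrable_const _) integrable_id_gaussianReal.abs]
  simp

lemma integrable_optBound {P : Measure A} [IsFiniteMeasure P]
    (hm : ∀ y, Measurable fun a => m a y) (hs : ∀ y, Measurable fun a => s a y)
    (hs0 : ∀ a y, 0 ≤ s a y) (hs1 : ∀ a y, s a y ≤ 1)
    (hi : ∀ y, Integrable (fun a => m a y) P) :
    Integrable (fun a => optBound (m a) (s a) x) P := by
  have hS : Integrable (fun a => ∑ y, |m a y| + |x|) P :=
    (integrable_finsetSum _ fun y _ => (hi y).abs).add (integrable_const _)
  have hT : Integrable (fun a => ∑ y, (|m a y| + (∑ y, |m a y| + |x|) +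
      ∫ n, |n| ∂gaussianReal 0 1)) P :=
    integrable_finsetSum _ fun y _ => ((hi y).abs.add hS).add (integrable_const _)
  exact (hS.add hT).mono' (measurable_optBound hm hs).aestronglyMeasurable
    (.of_forall fun a => abs_optBound_le (hs0 a) (hs1 a))

end OptBound

/-! ### The data collected by the algorithm -/

namespace IsIRGPUCBRun

variable {X Ω : Type*} {k : X → X → ℝ} {σ s : ℝ} [mΩ : MeasurableSpace Ω]
  {P : Measure Ω} {f : X → Ω → ℝ} {ε ζ : ℕ → Ω → ℝ} {x : ℕ → Ω → X}

lemma paramSigma_le (hr : IsIRGPUCBRun P k σ s f ε ζ x) : paramSigma ζ ≤ mΩ :=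
  Measurable.comap_le (measurable_pi_lambda _ hr.measurable_param)

/-- The queries and observations of the first `t` steps. -/
def data (f : X → Ω → ℝ) (ε : ℕ → Ω → ℝ) (x : ℕ → Ω → X) (t : ℕ) (ω : Ω) :
    (Fin t → X) × (Fin t → ℝ) :=
  (fun i => x i ω, fun i => obs f ε x i ω)

/-- The observations for the fixed design `q` together with the confidence parameters. -/
def fixedData (f : X → Ω → ℝ) (ε ζ : ℕ → Ω → ℝ) (q : ℕ → X) (t : ℕ) (ω : Ω) :
    (Fin t → ℝ) × (ℕ → ℝ) :=
  (fixedObs f ε (fun i : Fin t => q i) ω, fun i => ζ i ω)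

lemma measurable_fixedData (hr : IsIRGPUCBRun P k σ s f ε ζ x) (hm : IsGPModel P k σ f ε)
    (q : ℕ → X) (t : ℕ) : Measurable (fixedData f ε ζ q t) :=
  (hm.measurable_fixedObs _).prodMk (measurable_pi_lambda _ hr.measurable_param)

/-- Whether the design `q` has been followed can be read off the observations for `q`. -/
lemma measurableSet_forall_query_eq (hr : IsIRGPUCBRun P k σ s f ε ζ x) (q : ℕ → X) {t n : ℕ}
    (htn : t ≤ n + 1) :
    MeasurableSet[MeasurableSpace.comap (fixedData f ε ζ q n) inferInstance]
      {ω | ∀ i < t, x i ω = q i} := by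
  -- The query of a step uses only earlier observations, so n observations decide n + 1 queries. On
  -- the event that the earlier queries follow q, these observations are those of the fixed design.
  induction t with
  | zero => simp
  | succ t ih =>
    obtain ⟨B, hB, hBeq⟩ := hr.query_measurable t (MeasurableSpace.measurableSet_top (s := {q t}))
    have hG : Measurable fun u : (Fin n → ℝ) × (ℕ → ℝ) =>
        ((fun i : Fin t => u.1 ⟨i, i.2.trans_le (by omega)⟩), fun i : Fin (t + 1) => u.2 i) := by
      fun_prop
    have hset : {ω | ∀ i < t + 1, x i ω = q i} = {ω | ∀ i < t, x i ω = q i} ∩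
        fixedData f ε ζ q n ⁻¹' ((fun u : (Fin n → ℝ) × (ℕ → ℝ) =>
          ((fun i : Fin t => u.1 ⟨i, i.2.trans_le (by omega)⟩),
            fun i : Fin (t + 1) => u.2 i)) ⁻¹' B) := by
      ext ω
      simp only [Nat.lt_succ_iff_lt_or_eq, or_imp, forall_and, forall_eq, mem_ofPred_eq, mem_inter_iff]
      refine and_congr_right fun h => ?_
      have h1 : x t ω = q t ↔ ω ∈ x t ⁻¹' {q t} := Iff.rfl
      rw [h1, ← hBeq]
      have h2 : (fun i : Fin t => obs f ε x i ω) =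
          fun i : Fin t => f (q i) ω + ε i ω := by
        funext i; rw [obs, h i i.2]
      simp only [mem_preimage, h2]
      rfl
    rw [hset]
    exact (ih (by omega)).inter ⟨_, hG hB, rfl⟩

variable [Fintype X]

/-- The queries depend measurably on the sample path, the noise and the confidence parameters. -/
lemma measurable_query_of (hr : IsIRGPUCBRun P k σ s f ε ζ x) : ∀ m : MeasurableSpace Ω,
    (∀ z, Measurable[m] (f z)) → (∀ t, Measurable[m] (ε t)) → ∀ t,
    (∀ i ≤ t, Measurable[m] (ζ i)) → Measurable[m, ⊤] (x t) := by
  have hq := hr.query_measurable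
  intro m hf hε t hζ
  induction t using Nat.strong_induction_on with
  | _ t ih =>
    refine (hq t).mono (Measurable.comap_le ?_) le_rfl
    refine Measurable.prodMk (measurable_pi_lambda _ fun i => ?_)
      (measurable_pi_lambda _ fun i => hζ i (Nat.lt_succ_iff.1 i.2))
    exact (measurable_apply_query hf
      (ih i i.2 fun j hj => hζ j (hj.trans i.2.le))).add (hε i)

lemma measurable_obs_of (hr : IsIRGPUCBRun P k σ s f ε ζ x) : ∀ m : MeasurableSpace Ω,
    (∀ z, Measurable[m] (f z)) → (∀ t, Measurable[m] (ε t)) → ∀ t,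
    (∀ i ≤ t, Measurable[m] (ζ i)) → Measurable[m] (obs f ε x t) := by
  have hq := hr.measurable_query_of
  intro m hf hε t hζ
  exact (measurable_apply_query hf (hq m hf hε t hζ)).add (hε t)

lemma measurable_query (hr : IsIRGPUCBRun P k σ s f ε ζ x) (hm : IsGPModel P k σ f ε) (t : ℕ) :
    Measurable[mΩ, ⊤] (x t) :=
  hr.measurable_query_of _ hm.measurable_f hm.measurable_noise t fun i _ => hr.measurable_param i

lemma measurable_data_of [MeasurableSpace X] (hr : IsIRGPUCBRun P k σ s f ε ζ x) :
    ∀ m : MeasurableSpace Ω,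
    (∀ z, Measurable[m] (f z)) → (∀ t, Measurable[m] (ε t)) → ∀ t,
    (∀ i < t, Measurable[m] (ζ i)) → Measurable[m] (data f ε x t) := by
  have hq := hr.measurable_query_of
  have ho := hr.measurable_obs_of
  intro m hf hε t hζ
  exact Measurable.prodMk
    (measurable_pi_lambda _ fun i => (hq m hf hε i fun j hj =>
      hζ j (hj.trans_lt i.2)).mono le_rfl le_top)
    (measurable_pi_lambda _ fun i => ho m hf hε i fun j hj => hζ j (hj.trans_lt i.2))

lemma measurable_data [MeasurableSpace X] (hr : IsIRGPUCBRun P k σ s f ε ζ x)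
    (hm : IsGPModel P k σ f ε) (t : ℕ) :
    Measurable (data f ε x t) :=
  hr.measurable_data_of _ hm.measurable_f hm.measurable_noise t fun i _ => hr.measurable_param i

variable [IsProbabilityMeasure P]

/-- The error is independent of the observations, and both together are independent of ζ. The whole
sequence ζ is included, future values too, because the regret is conditioned on all of it. -/
lemma indepFun_postError_fixedData (hr : IsIRGPUCBRun P k σ s f ε ζ x) (hm : IsGPModel P k σ f ε)
    (hk : (Matrix.of k).PosSemidef) (hσ : 0 < σ) (q : ℕ → X) (t : ℕ) (z : X) :
    IndepFun (postError k σ f ε (fun i : Fin t => q i) z) (fixedData f ε ζ q t) P := by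
  refine indepFun_prodMk_of_indepFun (hm.measurable_postError _ _) (hm.measurable_fixedObs _)
    (measurable_pi_lambda _ hr.measurable_param) (hm.indepFun_postError_fixedObs hk hσ _ _) ?_
  have hφ : Measurable fun p : (X → ℝ) × (ℕ → ℝ) =>
      (p.1 z - postMean k σ (fun i : Fin t => q i) (fun i : Fin t => p.1 (q i) + p.2 i) z,
        fun i : Fin t => p.1 (q i) + p.2 i) := by
    have h1 : Measurable fun p : (X → ℝ) × (ℕ → ℝ) => fun i : Fin t => p.1 (q i) + p.2 i := by
      fun_prop
    have h2 := (measurable_postMean (k := k) (σ := σ) (fun i : Fin t => q i) z).comp h1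
    exact (Measurable.sub (by fun_prop) h2).prodMk h1
  exact hr.indep_model_param.comp hφ measurable_id

variable [MeasurableSpace X]

/-- The confidence parameter of step `t` is independent of the past. -/
lemma indepFun_past_param (hr : IsIRGPUCBRun P k σ s f ε ζ x) (hm : IsGPModel P k σ f ε) (t : ℕ) :
    IndepFun (fun ω => (data f ε x t ω, fun i : Fin t => ζ i ω)) (ζ t) P := by
  have hζt : Measurable fun ω (i : Fin t) => ζ i ω :=
    measurable_pi_lambda _ fun i => hr.measurable_param i
  have hfε : Measurable fun ω => ((fun z => f z ω), fun t => ε t ω) :=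
    (measurable_pi_lambda _ hm.measurable_f).prodMk (measurable_pi_lambda _ hm.measurable_noise)
  have h1 : IndepFun (ζ t) (fun ω (i : Fin t) => ζ i ω) P := by
    have h := hr.iIndep_param.indepFun_finset {t} (Finset.range t) (by simp) hr.measurable_param
    exact h.comp (φ := fun g : ({t} : Finset ℕ) → ℝ => g ⟨t, Finset.mem_singleton_self t⟩)
      (ψ := fun (g : Finset.range t → ℝ) (i : Fin t) => g ⟨i, Finset.mem_range.2 i.2⟩)
      (by fun_prop) (by fun_prop)
  have h2 : IndepFun (fun ω => (ζ t ω, fun i : Fin t => ζ i ω))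
      (fun ω => ((fun z => f z ω), fun t => ε t ω)) P :=
    hr.indep_model_param.symm.comp (φ := fun g : ℕ → ℝ => (g t, fun i : Fin t => g i)) (ψ := id)
      (by fun_prop) measurable_id
  have h3 := (indepFun_prodMk_of_indepFun (hr.measurable_param t) hζt hfε h1 h2).symm
  rw [IndepFun_iff_Indep] at h3 ⊢
  refine indep_of_indep_of_le_left h3 (Measurable.comap_le ?_)
  have hd := hr.measurable_data_of
  set m := MeasurableSpace.comap (fun ω => ((fun i : Fin t => ζ i ω),
    ((fun z => f z ω), fun t => ε t ω))) inferInstance with hmdef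
  have hG : Measurable[m] fun ω => ((fun i : Fin t => ζ i ω),
    ((fun z => f z ω), fun t => ε t ω)) := comap_measurable _
  have g1 : Measurable[m] fun ω (i : Fin t) => ζ i ω := measurable_fst.comp hG
  have g2 : Measurable[m] fun ω z => f z ω := (measurable_fst.comp measurable_snd).comp hG
  have g3 : Measurable[m] fun ω t => ε t ω := (measurable_snd.comp measurable_snd).comp hG
  refine Measurable.prodMk (hd m (fun z => (measurable_pi_apply z).comp g2)
    (fun i => (measurable_pi_apply i).comp g3) t fun i hi => ?_) g1
  exact (measurable_pi_apply (⟨i, hi⟩ : Fin t)).comp g1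

end IsIRGPUCBRun

/-! ### The regret of one step -/

section DataPosterior

variable {X : Type*} {k : X → X → ℝ} {σ C x₀ : ℝ} {t : ℕ}

/-- The posterior mean given the collected data. -/
noncomputable def dataMean (k : X → X → ℝ) (σ : ℝ) {t : ℕ} (d : (Fin t → X) × (Fin t → ℝ)) (y : X) :
    ℝ :=
  postMean k σ d.1 d.2 y

/-- The posterior standard deviation given the collected data. -/
noncomputable def dataSd (k : X → X → ℝ) (σ : ℝ) {t : ℕ} (d : (Fin t → X) × (Fin t → ℝ)) (y : X) :
    ℝ :=
  √(postVar k σ d.1 y)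

/-- The excess of the bound on the expected regret of the query `y` over a quadratic function of the
posterior standard deviation. -/
noncomputable def stepGap [Fintype X] (k : X → X → ℝ) (σ C x₀ : ℝ) {t : ℕ}
    (d : (Fin t → X) × (Fin t → ℝ)) (y : X) : ℝ :=
  optBound (dataMean k σ d) (dataSd k σ d) x₀ - dataMean k σ d y - C * dataSd k σ d y ^ 2 -
    (x₀ ^ 2 + 1) / (4 * C)

lemma dataSd_nonneg (d : (Fin t → X) × (Fin t → ℝ)) (y : X) : 0 ≤ dataSd k σ d y :=
  Real.sqrt_nonneg _

variable [Fintype X]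

lemma dataSd_le_one (hk : (Matrix.of k).PosSemidef) (hk1 : ∀ z, k z z ≤ 1) (hσ : 0 < σ)
    (d : (Fin t → X) × (Fin t → ℝ)) (y : X) : dataSd k σ d y ≤ 1 := by
  exact (Real.sqrt_le_sqrt ((postVar_le hk hσ _ _).trans (hk1 y))).trans_eq Real.sqrt_one

variable [MeasurableSpace X] [DiscreteMeasurableSpace X]

lemma measurable_dataMean (y : X) :
    Measurable fun d : (Fin t → X) × (Fin t → ℝ) => dataMean k σ d y :=
  measurable_from_prod_countable_right fun q => measurable_postMean q y

lemma measurable_dataSd (y : X) :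
    Measurable fun d : (Fin t → X) × (Fin t → ℝ) => dataSd k σ d y :=
  (Measurable.of_discrete (f := fun q : Fin t → X => √(postVar k σ q y))).comp measurable_fst

lemma measurable_stepGap :
    Measurable fun p : ((Fin t → X) × (Fin t → ℝ)) × X => stepGap k σ C x₀ p.1 p.2 := by
  refine measurable_from_prod_countable_left fun y => ?_
  exact ((((measurable_optBound measurable_dataMean measurable_dataSd).sub
    (measurable_dataMean y)).sub (((measurable_dataSd y).pow_const 2).const_mul C)).sub_const _)

end DataPosterior

/-- The pathwise union bound whose posterior mean is `optBound`. -/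
lemma ciSup_le_env_add {X : Type*} [Fintype X] [Nonempty X] (g m s : X → ℝ) (x₀ : ℝ) :
    ⨆ z, g z ≤ env m s x₀ + ∑ z, max (g z - env m s x₀) 0 :=
  ciSup_le fun y => by
    have h1 : max (g y - env m s x₀) 0 ≤ ∑ z, max (g z - env m s x₀) 0 :=
      Finset.single_le_sum (f := fun z => max (g z - env m s x₀) 0) (fun _ _ => le_max_right _ _)
        (Finset.mem_univ y)
    have h2 := le_max_left (g y - env m s x₀) 0
    linarith

namespace IsGPModel

variable {X Ω : Type*} {k : X → X → ℝ} {σ : ℝ} [MeasurableSpace Ω] {P : Measure Ω}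
  [IsProbabilityMeasure P] {f : X → Ω → ℝ} {ε : ℕ → Ω → ℝ}
  (hm : IsGPModel P k σ f ε)
include hm

lemma integrable_f (z : X) : Integrable (f z) P := (hm.memLp_f z).integrable (by norm_num)

lemma integrable_postMean_fixedObs {t : ℕ} (q : Fin t → X) (z : X) :
    Integrable (fun ω => postMean k σ q (fixedObs f ε q ω) z) P := by
  simp_rw [postMean_eq_sum]
  exact integrable_finsetSum _ fun i _ =>
    ((hm.memLp_fixedObs q i).integrable (by norm_num)).const_mul _

lemma integrable_iSup_f [Fintype X] [Nonempty X] : Integrable (fun ω => ⨆ z, f z ω) P := by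
  refine (integrable_finsetSum Finset.univ fun z _ => (hm.integrable_f z).abs).mono'
    (Measurable.iSup hm.measurable_f).aestronglyMeasurable (.of_forall fun ω => ?_)
  have hb : ∀ z, |f z ω| ≤ ∑ z, |f z ω| := fun z =>
    Finset.single_le_sum (f := fun z => |f z ω|) (fun _ _ => abs_nonneg _) (Finset.mem_univ z)
  obtain ⟨z⟩ := ‹Nonempty X›
  rw [Real.norm_eq_abs, abs_le]
  exact ⟨((abs_le.1 (hb z)).1).trans (le_ciSup (f := fun z => f z ω) (finite_range _).bddAbove z),
    ciSup_le fun z => (abs_le.1 (hb z)).2⟩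

end IsGPModel

namespace IsIRGPUCBRun

variable {X Ω : Type*} {k : X → X → ℝ} {σ s : ℝ} {f : X → Ω → ℝ} {ε ζ : ℕ → Ω → ℝ}
  {x : ℕ → Ω → X}

lemma data_eq_of_forall {q : ℕ → X} {t : ℕ} {ω : Ω} (h : ∀ i < t, x i ω = q i) :
    data f ε x t ω = (fun i : Fin t => q i, fixedObs f ε (fun i : Fin t => q i) ω) := by
  ext i
  · exact h i i.2
  · simp only [data, obs, fixedObs, h i i.2]

/-- The set of outcomes with given first queries, in terms of an infinite design. -/
lemma exists_preimage_queries_eq [Nonempty X] (x : ℕ → Ω → X) {t : ℕ} (q : Fin t → X) :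
    ∃ q' : ℕ → X, (fun ω (i : Fin t) => x i ω) ⁻¹' {q} = {ω | ∀ i < t, x i ω = q' i} := by
  refine ⟨fun i => if h : i < t then q ⟨i, h⟩ else Classical.arbitrary X, ?_⟩
  ext ω
  simp only [mem_preimage, mem_singleton_iff, mem_ofPred_eq, funext_iff, Fin.forall_iff]
  refine forall_congr' fun i => forall_congr' fun hi => ?_
  rw [dif_pos hi]

variable [mΩ : MeasurableSpace Ω] {P : Measure Ω}

lemma measurableSet_forall_query_eq' (hr : IsIRGPUCBRun P k σ s f ε ζ x) (hm : IsGPModel P k σ f ε)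
    (q : ℕ → X) (t : ℕ) : MeasurableSet {ω | ∀ i < t, x i ω = q i} :=
  (hr.measurable_fixedData hm q t).comap_le _ (hr.measurableSet_forall_query_eq q (by omega))

variable [Fintype X]

lemma integrable_dataMean [Nonempty X] [IsProbabilityMeasure P]
    (hr : IsIRGPUCBRun P k σ s f ε ζ x) (hm : IsGPModel P k σ f ε) (t : ℕ) (y : X) :
    Integrable (fun ω => dataMean k σ (data f ε x t ω) y) P := by
  refine integrable_of_fibers (fun ω (i : Fin t) => x i ω) fun q => ?_
  obtain ⟨q', hq'⟩ := exists_preimage_queries_eq x q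
  rw [hq']
  refine (hm.integrable_postMean_fixedObs (fun i : Fin t => q' i) y).integrableOn.congr_fun
    (fun ω hω => ?_) (hr.measurableSet_forall_query_eq' hm q' t)
  simp only [dataMean, data_eq_of_forall hω]

lemma integrable_apply_query (hr : IsIRGPUCBRun P k σ s f ε ζ x) (hm : IsGPModel P k σ f ε) (t : ℕ)
    {g : X → Ω → ℝ} (hgm : ∀ z, Measurable (g z)) (hg : ∀ z, Integrable (g z) P) :
    Integrable (fun ω => g (x t ω) ω) P :=
  (integrable_finsetSum Finset.univ fun z _ => (hg z).abs).mono'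
    (measurable_apply_query hgm (hr.measurable_query hm t)).aestronglyMeasurable
    (.of_forall fun ω => Finset.single_le_sum (f := fun z => |g z ω|) (fun _ _ => abs_nonneg _)
      (Finset.mem_univ (x t ω)))

lemma measurable_dataMean_data [MeasurableSpace X] [DiscreteMeasurableSpace X]
    (hr : IsIRGPUCBRun P k σ s f ε ζ x) (hm : IsGPModel P k σ f ε)
    (t : ℕ) (y : X) : Measurable fun ω => dataMean k σ (data f ε x t ω) y :=
  (measurable_dataMean y).comp (hr.measurable_data hm t)

variable [IsProbabilityMeasure P]

/-- The posterior error has mean zero and is independent of the event. -/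
lemma setIntegral_postMean_eq (hr : IsIRGPUCBRun P k σ s f ε ζ x) (hm : IsGPModel P k σ f ε)
    (hk : (Matrix.of k).PosSemidef) (hσ : 0 < σ) (q : ℕ → X) (t : ℕ) (z : X) {B : Set Ω}
    (hB : MeasurableSet[MeasurableSpace.comap (fixedData f ε ζ q t) inferInstance] B) :
    ∫ ω in B, f z ω ∂P = ∫ ω in B,
      postMean k σ (fun i : Fin t => q i) (fixedObs f ε (fun i : Fin t => q i) ω) z ∂P := by
  obtain ⟨S, hS, rfl⟩ := hB
  have hU := hr.measurable_fixedData hm q t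
  rw [← sub_eq_zero, ← integral_sub (hm.integrable_f z).integrableOn
    (hm.integrable_postMean_fixedObs _ z).integrableOn]
  change ∫ ω in _, postError k σ f ε (fun i : Fin t => q i) z ω ∂P = 0
  have h := ((hr.indepFun_postError_fixedData hm hk hσ q t z).comp (φ := id)
    (ψ := S.indicator fun _ => (1 : ℝ)) measurable_id
    (measurable_const.indicator hS)).integral_fun_mul_eq_mul_integral
    (hm.measurable_postError _ z).aestronglyMeasurable
    ((measurable_const.indicator hS).comp hU).aestronglyMeasurable
  simp only [Function.comp_apply, id_eq, hm.integral_postError, zero_mul] at h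
  rw [← integral_indicator (hU hS), ← h]
  congr 1 with ω
  by_cases hω : fixedData f ε ζ q t ω ∈ S <;> simp [Set.indicator, hω]

variable [Nonempty X]

/-- The union bound `ciSup_le_env_add` is integrated over the event, each positive part being
evaluated by `setIntegral_max_add`. -/
lemma setIntegral_iSup_le (hr : IsIRGPUCBRun P k σ s f ε ζ x) (hm : IsGPModel P k σ f ε)
    (hk : (Matrix.of k).PosSemidef) (hk1 : ∀ z, k z z ≤ 1) (hσ : 0 < σ) (q : ℕ → X) (t : ℕ) (x₀ : ℝ)
    {B : Set Ω}
    (hB : MeasurableSet[MeasurableSpace.comap (fixedData f ε ζ q t) inferInstance] B) :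
    ∫ ω in B, ⨆ z, f z ω ∂P ≤ ∫ ω in B,
      optBound (fun y => postMean k σ (fun i : Fin t => q i) (fixedObs f ε (fun i : Fin t => q i) ω) y)
        (fun y => √(postVar k σ (fun i : Fin t => q i) y)) x₀ ∂P := by
  obtain ⟨S, hS, rfl⟩ := hB
  have hU := hr.measurable_fixedData hm q t
  set Q : Fin t → X := fun i => q i with hQ
  set sd : X → ℝ := fun y => √(postVar k σ Q y) with hsd
  have hsd0 : ∀ y, 0 ≤ sd y := fun y => Real.sqrt_nonneg _
  have hsd1 : ∀ y, sd y ≤ 1 := fun y =>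
    (Real.sqrt_le_sqrt ((postVar_le hk hσ _ _).trans (hk1 y))).trans_eq Real.sqrt_one
  set mn : (Fin t → ℝ) × (ℕ → ℝ) → X → ℝ := fun u y => postMean k σ Q u.1 y with hmn
  have hmnm : ∀ y, Measurable fun u => mn u y := fun y =>
    (measurable_postMean Q y).comp measurable_fst
  have hem : Measurable fun u => env (mn u) sd x₀ := measurable_env hmnm fun y => measurable_const
  have himn : ∀ y, Integrable (fun ω => mn (fixedData f ε ζ q t ω) y) P := fun y =>
    hm.integrable_postMean_fixedObs Q y
  have hie : Integrable (fun ω => env (mn (fixedData f ε ζ q t ω)) sd x₀) P :=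
    ((integrable_finsetSum Finset.univ fun y _ => (himn y).abs).add (integrable_const |x₀|)).mono'
      (hem.comp hU).aestronglyMeasurable (.of_forall fun ω => abs_env_le hsd0 hsd1)
  have himax : ∀ z, Integrable
      (fun ω => max (f z ω - env (mn (fixedData f ε ζ q t ω)) sd x₀) 0) P := fun z =>
    ((hm.integrable_f z).sub hie).pos_part
  have hsum := integrable_finsetSum Finset.univ fun z _ => himax z
  have hopt : Integrable (fun ω => optBound (mn (fixedData f ε ζ q t ω)) sd x₀) P :=
    integrable_optBound (m := fun ω => mn (fixedData f ε ζ q t ω)) (s := fun _ => sd)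
      (fun y => (hmnm y).comp hU) (fun y => measurable_const) (fun _ => hsd0) (fun _ => hsd1) himn
  have hinner : ∀ z, ∫ ω in fixedData f ε ζ q t ⁻¹' S,
      max (f z ω - env (mn (fixedData f ε ζ q t ω)) sd x₀) 0 ∂P =
      ∫ ω in fixedData f ε ζ q t ⁻¹' S, ∫ n, max (mn (fixedData f ε ζ q t ω) z + n * sd z -
        env (mn (fixedData f ε ζ q t ω)) sd x₀) 0 ∂gaussianReal 0 1 ∂P := fun z => by
    have h := setIntegral_max_add hU (hm.measurable_postError Q z)
      (hr.indepFun_postError_fixedData hm hk hσ q t z) (hm.postVar_nonneg hk hσ Q z)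
      (hm.map_postError hk hσ Q z) (φ := fun u => mn u z - env (mn u) sd x₀)
      ((hmnm z).sub hem) ((himn z).sub hie)
      ((hm.memLp_postError Q z).integrable (by norm_num)) hS
    have e1 : ∀ ω, mn (fixedData f ε ζ q t ω) z - env (mn (fixedData f ε ζ q t ω)) sd x₀ +
        postError k σ f ε Q z ω = f z ω - env (mn (fixedData f ε ζ q t ω)) sd x₀ := fun ω => by
      simp only [postError, hmn, fixedData, ← hQ]; ring
    simp_rw [e1] at h
    rw [h]
    simp only [sub_add_eq_add_sub, hsd]
  have hiopt : ∀ z, Integrable (fun ω => ∫ n, max (mn (fixedData f ε ζ q t ω) z + n * sd z -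
        env (mn (fixedData f ε ζ q t ω)) sd x₀) 0 ∂gaussianReal 0 1) P := fun z => by
    have hmeas : Measurable fun u => ∫ n, max (mn u z + n * sd z - env (mn u) sd x₀) 0
        ∂gaussianReal 0 1 := by
      refine (StronglyMeasurable.integral_prod_right' (f := fun p : ((Fin t → ℝ) × (ℕ → ℝ)) × ℝ =>
        max (mn p.1 z + p.2 * sd z - env (mn p.1) sd x₀) 0) ?_).measurable
      have h1 := (hmnm z).comp (measurable_fst :
        Measurable (Prod.fst : ((Fin t → ℝ) × (ℕ → ℝ)) × ℝ → _))
      have h3 := hem.comp (measurable_fst :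
        Measurable (Prod.fst : ((Fin t → ℝ) × (ℕ → ℝ)) × ℝ → _))
      exact (((h1.add (measurable_snd.mul_const _)).sub h3).max measurable_const).stronglyMeasurable
    refine (hopt.sub hie).mono' (hmeas.comp hU).aestronglyMeasurable (.of_forall fun ω => ?_)
    rw [Real.norm_eq_abs, abs_of_nonneg (integral_nonneg fun n => le_max_right _ _)]
    simp only [Pi.sub_apply, optBound, add_sub_cancel_left]
    exact Finset.single_le_sum (f := fun z => ∫ n, max (mn (fixedData f ε ζ q t ω) z + n * sd z -
        env (mn (fixedData f ε ζ q t ω)) sd x₀) 0 ∂gaussianReal 0 1)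
        (fun _ _ => integral_nonneg fun n => le_max_right _ _) (Finset.mem_univ z)
  calc ∫ ω in fixedData f ε ζ q t ⁻¹' S, ⨆ z, f z ω ∂P
      ≤ ∫ ω in fixedData f ε ζ q t ⁻¹' S, (env (mn (fixedData f ε ζ q t ω)) sd x₀ +
          ∑ z, max (f z ω - env (mn (fixedData f ε ζ q t ω)) sd x₀) 0) ∂P :=
        setIntegral_mono hm.integrable_iSup_f.integrableOn (hie.add hsum).integrableOn
          fun ω => ciSup_le_env_add _ _ _ _
    _ = ∫ ω in fixedData f ε ζ q t ⁻¹' S, (env (mn (fixedData f ε ζ q t ω)) sd x₀ +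
          ∑ z, ∫ n, max (mn (fixedData f ε ζ q t ω) z + n * sd z -
            env (mn (fixedData f ε ζ q t ω)) sd x₀) 0 ∂gaussianReal 0 1) ∂P := by
        rw [integral_add hie.integrableOn hsum.integrableOn,
          integral_add hie.integrableOn
            (integrable_finsetSum _ fun z _ => hiopt z).integrableOn,
          integral_finsetSum _ fun z _ => (himax z).integrableOn,
          integral_finsetSum _ fun z _ => (hiopt z).integrableOn]
        simp_rw [hinner]
    _ = _ := rfl

variable [MeasurableSpace X] [DiscreteMeasurableSpace X]

lemma integrable_optBound_data (hr : IsIRGPUCBRun P k σ s f ε ζ x) (hm : IsGPModel P k σ f ε)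
    (hk : (Matrix.of k).PosSemidef) (hk1 : ∀ z, k z z ≤ 1) (hσ : 0 < σ) (t : ℕ) (x₀ : ℝ) :
    Integrable (fun ω =>
      optBound (dataMean k σ (data f ε x t ω)) (dataSd k σ (data f ε x t ω)) x₀) P :=
  integrable_optBound (hr.measurable_dataMean_data hm t)
    (fun y => (measurable_dataSd y).comp (hr.measurable_data hm t))
    (fun _ => dataSd_nonneg _) (fun _ => dataSd_le_one hk hk1 hσ _) (hr.integrable_dataMean hm t)

/-- The regret of one step is bounded in terms of the posterior, on average over any event that
depends on the confidence parameters only. -/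
lemma setIntegral_regret_le (hr : IsIRGPUCBRun P k σ s f ε ζ x) (hm : IsGPModel P k σ f ε)
    (hk : (Matrix.of k).PosSemidef) (hk1 : ∀ z, k z z ≤ 1) (hσ : 0 < σ) (t : ℕ) (x₀ : ℝ)
    {S : Set Ω} (hS : MeasurableSet[paramSigma ζ] S) :
    ∫ ω in S, ((⨆ z, f z ω) - f (x t ω) ω) ∂P ≤ ∫ ω in S,
      (optBound (dataMean k σ (data f ε x t ω)) (dataSd k σ (data f ε x t ω)) x₀ -
        dataMean k σ (data f ε x t ω) (x t ω)) ∂P := by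
  have i1 := hm.integrable_iSup_f
  have i2 := hr.integrable_apply_query hm t hm.measurable_f hm.integrable_f
  have i3 := hr.integrable_optBound_data hm hk hk1 hσ t x₀
  have i4 := hr.integrable_apply_query hm t (hr.measurable_dataMean_data hm t)
    (hr.integrable_dataMean hm t)
  -- The fibers fix t + 1 queries, so that the current query is a constant too. By the off-by-one in
  -- `measurableSet_forall_query_eq`, t observations and ζ still decide them.
  have hQ : ∀ q, MeasurableSet ((fun ω (i : Fin (t + 1)) => x i ω) ⁻¹' {q}) := fun q => by
    obtain ⟨q', hq'⟩ := exists_preimage_queries_eq x q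
    rw [hq']
    exact hr.measurableSet_forall_query_eq' hm q' (t + 1)
  refine setIntegral_le_of_fibers hQ (i1.sub i2) (i3.sub i4) (hr.paramSigma_le _ hS) fun q => ?_
  obtain ⟨q', hq'⟩ := exists_preimage_queries_eq x q
  have hSU : MeasurableSet[MeasurableSpace.comap (fixedData f ε ζ q' t) inferInstance] S := by
    obtain ⟨B, hB, rfl⟩ := hS
    exact ⟨Prod.snd ⁻¹' B, measurable_snd hB, rfl⟩
  have hfib := hSU.inter (hr.measurableSet_forall_query_eq q' (le_refl (t + 1)))
  have hB := (hr.measurable_fixedData hm q' t).comap_le _ hfib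
  rw [hq']
  have hin : ∀ ω ∈ S ∩ {ω | ∀ i < t + 1, x i ω = q' i}, x t ω = q' t ∧
      data f ε x t ω = (fun i : Fin t => q' i, fixedObs f ε (fun i : Fin t => q' i) ω) :=
    fun ω hω => ⟨hω.2 t (Nat.lt_succ_self t), data_eq_of_forall fun i hi => hω.2 i (hi.trans
      (Nat.lt_succ_self t))⟩
  have e2 : ∫ ω in S ∩ {ω | ∀ i < t + 1, x i ω = q' i}, f (x t ω) ω ∂P =
      ∫ ω in S ∩ {ω | ∀ i < t + 1, x i ω = q' i}, f (q' t) ω ∂P :=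
    setIntegral_congr_fun hB fun ω hω => by simp only [(hin ω hω).1]
  have e3 : ∫ ω in S ∩ {ω | ∀ i < t + 1, x i ω = q' i},
      optBound (dataMean k σ (data f ε x t ω)) (dataSd k σ (data f ε x t ω)) x₀ ∂P =
      ∫ ω in S ∩ {ω | ∀ i < t + 1, x i ω = q' i},
      optBound (fun y => postMean k σ (fun i : Fin t => q' i)
        (fixedObs f ε (fun i : Fin t => q' i) ω) y)
        (fun y => √(postVar k σ (fun i : Fin t => q' i) y)) x₀ ∂P :=
    setIntegral_congr_fun hB fun ω hω => by simp only [(hin ω hω).2]; rfl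
  have e4 : ∫ ω in S ∩ {ω | ∀ i < t + 1, x i ω = q' i},
      dataMean k σ (data f ε x t ω) (x t ω) ∂P =
      ∫ ω in S ∩ {ω | ∀ i < t + 1, x i ω = q' i}, postMean k σ (fun i : Fin t => q' i)
        (fixedObs f ε (fun i : Fin t => q' i) ω) (q' t) ∂P :=
    setIntegral_congr_fun hB fun ω hω => by simp only [(hin ω hω).1, (hin ω hω).2]; rfl
  simp only [Pi.sub_apply]
  rw [integral_sub i1.integrableOn i2.integrableOn, integral_sub i3.integrableOn i4.integrableOn,
    e2, e3, e4, hr.setIntegral_postMean_eq hm hk hσ q' t (q' t) hfib]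
  exact sub_le_sub_right (hr.setIntegral_iSup_le hm hk hk1 hσ q' t x₀ hfib) _

end IsIRGPUCBRun

/-! ### Exponential moments along the run -/

section Past

variable {X : Type*} {T : ℕ}

/-- The data collected before step `i`. -/
def truncate (i : Fin T) (d : (Fin T → X) × (Fin T → ℝ)) : (Fin i → X) × (Fin i → ℝ) :=
  (fun j => d.1 ⟨j, j.2.trans i.2⟩, fun j => d.2 ⟨j, j.2.trans i.2⟩)

variable [MeasurableSpace X]

lemma measurable_truncate (i : Fin T) : Measurable (truncate (X := X) i) :=
  Measurable.prodMk
    (measurable_pi_lambda _ fun _ => (measurable_pi_apply _).comp measurable_fst)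
    (measurable_pi_lambda _ fun _ => (measurable_pi_apply _).comp measurable_snd)

/-- The sum of the gaps of the first `T` steps as a function of the collected data. -/
noncomputable def pastGap [Fintype X] (k : X → X → ℝ) (σ C x₀ : ℝ)
    (d : (Fin T → X) × (Fin T → ℝ)) : ℝ :=
  ∑ i : Fin T, stepGap k σ C x₀ (truncate i d) (d.1 i)

variable [Fintype X] [DiscreteMeasurableSpace X] {k : X → X → ℝ} {σ C x₀ : ℝ}

lemma measurable_stepGap_truncate (i : Fin T) :
    Measurable fun d : (Fin T → X) × (Fin T → ℝ) => stepGap k σ C x₀ (truncate i d) (d.1 i) := by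
  have h1 : Measurable fun d : (Fin T → X) × (Fin T → ℝ) => (truncate i d, d.1 i) :=
    (measurable_truncate i).prodMk ((measurable_pi_apply i).comp measurable_fst)
  have h2 := (measurable_stepGap (k := k) (σ := σ) (C := C) (x₀ := x₀)).comp h1
  simp only [Function.comp_def] at h2
  exact h2

lemma measurable_pastGap :
    Measurable fun d : (Fin T → X) × (Fin T → ℝ) => pastGap k σ C x₀ d := by
  unfold pastGap
  exact Finset.measurable_sum _ fun i _ => measurable_stepGap_truncate i

end Past

namespace IsIRGPUCBRun

variable {X Ω : Type*} [Nonempty X] [MeasurableSpace X]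
  [DiscreteMeasurableSpace X] {k : X → X → ℝ} {σ s : ℝ} [mΩ : MeasurableSpace Ω] {P : Measure Ω}
  {f : X → Ω → ℝ} {ε ζ : ℕ → Ω → ℝ} {x : ℕ → Ω → X}

/-- The query is a measurable function of the past and the current confidence parameter. -/
lemma exists_measurable_query_eq [Countable X] (hr : IsIRGPUCBRun P k σ s f ε ζ x) (t : ℕ) :
    ∃ sel : (((Fin t → X) × (Fin t → ℝ)) × (Fin t → ℝ)) × ℝ → X, Measurable sel ∧
      ∀ ω, x t ω = sel ((data f ε x t ω, fun i : Fin t => ζ i ω), ζ t ω) := by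
  have hq := hr.query_measurable t
  set V : Ω → (((Fin t → X) × (Fin t → ℝ)) × (Fin t → ℝ)) × ℝ :=
    fun ω => ((data f ε x t ω, fun i : Fin t => ζ i ω), ζ t ω) with hV
  have hle : history f ε ζ x t ≤ MeasurableSpace.comap V inferInstance := by
    have hVm : Measurable[MeasurableSpace.comap V inferInstance] V := comap_measurable _
    generalize MeasurableSpace.comap V inferInstance = m at hVm
    refine Measurable.comap_le (Measurable.prodMk (measurable_snd.comp
      (measurable_fst.comp (measurable_fst.comp hVm))) (measurable_pi_lambda _ fun i => ?_))
    rcases Nat.lt_succ_iff_lt_or_eq.1 i.2 with hi | hi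
    · exact (measurable_pi_apply (⟨i, hi⟩ : Fin t)).comp
        (measurable_snd.comp (measurable_fst.comp hVm))
    · rw [hi]; exact measurable_snd.comp hVm
  obtain ⟨sel, hsel, h⟩ := (hq.mono hle le_top).exists_eq_measurable_comp
  exact ⟨sel, hsel, congrFun h⟩

variable [Fintype X] [IsProbabilityMeasure P]

/-- Induction on T. The earlier gaps are functions of the past, and the current query is a function
of the past and of ζ_T, which is independent of it. Integrating ζ_T first costs one factor exp(9
l²). -/
lemma lintegral_exp_sum_stepGap_le (hcard : 2 ≤ Fintype.card X)
    (hr : IsIRGPUCBRun P k σ (shift (Fintype.card X)) f ε ζ x) (hm : IsGPModel P k σ f ε)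
    (hk : (Matrix.of k).PosSemidef) (hk1 : ∀ z, k z z ≤ 1) (hσ : 0 < σ) {C l : ℝ} (hC : 0 < C)
    (hl : 0 ≤ l) (T : ℕ) :
    ∫⁻ ω, ENNReal.ofReal (rexp (l * ∑ t ∈ Finset.range T,
      stepGap k σ C √(shift (Fintype.card X)) (data f ε x t ω) (x t ω))) ∂P ≤
      ENNReal.ofReal (rexp (9 * l ^ 2 * T)) := by
  have hS0 : 0 ≤ shift (Fintype.card X) :=
    mul_nonneg two_pos.le (Real.log_nonneg (by
      have : (2 : ℝ) ≤ Fintype.card X := by exact_mod_cast hcard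
      linarith))
  set S := shift (Fintype.card X) with hS
  induction T with
  | zero => simp
  | succ T ih =>
    set W : Ω → ((Fin T → X) × (Fin T → ℝ)) × (Fin T → ℝ) :=
      fun ω => (data f ε x T ω, fun i : Fin T => ζ i ω) with hW
    have hWm : Measurable W :=
      (hr.measurable_data hm T).prodMk (measurable_pi_lambda _ fun i => hr.measurable_param i)
    have hVm : Measurable fun ω => (W ω, ζ T ω) := hWm.prodMk (hr.measurable_param T)
    obtain ⟨sel, hsel, hselx⟩ := hr.exists_measurable_query_eq T
    have hselt : Measurable[_, ⊤] sel := fun _ _ => hsel .of_discrete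
    set ν := shiftedExp S (1 / 2) with hν
    have hνlaw : P.map (ζ T) = ν := (hr.law_param T).map_eq
    have : IsProbabilityMeasure ν :=
      hνlaw ▸ Measure.isProbabilityMeasure_map (hr.measurable_param T).aemeasurable
    have hlaw : P.map (fun ω => (W ω, ζ T ω)) = (P.map W).prod ν := by
      rw [← hνlaw]
      exact (indepFun_iff_map_prod_eq_prod_map_map hWm.aemeasurable
        (hr.measurable_param T).aemeasurable).1 (hr.indepFun_past_param hm T)
    set H := pastGap (X := X) k σ C √S (T := T)
    have hHm : Measurable H := measurable_pastGap
    have hHeq : ∀ ω, ∑ t ∈ Finset.range T, stepGap k σ C √S (data f ε x t ω) (x t ω) =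
        H (W ω).1 := fun ω => Finset.sum_range _
    set A : ((Fin T → X) × (Fin T → ℝ)) × (Fin T → ℝ) → ℝ≥0∞ :=
      fun w => ENNReal.ofReal (rexp (l * H w.1)) with hA
    set B : (((Fin T → X) × (Fin T → ℝ)) × (Fin T → ℝ)) × ℝ → ℝ≥0∞ :=
      fun p => ENNReal.ofReal (rexp (l * stepGap k σ C √S p.1.1 (sel p))) with hB
    have hAm : Measurable A := by
      have := hHm.comp (measurable_fst : Measurable (Prod.fst :
        ((Fin T → X) × (Fin T → ℝ)) × (Fin T → ℝ) → (Fin T → X) × (Fin T → ℝ)))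
      exact ((this.const_mul l).exp).ennreal_ofReal
    have hfst : Measurable fun p : (((Fin T → X) × (Fin T → ℝ)) × (Fin T → ℝ)) × ℝ => p.1.1 :=
      measurable_fst.comp measurable_fst
    have hBm : Measurable B :=
      (((measurable_stepGap.comp (hfst.prodMk hsel)).const_mul l).exp).ennreal_ofReal
    have hABm : Measurable fun p : (((Fin T → X) × (Fin T → ℝ)) × (Fin T → ℝ)) × ℝ =>
        A p.1 * B p := (hAm.comp measurable_fst).mul hBm
    have hmax : ∀ᵐ p ∂(P.map W).prod ν, ∀ z,
        dataMean k σ p.1.1 z + √p.2 * dataSd k σ p.1.1 z ≤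
          dataMean k σ p.1.1 (sel p) + √p.2 * dataSd k σ p.1.1 (sel p) := by
      rw [← hlaw, ae_map_iff hVm.aemeasurable]
      · refine .of_forall fun ω z => ?_
        have h := hr.query_isMax T ω z
        rw [hselx ω] at h
        exact h
      · have hmz : ∀ z, Measurable
            fun p : (((Fin T → X) × (Fin T → ℝ)) × (Fin T → ℝ)) × ℝ => dataMean k σ p.1.1 z :=
          fun z => (measurable_dataMean z).comp hfst
        have hsz : ∀ z, Measurable
            fun p : (((Fin T → X) × (Fin T → ℝ)) × (Fin T → ℝ)) × ℝ => dataSd k σ p.1.1 z :=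
          fun z => (measurable_dataSd z).comp hfst
        have hsq : Measurable fun p : (((Fin T → X) × (Fin T → ℝ)) × (Fin T → ℝ)) × ℝ => √p.2 :=
          measurable_snd.sqrt
        rw [show {p : (((Fin T → X) × (Fin T → ℝ)) × (Fin T → ℝ)) × ℝ | ∀ z,
            dataMean k σ p.1.1 z + √p.2 * dataSd k σ p.1.1 z ≤
              dataMean k σ p.1.1 (sel p) + √p.2 * dataSd k σ p.1.1 (sel p)} = ⋂ z,
            {p | dataMean k σ p.1.1 z + √p.2 * dataSd k σ p.1.1 z ≤
              dataMean k σ p.1.1 (sel p) + √p.2 * dataSd k σ p.1.1 (sel p)} from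
          ofPred_forall _]
        exact MeasurableSet.iInter fun z => measurableSet_le ((hmz z).add (hsq.mul (hsz z)))
          ((measurable_apply_query hmz hselt).add (hsq.mul (measurable_apply_query hsz hselt)))
    have hinner : ∀ᵐ w ∂P.map W, ∫⁻ b, B (w, b) ∂ν ≤ ENNReal.ofReal (rexp (9 * l ^ 2)) := by
      filter_upwards [Measure.ae_ae_of_ae_prod hmax] with w hw
      have h := lintegral_exp_optBound_le hcard (m := dataMean k σ w.1) (s := dataSd k σ w.1)
        (dataSd_nonneg _) (dataSd_le_one hk hk1 hσ _) (sel := fun b => sel (w, b))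
        (hselt.comp measurable_prodMk_left) hw hC hl
      simpa only [hB, stepGap, Real.sq_sqrt hS0] using h
    calc ∫⁻ ω, ENNReal.ofReal (rexp (l * ∑ t ∈ Finset.range (T + 1),
          stepGap k σ C √S (data f ε x t ω) (x t ω))) ∂P
        = ∫⁻ ω, A (W ω) * B (W ω, ζ T ω) ∂P := by
          refine lintegral_congr fun ω => ?_
          rw [Finset.sum_range_succ, hHeq, mul_add, exp_add, ENNReal.ofReal_mul (exp_pos _).le,
            hselx ω]
      _ = ∫⁻ p, A p.1 * B p ∂(P.map W).prod ν := by
          rw [← hlaw, lintegral_map hABm hVm]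
      _ = ∫⁻ w, A w * ∫⁻ b, B (w, b) ∂ν ∂P.map W := by
          rw [lintegral_prod _ hABm.aemeasurable]
          have hBw : ∀ w, Measurable fun b => B (w, b) := fun w => hBm.comp measurable_prodMk_left
          exact lintegral_congr fun w => lintegral_const_mul (A w) (hBw w)
      _ ≤ ∫⁻ w, A w * ENNReal.ofReal (rexp (9 * l ^ 2)) ∂P.map W :=
          lintegral_mono_ae (hinner.mono fun w hw => by gcongr)
      _ = (∫⁻ ω, ENNReal.ofReal (rexp (l * ∑ t ∈ Finset.range T,
          stepGap k σ C √S (data f ε x t ω) (x t ω))) ∂P) * ENNReal.ofReal (rexp (9 * l ^ 2)) := by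
          rw [lintegral_mul_const _ hAm, lintegral_map hAm hWm]
          simp_rw [hHeq, hA]
      _ ≤ ENNReal.ofReal (rexp (9 * l ^ 2 * T)) * ENNReal.ofReal (rexp (9 * l ^ 2)) := by
          gcongr
      _ = _ := by
          rw [← ENNReal.ofReal_mul (exp_pos _).le, ← exp_add]
          push_cast
          ring_nf

end IsIRGPUCBRun

/-! ### The regret bound -/

/-- Basel sum of the failure probabilities exp(-L_T) over T = n + 1. -/
lemma hasSum_three_mul_div_pi_sq (δ : ℝ) :
    HasSum (fun n : ℕ => 3 * δ / (π ^ 2 * ((n + 1 : ℕ) : ℝ) ^ 2)) (δ / 2) := by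
  have h := ((hasSum_nat_add_iff' 1).2 hasSum_zeta_two).mul_left (3 * δ / π ^ 2)
  have hval : 3 * δ / π ^ 2 * (π ^ 2 / 6 - ∑ i ∈ Finset.range 1, 1 / (i : ℝ) ^ 2) = δ / 2 := by
    simp only [Finset.range_one, Finset.sum_singleton]
    field_simp
    norm_num
    ring
  rw [hval] at h
  simpa only [mul_one_div, div_div] using h

lemma two_div_log_one_add_inv_sq_pos {σ : ℝ} (hσ : 0 < σ) : 0 < 2 / log (1 + (σ ^ 2)⁻¹) :=
  div_pos two_pos (Real.log_pos (by
    have : 0 < (σ ^ 2)⁻¹ := by positivity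
    linarith))

lemma regretBound_nonneg (σ γ s : ℝ) (T : ℕ) (δ : ℝ) : 0 ≤ regretBound σ γ s T δ := by
  unfold regretBound; positivity

namespace IsGPModel

variable {X Ω : Type*} [Fintype X] {k : X → X → ℝ} {σ : ℝ} [MeasurableSpace Ω] {P : Measure Ω}
  [IsProbabilityMeasure P] {f : X → Ω → ℝ} {ε : ℕ → Ω → ℝ}

/-- If no information can be gained, then the Gaussian process vanishes. -/
lemma ae_eq_zero_of_maxInfoGain_eq_zero (hm : IsGPModel P k σ f ε) (hk : (Matrix.of k).PosSemidef)
    (hk1 : ∀ z, k z z ≤ 1) (hσ : 0 < σ) {T : ℕ} (hT : 1 ≤ T) (hγ : maxInfoGain P f ε T = 0)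
    (z : X) : f z =ᵐ[P] 0 := by
  have h1 := hm.sum_postVar_le hk hk1 hσ (fun _ => z) T
  rw [hγ, mul_zero] at h1
  have h2 := (Finset.single_le_sum (f := fun t : ℕ => postVar k σ (fun _ : Fin t => z) z)
    (fun t _ => hm.postVar_nonneg hk hσ _ _) (Finset.mem_range.2 hT)).trans h1
  -- Before any observation the posterior variance is the prior variance.
  have h3 : postVar k σ (fun _ : Fin 0 => z) z = k z z := by simp [postVar]
  rw [h3, ← hm.cov_f, covariance_self (hm.measurable_f z).aemeasurable] at h2
  have h4 := ae_eq_integral_of_variance_eq_zero (hm.memLp_f z)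
    (le_antisymm h2 (variance_nonneg _ _))
  rw [hm.mean_f] at h4
  exact h4

end IsGPModel

namespace IsIRGPUCBRun

variable {X Ω : Type*} [Fintype X] {k : X → X → ℝ} {σ s : ℝ} [mΩ : MeasurableSpace Ω]
  {P : Measure Ω} [IsProbabilityMeasure P] {f : X → Ω → ℝ} {ε ζ : ℕ → Ω → ℝ} {x : ℕ → Ω → X}

lemma sum_dataSd_sq_le (hm : IsGPModel P k σ f ε) (hk : (Matrix.of k).PosSemidef)
    (hk1 : ∀ z, k z z ≤ 1) (hσ : 0 < σ) (x : ℕ → Ω → X) (T : ℕ) (ω : Ω) :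
    ∑ t ∈ Finset.range T, dataSd k σ (data f ε x t ω) (x t ω) ^ 2 ≤
      2 / log (1 + (σ ^ 2)⁻¹) * maxInfoGain P f ε T := by
  refine le_of_eq_of_le (Finset.sum_congr rfl fun t _ => ?_)
    (hm.sum_postVar_le hk hk1 hσ (fun t => x t ω) T)
  exact Real.sq_sqrt (hm.postVar_nonneg hk hσ _ _)

variable [Nonempty X]

lemma integrable_cumRegret (hr : IsIRGPUCBRun P k σ s f ε ζ x) (hm : IsGPModel P k σ f ε) (T : ℕ) :
    Integrable (cumRegret f x T) P :=
  integrable_finsetSum _ fun t _ =>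
    hm.integrable_iSup_f.sub (hr.integrable_apply_query hm t hm.measurable_f hm.integrable_f)

variable [MeasurableSpace X] [DiscreteMeasurableSpace X]

lemma integrable_stepGap (hr : IsIRGPUCBRun P k σ s f ε ζ x) (hm : IsGPModel P k σ f ε)
    (hk : (Matrix.of k).PosSemidef) (hk1 : ∀ z, k z z ≤ 1) (hσ : 0 < σ) (C x₀ : ℝ) (t : ℕ) :
    Integrable (fun ω => stepGap k σ C x₀ (data f ε x t ω) (x t ω)) P := by
  have hsm : ∀ y, Measurable fun ω => dataSd k σ (data f ε x t ω) y ^ 2 := fun y =>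
    ((measurable_dataSd y).comp (hr.measurable_data hm t)).pow_const 2
  have hsi : ∀ y, Integrable (fun ω => dataSd k σ (data f ε x t ω) y ^ 2) P := fun y =>
    (integrable_const (1 : ℝ)).mono' (hsm y).aestronglyMeasurable (.of_forall fun ω => by
      rw [Real.norm_eq_abs, abs_of_nonneg (sq_nonneg _)]
      exact pow_le_one₀ (dataSd_nonneg _ _) (dataSd_le_one hk hk1 hσ _ _))
  exact ((((hr.integrable_optBound_data hm hk hk1 hσ t x₀).sub
    (hr.integrable_apply_query hm t (hr.measurable_dataMean_data hm t)
      (hr.integrable_dataMean hm t))).sub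
    ((hr.integrable_apply_query hm t hsm hsi).const_mul C)).sub (integrable_const _))

/-- The conditional expectation of the regret is at most that of the gaps, up to a constant. -/
lemma condExp_cumRegret_le (hr : IsIRGPUCBRun P k σ s f ε ζ x) (hm : IsGPModel P k σ f ε)
    (hk : (Matrix.of k).PosSemidef) (hk1 : ∀ z, k z z ≤ 1) (hσ : 0 < σ) {C : ℝ} (hC : 0 < C)
    (x₀ : ℝ) (T : ℕ) :
    P[cumRegret f x T | paramSigma ζ] ≤ᵐ[P] fun ω =>
      P[fun ω => ∑ t ∈ Finset.range T, stepGap k σ C x₀ (data f ε x t ω) (x t ω) |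
        paramSigma ζ] ω + (C * (2 / log (1 + (σ ^ 2)⁻¹) * maxInfoGain P f ε T) +
          T * ((x₀ ^ 2 + 1) / (4 * C))) := by
  set c := C * (2 / log (1 + (σ ^ 2)⁻¹) * maxInfoGain P f ε T) +
    T * ((x₀ ^ 2 + 1) / (4 * C)) with hc
  set Y : Ω → ℝ := fun ω => ∑ t ∈ Finset.range T, stepGap k σ C x₀ (data f ε x t ω) (x t ω)
  have hY : Integrable Y P :=
    integrable_finsetSum _ fun t _ => hr.integrable_stepGap hm hk hk1 hσ C x₀ t
  have hgap : ∀ t, Integrable (fun ω =>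
      optBound (dataMean k σ (data f ε x t ω)) (dataSd k σ (data f ε x t ω)) x₀ -
        dataMean k σ (data f ε x t ω) (x t ω)) P := fun t =>
    (hr.integrable_optBound_data hm hk hk1 hσ t x₀).sub
      (hr.integrable_apply_query hm t (hr.measurable_dataMean_data hm t)
        (hr.integrable_dataMean hm t))
  have hreg : ∀ t, Integrable (fun ω => (⨆ z, f z ω) - f (x t ω) ω) P := fun t =>
    hm.integrable_iSup_f.sub (hr.integrable_apply_query hm t hm.measurable_f hm.integrable_f)
  have hle : P[cumRegret f x T | paramSigma ζ] ≤ᵐ[P] P[Y + fun _ : Ω => c | paramSigma ζ] := by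
    refine condExp_le_condExp_of_setIntegral_le hr.paramSigma_le (hr.integrable_cumRegret hm T)
      (hY.add (integrable_const c)) fun S hS => ?_
    calc ∫ ω in S, cumRegret f x T ω ∂P
        = ∑ t ∈ Finset.range T, ∫ ω in S, ((⨆ z, f z ω) - f (x t ω) ω) ∂P :=
          integral_finsetSum _ fun t _ => (hreg t).integrableOn
      _ ≤ ∑ t ∈ Finset.range T, ∫ ω in S,
          (optBound (dataMean k σ (data f ε x t ω)) (dataSd k σ (data f ε x t ω)) x₀ -
            dataMean k σ (data f ε x t ω) (x t ω)) ∂P :=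
          Finset.sum_le_sum fun t _ => hr.setIntegral_regret_le hm hk hk1 hσ t x₀ hS
      _ = ∫ ω in S, ∑ t ∈ Finset.range T,
          (optBound (dataMean k σ (data f ε x t ω)) (dataSd k σ (data f ε x t ω)) x₀ -
            dataMean k σ (data f ε x t ω) (x t ω)) ∂P :=
          (integral_finsetSum _ fun t _ => (hgap t).integrableOn).symm
      _ ≤ ∫ ω in S, (Y + fun _ : Ω => c) ω ∂P := by
          refine setIntegral_mono (integrable_finsetSum _ fun t _ => hgap t).integrableOn
            (hY.add (integrable_const c)).integrableOn fun ω => ?_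
          have h1 := mul_le_mul_of_nonneg_left (sum_dataSd_sq_le hm hk hk1 hσ x T ω) hC.le
          have h2 : Y ω = ∑ t ∈ Finset.range T,
              (optBound (dataMean k σ (data f ε x t ω)) (dataSd k σ (data f ε x t ω)) x₀ -
                dataMean k σ (data f ε x t ω) (x t ω)) -
              C * ∑ t ∈ Finset.range T, dataSd k σ (data f ε x t ω) (x t ω) ^ 2 -
              T * ((x₀ ^ 2 + 1) / (4 * C)) := by
            simp only [Y, stepGap, Finset.sum_sub_distrib, Finset.mul_sum, Finset.sum_const,
              Finset.card_range, nsmul_eq_mul]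
          simp only [Pi.add_apply, h2, hc]
          linarith
  filter_upwards [hle, condExp_add hY (integrable_const c) (paramSigma ζ)] with ω h1 h2
  rwa [h2, Pi.add_apply, condExp_const hr.paramSigma_le] at h1

/-- Chernoff's bound for a single horizon, with the trade-off parameter C and the exponent l chosen
optimally. -/
lemma measure_regretBound_lt_le
    (hr : IsIRGPUCBRun P k σ (shift (Fintype.card X)) f ε ζ x) (hm : IsGPModel P k σ f ε)
    (hk : (Matrix.of k).PosSemidef) (hk1 : ∀ z, k z z ≤ 1) (hσ : 0 < σ) {δ : ℝ} (hδ : 0 < δ)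
    (hδ1 : δ < 1) {T : ℕ} (hT : 1 ≤ T) :
    P {ω | regretBound σ (maxInfoGain P f ε T) (shift (Fintype.card X)) T δ <
      P[cumRegret f x T | paramSigma ζ] ω} ≤ ENNReal.ofReal (3 * δ / (π ^ 2 * T ^ 2)) := by
  -- Almost surely zero regret is set aside. This covers a single point and zero information gain,
  -- where the optimal C below would be undefined.
  by_cases htriv : cumRegret f x T =ᵐ[P] 0
  · have h := condExp_congr_ae (m := paramSigma ζ) htriv
    rw [condExp_zero] at h
    refine le_of_eq_of_le ?_ zero_le
    refine measure_eq_zero_iff_ae_notMem.2 (h.mono fun ω hω => ?_)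
    simp only [mem_ofPred_eq, hω, Pi.zero_apply, not_lt, regretBound_nonneg]
  have hcard : 2 ≤ Fintype.card X := by
    by_contra! h
    have : Subsingleton X := Fintype.card_le_one_iff_subsingleton.1 (by omega)
    refine htriv (.of_forall fun ω => Finset.sum_eq_zero fun t _ => ?_)
    have : ∀ z, f z ω = f (x t ω) ω := fun z => by rw [Subsingleton.elim z]
    simp [this]
  have hG : 0 < 2 / log (1 + (σ ^ 2)⁻¹) * maxInfoGain P f ε T := by
    refine mul_pos (two_div_log_one_add_inv_sq_pos hσ) (ENNReal.toReal_nonneg.lt_of_ne' fun h => ?_)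
    have h0 := ae_all_iff.2 fun z => hm.ae_eq_zero_of_maxInfoGain_eq_zero hk hk1 hσ hT h z
    refine htriv (h0.mono fun ω hω => Finset.sum_eq_zero fun t _ => ?_)
    simp [hω]
  have hS0 : 0 ≤ shift (Fintype.card X) :=
    mul_nonneg two_pos.le (Real.log_nonneg (by
      have : (2 : ℝ) ≤ Fintype.card X := by exact_mod_cast hcard
      linarith))
  have hT0 : (0 : ℝ) < T := by exact_mod_cast hT
  have hT1 : (1 : ℝ) ≤ T := by exact_mod_cast hT
  have hratio : 1 < π ^ 2 * T ^ 2 / (3 * δ) := by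
    rw [lt_div_iff₀ (by positivity)]
    nlinarith [Real.pi_gt_three, one_le_pow₀ hT1 (n := 2)]
  unfold regretBound
  set G := 2 / log (1 + (σ ^ 2)⁻¹) * maxInfoGain P f ε T with hGdef
  set S := shift (Fintype.card X) with hS
  set L := log (π ^ 2 * T ^ 2 / (3 * δ)) with hL
  have hL0 : 0 < L := Real.log_pos hratio
  obtain ⟨a, ha, haG⟩ : ∃ a, 0 < a ∧ G = a ^ 2 * T :=
    ⟨√(G / T), by positivity, by rw [Real.sq_sqrt (by positivity)]; field_simp⟩
  obtain ⟨b, hb, hbL⟩ : ∃ b, 0 < b ∧ L = b ^ 2 * T :=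
    ⟨√(L / T), by positivity, by rw [Real.sq_sqrt (by positivity)]; field_simp⟩
  obtain ⟨c, hc, hcS⟩ : ∃ c, 0 < c ∧ S + 1 = c ^ 2 :=
    ⟨√(S + 1), by positivity, by rw [Real.sq_sqrt (by positivity)]⟩
  have hTL : √(T * L) = b * T := by
    rw [hbL, show (T : ℝ) * (b ^ 2 * T) = (b * T) ^ 2 by ring, Real.sqrt_sq (by positivity)]
  -- C = c/(2a) is ½√(T(S + 1)/G), the minimizer of C G + T(S + 1)/(4C), with minimum √(G T(S + 1))
  -- = a c T.
  have hC : 0 < c / (2 * a) := by positivity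
  have hconst : c / (2 * a) * G + T * ((√S ^ 2 + 1) / (4 * (c / (2 * a)))) ≤
      √(G * (T * S + T + 2 * √(T * L) + 2 * L)) := by
    have h1 : c / (2 * a) * G + T * ((√S ^ 2 + 1) / (4 * (c / (2 * a)))) = a * c * T := by
      rw [Real.sq_sqrt hS0, hcS, haG]; field_simp; ring
    rw [h1]
    refine Real.le_sqrt_of_sq_le ?_
    have h2 : (a * c * T) ^ 2 = G * (T * S + T) := by
      rw [haG, show (T : ℝ) * S + T = T * (S + 1) by ring, hcS]; ring
    rw [h2]
    have : 0 ≤ √(T * L) := Real.sqrt_nonneg _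
    refine mul_le_mul_of_nonneg_left ?_ hG.le
    linarith
  -- The exponent l = b/3 = √(L/T)/3 minimizes 9 l² T - 6 l √(TL), and the minimum is -L.
  have hK := hr.lintegral_exp_sum_stepGap_le hcard hm hk hk1 hσ hC (l := b / 3) (by positivity) T
  have hY := integrable_finsetSum (Finset.range T) fun t _ =>
    hr.integrable_stepGap hm hk hk1 hσ (c / (2 * a)) √S t
  calc P {ω | 6 * √(T * L) + √(G * (T * S + T + 2 * √(T * L) + 2 * L)) <
        P[cumRegret f x T | paramSigma ζ] ω}
      ≤ P {ω | 6 * √(T * L) < P[fun ω => ∑ t ∈ Finset.range T,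
          stepGap k σ (c / (2 * a)) √S (data f ε x t ω) (x t ω) | paramSigma ζ] ω} := by
        refine measure_mono_ae ((hr.condExp_cumRegret_le hm hk hk1 hσ hC √S T).mono
          fun ω hω h => ?_)
        change _ < _ at h
        change _ < _
        linarith
    _ ≤ ENNReal.ofReal (rexp (9 * (b / 3) ^ 2 * T) * rexp (-(b / 3 * (6 * √(T * L))))) :=
        measure_condExp_gt_le hr.paramSigma_le hY (by positivity) hK
    _ = ENNReal.ofReal (3 * δ / (π ^ 2 * T ^ 2)) := by
        rw [← exp_add, hTL, show 9 * (b / 3) ^ 2 * T + -(b / 3 * (6 * (b * T))) = -L by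
          rw [hbL]; ring, hL, Real.exp_neg, Real.exp_log (by positivity), inv_div]

end IsIRGPUCBRun

end IRGPUCB

theorem mainTheorem3 {X Ω : Type*} [Fintype X] [Nonempty X]
    [MeasurableSpace Ω] (P : Measure Ω) [IsProbabilityMeasure P]
    (k : X → X → ℝ) (hk : (Matrix.of k).PosSemidef) (hk1 : ∀ z, k z z ≤ 1)
    (σ : ℝ) (hσ : 0 < σ) (δ : ℝ) (hδ : 0 < δ) (hδ1 : δ < 1)
    (f : X → Ω → ℝ) (ε ζ : ℕ → Ω → ℝ) (x : ℕ → Ω → X)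
    (hmodel : IsGPModel P k σ f ε)
    (hrun : IsIRGPUCBRun P k σ (shift (Fintype.card X)) f ε ζ x) :
    (∀ T : ℕ, Integrable (cumRegret f x T) P) ∧
    ENNReal.ofReal (1 - δ) ≤
      P {ω | ∀ T : ℕ, 1 ≤ T →
        (P[cumRegret f x T | paramSigma ζ]) ω ≤
          regretBound σ (maxInfoGain P f ε T) (shift (Fintype.card X)) T δ} := by
  let _ : MeasurableSpace X := ⊤
  refine ⟨hrun.integrable_cumRegret hmodel, ?_⟩
  set A : Set Ω := {ω | ∀ T : ℕ, 1 ≤ T → (P[cumRegret f x T | paramSigma ζ]) ω ≤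
    regretBound σ (maxInfoGain P f ε T) (shift (Fintype.card X)) T δ} with hA
  -- The bad events are indexed by n = T - 1, since T = 0 is excluded. Their total probability is at
  -- most δ/2.
  set B : ℕ → Set Ω := fun n =>
    {ω | regretBound σ (maxInfoGain P f ε (n + 1)) (shift (Fintype.card X)) (n + 1 : ℕ) δ <
      P[cumRegret f x (n + 1) | paramSigma ζ] ω} with hB
  have hcover : Set.univ ⊆ A ∪ ⋃ n, B n := fun ω _ => by
    by_cases hω : ω ∈ A
    · exact Or.inl hω
    · simp only [hA, Set.mem_ofPred_eq, not_forall, not_le] at hω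
      obtain ⟨T, hT, h⟩ := hω
      obtain ⟨n, rfl⟩ := Nat.exists_eq_add_of_le' hT
      exact Or.inr (Set.mem_iUnion.2 ⟨n, h⟩)
  have hsum := hasSum_three_mul_div_pi_sq δ
  have hBsum : P (⋃ n, B n) ≤ ENNReal.ofReal (δ / 2) := by
    refine (measure_iUnion_le B).trans ((ENNReal.tsum_le_tsum fun n =>
      hrun.measure_regretBound_lt_le hmodel hk hk1 hσ hδ hδ1 (Nat.le_add_left 1 n)).trans_eq ?_)
    rw [← ENNReal.ofReal_tsum_of_nonneg (fun n => by positivity) hsum.summable, hsum.tsum_eq]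
  rw [ENNReal.ofReal_sub _ hδ.le, ENNReal.ofReal_one, tsub_le_iff_right]
  calc (1 : ℝ≥0∞) = P Set.univ := measure_univ.symm
    _ ≤ P A + P (⋃ n, B n) := (measure_mono hcover).trans (measure_union_le _ _)
    _ ≤ P A + ENNReal.ofReal δ := by
        gcongr
        exact hBsum.trans (ENNReal.ofReal_le_ofReal (by linarith))
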